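/- **Setting.** Let $\varphi(t)=\max\{t,0\}$, applied entrywise to vectors. Consider a fully connected network of depth $L$ with input dimension $n_0$ and layer widths $n_1,\dots,n_L$. For an input $x\in\mathbb R^{n_0}$ put $\varphi^0=x$, $z^1=W^1x$, $\varphi^\ell=\varphi(z^\ell)$ for $\ell\ge 1$, and $z^{\ell+1}=\sqrt{2/n_\ell}\,W^{\ell+1}\varphi^\ell$, where $W^{\ell+1}\in\mathbb R^{n_{\ell+1}\times n_\ell}$ and all entries of $W^1,\dots,W^L$ are independent standard Gaussian variables. For two fixed inputs, with post-activation vectors $\varphi^\ell_\alpha,\varphi^\ell_\beta$, let $\theta^\ell\in[0,\pi]$ be the angle between $\varphi^\ell_\alpha$ and $\varphi^\ell_\beta$. It is nondegenerate in layer $\ell+1$ if $\varphi^{\ell+1}_\alpha\ne0$, $\varphi^{\ell+1}_\beta\ne 0$ and $\sin\theta^{\ell+1}\neq 0$. (For every finite width this fails with positive probability, and then $\ln\sin^2\theta^{\ell+1}$ is undefined or $-\infty$.) Let $$\rho(n)=\ln\Big(\frac{n+5}{n-1}\Big)-\frac{10n}{(n+5)^2}+\frac{6n}{(n-1)^2}.$$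 **Theorem.** There are functions $\mu(\theta,n)$ and $\sigma^2(\theta,n)$, depending only on $\theta$ and $n$, with the following properties. 1. Conditionally on $\theta^\ell=\theta$ and on nondegeneracy in layer $\ell+1$ (this forces $\theta\in(0,\pi]$), the random variable $\ln\sin^2\theta^{\ell+1}$ is square integrable once the width $n=n_{\ell+1}$ of layer $\ell+1$ is large enough, depending on $\theta$, and its conditional mean and variance satisfy, as $n\to\infty$ with $\theta$ fixed, $$\mathbf E[\ln\sin^2\theta^{\ell+1}]=\mu(\theta,n)+\mathcal O(n^{-2}),\qquad \mathbf{Var}[\ln\sin^2\theta^{\ell+1}]=\sigma^2(\theta,n)+\mathcal O(n^{-2}).$$ The thresholds and the constants in $\mathcal O(n^{-2})$ depend only on $\theta$, not on the inputs, on $\ell$, on $L$ or on the other widths. The statement holds for almost every $\theta$ with respect to the law of $\theta^\ell$ given nondegeneracy in layer $\ell+1$. 2. As $\theta\to0^+$, uniformly in $n\ge2$, $$\mu(\theta,n)=\ln\sin^2\theta-\frac{2}{3\pi}\theta-\rho(n)-\frac{8\theta}{15\pi n}-\Big(\frac{2}{9\pi^2}-\frac{68}{45\pi^2n}\Big)\theta^2+\mathcal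 O(\theta^3),$$ $$\sigma^2(\theta,n)=\frac8n-\frac{64}{15\pi}\frac{\theta}{n}-\Big(8+\frac{296}{45\pi^2}\Big)\frac{\theta^2}{n}+\mathcal O(\theta^3).$$ 3. For each fixed $\theta\in(0,\pi]$ there are numbers $m_0,m_1,s$ (depending on $\theta$ only) with $\mu(\theta,n)=m_0-\rho(n)+m_1/n$ and $\sigma^2(\theta,n)=s/n$ for all $n\ge2$. So $\mu$ and $\sigma^2$ are determined by 1 and this form, and the remainders in 2 have the form $r_0(\theta)+r_1(\theta)/n$ and $r_2(\theta)/n$ with $r_i(\theta)=\mathcal O(\theta^3)$. -/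

import Mathlib

open MeasureTheory ProbabilityTheory
open scoped Matrix

noncomputable section

namespace ReluNetwork

/-- Entrywise ReLU, `φ(z)ᵢ = max zᵢ 0`. -/
def relu {n : ℕ} (z : Fin n → ℝ) : Fin n → ℝ := fun i => max (z i) 0

/-- Weight matrices of a fully connected network whose layer `k` has width `N k` (layer `0` is the
input): `W k` maps layer `k` to layer `k + 1`. -/
abbrev Weights (N : ℕ → ℕ) : Type := ∀ k : ℕ, Matrix (Fin (N (k + 1))) (Fin (N k)) ℝ

/-- `preActivation W x k` is the pre-activation vector of layer `k + 1` for the input `x`: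
the first one is the weight matrix applied to `x`, and then each one is
`√(2 / width)` times the weight matrix applied to the ReLU of the previous one. -/
def preActivation {N : ℕ → ℕ} (W : Weights N) (x : Fin (N 0) → ℝ) :
    ∀ k : ℕ, Fin (N (k + 1)) → ℝ
  | 0 => W 0 *ᵥ x
  | k + 1 => Real.sqrt (2 / (N (k + 1) : ℝ)) • (W (k + 1) *ᵥ relu (preActivation W x k))

/-- The post-activation vector of layer `k`; in layer `0` this is the input itself. -/
def output {N : ℕ → ℕ} (W : Weights N) (x : Fin (N 0) → ℝ) :
    ∀ k : ℕ, EuclideanSpace ℝ (Fin (N k))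
  | 0 => WithLp.toLp 2 x
  | k + 1 => WithLp.toLp 2 (relu (preActivation W x k))

/-- The angle in `[0, π]` between the post-activation vectors of two inputs in layer `k`.
It is only meaningful if neither vector is zero. -/
def layerAngle {N : ℕ → ℕ} (W : Weights N) (x y : Fin (N 0) → ℝ) (k : ℕ) : ℝ :=
  InnerProductGeometry.angle (output W x k) (output W y k)

/-- The angle in layer `k` is defined and `ln sin²` of it is finite: the two post-activation
vectors are nonzero and the sine of the angle between them does not vanish. -/
def NondegenerateAt {N : ℕ → ℕ} (W : Weights N) (x y : Fin (N 0) → ℝ) (k : ℕ) : Prop :=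
  output W x k ≠ 0 ∧ output W y k ≠ 0 ∧ Real.sin (layerAngle W x y k) ≠ 0

/-- Random initialization of a network of depth `L`: all entries of the weight matrices leading
into the layers `1, …, L` are independent standard Gaussian random variables. -/
structure IsGaussianInit {Ω : Type*} [MeasurableSpace Ω] (P : Measure Ω) (L : ℕ) {N : ℕ → ℕ}
    (W : Ω → Weights N) : Prop where
  measurable_entry : ∀ k < L, ∀ i j, Measurable fun ω => W ω k i j
  gaussian_entry : ∀ k < L, ∀ i j, P.map (fun ω => W ω k i j) = gaussianReal 0 1
  indep_entries : iIndepFun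
    (fun (e : Σ k : Fin L, Fin (N (k + 1)) × Fin (N k)) (ω : Ω) => W ω e.1 e.2.1 e.2.2) P

/-- The conditional law of the angle in layer `k + 1`, given the angle in layer `k` and given the
event that the angle in layer `k + 1` is nondegenerate. -/
def condAngleLaw {Ω : Type*} [MeasurableSpace Ω] (P : Measure Ω) [IsProbabilityMeasure P]
    {N : ℕ → ℕ} (W : Ω → Weights N) (x y : Fin (N 0) → ℝ) (k : ℕ) : Kernel ℝ ℝ :=
  condDistrib (fun ω => layerAngle (W ω) x y (k + 1)) (fun ω => layerAngle (W ω) x y k)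
    (P[|{ω | NondegenerateAt (W ω) x y (k + 1)}])

/-- The law of the angle in layer `k`, given the event that the angle in layer `k + 1` is
nondegenerate. -/
def angleLaw {Ω : Type*} [MeasurableSpace Ω] (P : Measure Ω)
    {N : ℕ → ℕ} (W : Ω → Weights N) (x y : Fin (N 0) → ℝ) (k : ℕ) : Measure ℝ :=
  (P[|{ω | NondegenerateAt (W ω) x y (k + 1)}]).map (fun ω => layerAngle (W ω) x y k)

/-- `ln sin²`. -/
def logSinSq (t : ℝ) : ℝ := Real.log (Real.sin t ^ 2)

/-- The width-dependent constant in the drift of `ln sin²`. -/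
def rho (n : ℕ) : ℝ :=
  Real.log (((n : ℝ) + 5) / ((n : ℝ) - 1)) - 10 * (n : ℝ) / ((n : ℝ) + 5) ^ 2
    + 6 * (n : ℝ) / ((n : ℝ) - 1) ^ 2

/-- The small-angle expansion of the conditional mean, without its remainder. -/
def meanExpansion (θ : ℝ) (n : ℕ) : ℝ :=
  logSinSq θ - 2 / (3 * Real.pi) * θ - rho n - 8 * θ / (15 * Real.pi * n)
    - (2 / (9 * Real.pi ^ 2) - 68 / (45 * Real.pi ^ 2 * n)) * θ ^ 2

/-- The small-angle expansion of the conditional variance, without its remainder. -/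
def varExpansion (θ : ℝ) (n : ℕ) : ℝ :=
  8 / (n : ℝ) - 64 / (15 * Real.pi) * (θ / n)
    - (8 + 296 / (45 * Real.pi ^ 2)) * (θ ^ 2 / n)

end ReluNetwork

end

/-!
Write `A = √2 relu G` and `B = √2 relu Ĝ` for standard Gaussian variables `G`, `Ĝ` with correlation
`cos θ`. Given outputs `u`, `v` of a layer with angle `θ`, the pre-activations of the `n` neurons of
the next layer are, up to positive factors that angles do not see, `n` independent copies of
`(G, Ĝ)`. Hence `sin²` of the next angle is `1 - Z² / (X Y)` where `X`, `Y`, `Z` are the averages of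
`A²`, `B²`, `A B` over the neurons, and the statement is about the mean and variance of a smooth
function of averages of `n` independent variables.

*Delta method.* The averages concentrate at `(1, 1, K)` with `K = E[A B]`. The third-order Taylor
expansion of `ln (1 - Z² / (X Y))` there has an error of fourth order in the deviations
(`exists_truncLog_expansion`). The linear part has mean `0`, the quadratic part has mean
`meanCoeff θ / n`, and cubic terms and the error have expectation `O(n⁻²)`; so the mean is
`ln (1 - K²) + meanCoeff θ / n + O(n⁻²)`, and the variance is that of the linear part,
`varCoeff θ / n`, up to `O(n⁻²)` (`exists_integral_centralSet`). The coefficients are polynomials in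
the mixed moments of `A` and `B`, which polar coordinates turn into trigonometric integrals.

*Singularity of the logarithm.* Where the deviations are large, `ln sin²` is unbounded, but this set
has geometrically small probability, and it is enough that the fourth moment of `ln sin²` grows at
most polynomially (`exists_log_layerSinSq_pow_four_le`). By Lagrange's identity `X Y - Z²` is
at least the square of any `2 × 2` minor of the activations, up to a factor, and a nonzero minor has
a finite moment of order `-1/2` because it is affine in a Gaussian variable or a product of two
activations.

*Conditioning.* Independence of the weight matrices gives the joint law of two consecutive angles as
a mixture over `θ` of the laws in the model layer, so the conditional law of the next angle is
`angleKernel` (`IsGaussianInit.condAngleLaw_ae_eq`). The event of nondegeneracy contains the set on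
which the averages are close to `(1, 1, K)`, so conditioning on it changes the moments by `O(n⁻²)`
only (`exists_cond_layerLog`).

*Small angles.* Since `1 - K² ~ θ²`, the coefficients are quotients with denominator `θ⁴`, and their
expansions to order `θ²` follow from those of the moments to order `θ⁶`. Finally
`rho n = 2 / n + O(n⁻²)`, so `- rho n` can be split off from the mean.
-/

open Filter Asymptotics
open scoped Topology

namespace ReluNetwork

/-! ### Moments of the rectified pair as functions of the angle -/

/-- `E[A B]` for `A = √2 relu G`, `B = √2 relu Ĝ`, where `G, Ĝ` are standard Gaussian with
correlation `cos θ`. -/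
noncomputable def crossMoment (θ : ℝ) : ℝ :=
  (Real.sin θ + (Real.pi - θ) * Real.cos θ) / Real.pi

/-- `E[A² B²]` for the rectified pair of `crossMoment`. -/
noncomputable def sqSqMoment (θ : ℝ) : ℝ :=
  2 / Real.pi * (3 * Real.sin θ * Real.cos θ + (Real.pi - θ) * (1 + 2 * Real.cos θ ^ 2))

/-- `E[A³ B]` for the rectified pair of `crossMoment`. -/
noncomputable def cubeMoment (θ : ℝ) : ℝ :=
  2 / Real.pi * (3 * Real.cos θ * (Real.pi - θ) + 2 * Real.sin θ + Real.sin θ * Real.cos θ ^ 2)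

/-- The limit of `sin²` of the angle in the next layer as the width grows. -/
noncomputable def limitSinSq (θ : ℝ) : ℝ := 1 - crossMoment θ ^ 2

/-- `limitSinSq²` times the coefficient of `1 / n` in the mean of `ln sin²`: half the trace of the
Hessian of `ln (1 - Z² / (X Y))` against the covariance of `(A², B², A B)`. -/
noncomputable def meanNumerator (θ : ℝ) : ℝ :=
  5 * (limitSinSq θ ^ 2 - 1) - (sqSqMoment θ - 1) * crossMoment θ ^ 2
    + 4 * crossMoment θ * (cubeMoment θ - crossMoment θ)
    - (sqSqMoment θ - crossMoment θ ^ 2) * (1 + crossMoment θ ^ 2)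

/-- `limitSinSq²` times the coefficient of `1 / n` in the variance of `ln sin²`: the covariance of
`(A², B², A B)` evaluated at the gradient of `ln (1 - Z² / (X Y))`. -/
noncomputable def varNumerator (θ : ℝ) : ℝ :=
  crossMoment θ ^ 4 * (10 + 2 * (sqSqMoment θ - 1))
    - 8 * crossMoment θ ^ 3 * (cubeMoment θ - crossMoment θ)
    + 4 * crossMoment θ ^ 2 * (sqSqMoment θ - crossMoment θ ^ 2)

/-! ### Small-angle expansions -/

/-- `f` has the one-sided expansion `a₀ + a₁ θ + ⋯ + a₆ θ⁶ + O(θ⁷)` at `0⁺`. -/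
def HasJet (f : ℝ → ℝ) (a₀ a₁ a₂ a₃ a₄ a₅ a₆ : ℝ) : Prop :=
  (fun θ : ℝ => f θ - (a₀ + a₁ * θ + a₂ * θ ^ 2 + a₃ * θ ^ 3 + a₄ * θ ^ 4 + a₅ * θ ^ 5
    + a₆ * θ ^ 6)) =O[𝓝[>] 0] fun θ => θ ^ 7

/-- A function continuous at `0` is bounded near `0⁺`. -/
theorem isBigO_one_of_continuous {f : ℝ → ℝ} (hf : Continuous f) :
    f =O[𝓝[>] 0] fun _ => (1 : ℝ) :=
  ((hf.tendsto 0).mono_left nhdsWithin_le_nhds).isBigO_one ℝ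

theorem isBigO_pow_of_le {m n : ℕ} (h : m ≤ n) :
    (fun θ : ℝ => θ ^ n) =O[𝓝[>] 0] fun θ => θ ^ m := by
  have := (isBigO_refl (fun θ : ℝ => θ ^ m) (𝓝[>] 0)).mul
    (isBigO_one_of_continuous (f := fun θ : ℝ => θ ^ (n - m)) (by fun_prop))
  refine this.congr (fun θ => ?_) (fun θ => by simp)
  rw [← pow_add]; congr 1; omega

theorem HasJet.congr {f : ℝ → ℝ} {a₀ a₁ a₂ a₃ a₄ a₅ a₆ : ℝ} (h : HasJet f a₀ a₁ a₂ a₃ a₄ a₅ a₆)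
    {g : ℝ → ℝ} {b₀ b₁ b₂ b₃ b₄ b₅ b₆ : ℝ} (hg : ∀ θ, g θ = f θ) (h₀ : b₀ = a₀) (h₁ : b₁ = a₁)
    (h₂ : b₂ = a₂) (h₃ : b₃ = a₃) (h₄ : b₄ = a₄) (h₅ : b₅ = a₅) (h₆ : b₆ = a₆) :
    HasJet g b₀ b₁ b₂ b₃ b₄ b₅ b₆ := by
  subst h₀ h₁ h₂ h₃ h₄ h₅ h₆
  rwa [show g = f from funext hg]

theorem HasJet.add {f g : ℝ → ℝ} {a₀ a₁ a₂ a₃ a₄ a₅ a₆ b₀ b₁ b₂ b₃ b₄ b₅ b₆ : ℝ}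
    (hf : HasJet f a₀ a₁ a₂ a₃ a₄ a₅ a₆) (hg : HasJet g b₀ b₁ b₂ b₃ b₄ b₅ b₆) :
    HasJet (fun θ => f θ + g θ) (a₀ + b₀) (a₁ + b₁) (a₂ + b₂) (a₃ + b₃) (a₄ + b₄) (a₅ + b₅)
      (a₆ + b₆) :=
  (IsBigO.add hf hg).congr_left fun θ => by ring

theorem hasJet_const (c : ℝ) : HasJet (fun _ => c) c 0 0 0 0 0 0 :=
  (isBigO_zero _ _).congr_left fun θ => by simp

theorem hasJet_id : HasJet (fun θ => θ) 0 1 0 0 0 0 0 :=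
  (isBigO_zero _ _).congr_left fun θ => by simp

theorem HasJet.isBigO_one {f : ℝ → ℝ} {a₀ a₁ a₂ a₃ a₄ a₅ a₆ : ℝ}
    (hf : HasJet f a₀ a₁ a₂ a₃ a₄ a₅ a₆) : f =O[𝓝[>] 0] fun _ => (1 : ℝ) := by
  have h1 := hf.trans ((isBigO_pow_of_le (Nat.zero_le 7)).congr_right fun θ => pow_zero θ)
  have h2 := isBigO_one_of_continuous (f := fun θ : ℝ => a₀ + a₁ * θ + a₂ * θ ^ 2 + a₃ * θ ^ 3
    + a₄ * θ ^ 4 + a₅ * θ ^ 5 + a₆ * θ ^ 6) (by fun_prop)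
  exact (h1.add h2).congr_left fun θ => by ring

theorem HasJet.mul {f g : ℝ → ℝ} {a₀ a₁ a₂ a₃ a₄ a₅ a₆ b₀ b₁ b₂ b₃ b₄ b₅ b₆ : ℝ}
    (hf : HasJet f a₀ a₁ a₂ a₃ a₄ a₅ a₆) (hg : HasJet g b₀ b₁ b₂ b₃ b₄ b₅ b₆) :
    HasJet (fun θ => f θ * g θ) (a₀ * b₀) (a₀ * b₁ + a₁ * b₀) (a₀ * b₂ + a₁ * b₁ + a₂ * b₀)
      (a₀ * b₃ + a₁ * b₂ + a₂ * b₁ + a₃ * b₀)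
      (a₀ * b₄ + a₁ * b₃ + a₂ * b₂ + a₃ * b₁ + a₄ * b₀)
      (a₀ * b₅ + a₁ * b₄ + a₂ * b₃ + a₃ * b₂ + a₄ * b₁ + a₅ * b₀)
      (a₀ * b₆ + a₁ * b₅ + a₂ * b₄ + a₃ * b₃ + a₄ * b₂ + a₅ * b₁ + a₆ * b₀) := by
  have h1 := IsBigO.mul hf hg.isBigO_one
  have h2 := IsBigO.mul (isBigO_one_of_continuous (f := fun θ : ℝ => a₀ + a₁ * θ + a₂ * θ ^ 2
    + a₃ * θ ^ 3 + a₄ * θ ^ 4 + a₅ * θ ^ 5 + a₆ * θ ^ 6) (by fun_prop)) hg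
  have h3 := IsBigO.mul (isBigO_refl (fun θ : ℝ => θ ^ 7) (𝓝[>] 0))
    (isBigO_one_of_continuous (f := fun θ : ℝ =>
      (a₁ * b₆ + a₂ * b₅ + a₃ * b₄ + a₄ * b₃ + a₅ * b₂ + a₆ * b₁)
      + (a₂ * b₆ + a₃ * b₅ + a₄ * b₄ + a₅ * b₃ + a₆ * b₂) * θ
      + (a₃ * b₆ + a₄ * b₅ + a₅ * b₄ + a₆ * b₃) * θ ^ 2
      + (a₄ * b₆ + a₅ * b₅ + a₆ * b₄) * θ ^ 3 + (a₅ * b₆ + a₆ * b₅) * θ ^ 4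
      + a₆ * b₆ * θ ^ 5) (by fun_prop))
  simp only [mul_one, one_mul] at h1 h2 h3
  exact ((h1.add h2).add h3).congr_left fun θ => by ring

theorem HasJet.isBigO {f : ℝ → ℝ} (hf : HasJet f 0 0 0 0 0 0 0) :
    f =O[𝓝[>] 0] fun θ => θ ^ 7 :=
  IsBigO.congr_left hf fun θ => by ring

/-- The expansions of `sin` and `cos` are the imaginary and real part of that of `exp (i θ)`. -/
theorem exp_mul_I_isBigO :
    (fun θ : ℝ => Complex.exp (θ * Complex.I) - ∑ m ∈ Finset.range 7,
      ((θ : ℂ) * Complex.I) ^ m / (m.factorial : ℂ)) =O[𝓝[>] 0] fun θ => θ ^ 7 := by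
  refine IsBigO.of_bound 1 ?_
  filter_upwards [Ioo_mem_nhdsGT (show (0 : ℝ) < 1 by norm_num)] with θ hθ
  have hn : ‖(θ : ℂ) * Complex.I‖ = θ := by simp [abs_of_pos hθ.1]
  refine (Complex.exp_bound (n := 7) (by rw [hn]; exact hθ.2.le) (by norm_num)).trans ?_
  rw [hn, Real.norm_of_nonneg (by have := hθ.1; positivity), one_mul]
  refine mul_le_of_le_one_right (by have := hθ.1; positivity) ?_
  norm_num [Nat.factorial]

theorem I_pow_three : Complex.I ^ 3 = -Complex.I := by
  rw [pow_succ, Complex.I_sq]; ring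

theorem I_pow_five : Complex.I ^ 5 = Complex.I := by
  rw [pow_succ, Complex.I_pow_four, one_mul]

theorem I_pow_six : Complex.I ^ 6 = -1 := by
  rw [pow_succ, I_pow_five, Complex.I_mul_I]

theorem hasJet_sin : HasJet Real.sin 0 1 0 (-1 / 6) 0 (1 / 120) 0 := by
  refine IsBigO.trans (IsBigO.of_bound 1 (Eventually.of_forall fun θ => ?_)) exp_mul_I_isBigO
  refine le_trans (le_of_eq ?_) ((Complex.abs_im_le_norm _).trans (one_mul _).ge)
  rw [Real.norm_eq_abs]
  congr 1
  simp only [Finset.sum_range_succ, Finset.sum_range_zero, mul_pow, Nat.factorial, Complex.I_sq,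
    Complex.I_pow_four, I_pow_three, I_pow_five, I_pow_six]
  rw [Complex.sub_im, Complex.exp_ofReal_mul_I_im]
  simp [← Complex.ofReal_pow]
  norm_num
  ring

theorem hasJet_cos : HasJet Real.cos 1 0 (-1 / 2) 0 (1 / 24) 0 (-1 / 720) := by
  refine IsBigO.trans (IsBigO.of_bound 1 (Eventually.of_forall fun θ => ?_)) exp_mul_I_isBigO
  refine le_trans (le_of_eq ?_) ((Complex.abs_re_le_norm _).trans (one_mul _).ge)
  rw [Real.norm_eq_abs]
  congr 1
  simp only [Finset.sum_range_succ, Finset.sum_range_zero, mul_pow, Nat.factorial, Complex.I_sq,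
    Complex.I_pow_four, I_pow_three, I_pow_five, I_pow_six]
  rw [Complex.sub_re, Complex.exp_ofReal_mul_I_re]
  simp [← Complex.ofReal_pow]
  norm_num
  ring

theorem hasJet_crossMoment : HasJet crossMoment 1 0 (-1 / 2) (1 / 3 * (1 / Real.pi)) (1 / 24)
    (-1 / 30 * (1 / Real.pi)) (-1 / 720) := by
  have hp := Real.pi_ne_zero
  have h1 := (hasJet_const (1 / Real.pi)).mul hasJet_sin
  have h2 := ((hasJet_const 1).add ((hasJet_const (-(1 / Real.pi))).mul hasJet_id)).mul hasJet_cos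
  refine (h1.add h2).congr (fun θ => ?_) ?_ ?_ ?_ ?_ ?_ ?_ ?_ <;> try ring1
  simp only [crossMoment]; field_simp; ring

theorem hasJet_cos_sq : HasJet (fun θ => Real.cos θ ^ 2) 1 0 (-1) 0 (1 / 3) 0 (-2 / 45) := by
  refine (hasJet_cos.mul hasJet_cos).congr (fun θ => ?_) ?_ ?_ ?_ ?_ ?_ ?_ ?_ <;> ring

theorem hasJet_sqSqMoment : HasJet sqSqMoment 6 0 (-4) 0 (4 / 3) (-8 / 15 * (1 / Real.pi))
    (-8 / 45) := by
  have hp := Real.pi_ne_zero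
  have h1 := (hasJet_const (6 * (1 / Real.pi))).mul (hasJet_sin.mul hasJet_cos)
  have h2 := ((hasJet_const 2).add ((hasJet_const (-2 * (1 / Real.pi))).mul hasJet_id)).mul
    ((hasJet_const 1).add ((hasJet_const 2).mul hasJet_cos_sq))
  refine (h1.add h2).congr (fun θ => ?_) ?_ ?_ ?_ ?_ ?_ ?_ ?_ <;> try ring1
  simp only [sqSqMoment]; field_simp; ring

theorem hasJet_cubeMoment : HasJet cubeMoment 6 0 (-3) 0 (1 / 4) (4 / 5 * (1 / Real.pi))
    (-1 / 120) := by
  have hp := Real.pi_ne_zero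
  have h1 := (hasJet_const (2 * (1 / Real.pi))).mul
    (((hasJet_const 2).mul hasJet_sin).add (hasJet_sin.mul hasJet_cos_sq))
  have h2 := ((hasJet_const 6).add ((hasJet_const (-6 * (1 / Real.pi))).mul hasJet_id)).mul
    hasJet_cos
  refine (h1.add h2).congr (fun θ => ?_) ?_ ?_ ?_ ?_ ?_ ?_ ?_ <;> try ring1
  simp only [cubeMoment]; field_simp; ring

theorem hasJet_crossMoment_sq : HasJet (fun θ => crossMoment θ ^ 2) 1 0 (-1)
    (2 / 3 * (1 / Real.pi)) (1 / 3) (-2 / 5 * (1 / Real.pi))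
    (-2 / 45 + 1 / 9 * (1 / Real.pi) ^ 2) := by
  refine (hasJet_crossMoment.mul hasJet_crossMoment).congr (fun θ => ?_) ?_ ?_ ?_ ?_ ?_ ?_ ?_ <;>
    ring

theorem hasJet_limitSinSq : HasJet limitSinSq 0 0 1 (-2 / 3 * (1 / Real.pi)) (-1 / 3)
    (2 / 5 * (1 / Real.pi)) (2 / 45 - 1 / 9 * (1 / Real.pi) ^ 2) := by
  refine ((hasJet_const 1).add ((hasJet_const (-1)).mul hasJet_crossMoment_sq)).congr
    (fun θ => ?_) ?_ ?_ ?_ ?_ ?_ ?_ ?_ <;> try ring1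
  simp only [limitSinSq]; ring

theorem hasJet_limitSinSq_sq : HasJet (fun θ => limitSinSq θ ^ 2) 0 0 0 0 1
    (-4 / 3 * (1 / Real.pi)) (-2 / 3 + 4 / 9 * (1 / Real.pi) ^ 2) := by
  refine (hasJet_limitSinSq.mul hasJet_limitSinSq).congr (fun θ => ?_) ?_ ?_ ?_ ?_ ?_ ?_ ?_ <;> ring

theorem hasJet_meanNumerator : HasJet meanNumerator 0 0 0 0 (-2) (32 / 15 * (1 / Real.pi))
    (4 / 3 + 4 / 3 * (1 / Real.pi) ^ 2) := by
  have h1 := (hasJet_const 5).mul (hasJet_limitSinSq_sq.add (hasJet_const (-1)))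
  have h2 := (hasJet_const (-1)).mul
    ((hasJet_sqSqMoment.add (hasJet_const (-1))).mul hasJet_crossMoment_sq)
  have h3 := (hasJet_const 4).mul (hasJet_crossMoment.mul
    (hasJet_cubeMoment.add ((hasJet_const (-1)).mul hasJet_crossMoment)))
  have h4 := (hasJet_const (-1)).mul
    ((hasJet_sqSqMoment.add ((hasJet_const (-1)).mul hasJet_crossMoment_sq)).mul
      ((hasJet_const 1).add hasJet_crossMoment_sq))
  refine (((h1.add h2).add h3).add h4).congr (fun θ => ?_) ?_ ?_ ?_ ?_ ?_ ?_ ?_ <;> try ring1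
  simp only [meanNumerator]; ring

theorem hasJet_varNumerator : HasJet varNumerator 0 0 0 0 8 (-224 / 15 * (1 / Real.pi))
    (-40 / 3 + 8 / 3 * (1 / Real.pi) ^ 2) := by
  have h1 : HasJet (fun θ => crossMoment θ ^ 4) 1 0 (-2) (4 / 3 * (1 / Real.pi)) (5 / 3)
      (-32 / 15 * (1 / Real.pi)) (-34 / 45 + 2 / 3 * (1 / Real.pi) ^ 2) :=
    (hasJet_crossMoment_sq.mul hasJet_crossMoment_sq).congr
      (fun θ => by ring) (by ring) (by ring) (by ring) (by ring) (by ring) (by ring) (by ring)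
  have h2 := h1.mul ((hasJet_const 8).add ((hasJet_const 2).mul hasJet_sqSqMoment))
  have h3 := ((hasJet_const (-8)).mul (hasJet_crossMoment.mul hasJet_crossMoment_sq)).mul
    (hasJet_cubeMoment.add ((hasJet_const (-1)).mul hasJet_crossMoment))
  have h4 := ((hasJet_const 4).mul hasJet_crossMoment_sq).mul
    (hasJet_sqSqMoment.add ((hasJet_const (-1)).mul hasJet_crossMoment_sq))
  refine ((h2.add h3).add h4).congr (fun θ => ?_) ?_ ?_ ?_ ?_ ?_ ?_ ?_ <;> try ring1
  simp only [varNumerator]; ring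

theorem isBigO_of_hasJet_order_two {f : ℝ → ℝ} {a₂ a₃ a₄ a₅ a₆ : ℝ}
    (hf : HasJet f 0 0 a₂ a₃ a₄ a₅ a₆) :
    (fun θ => f θ - (a₂ * θ ^ 2 + a₃ * θ ^ 3 + a₄ * θ ^ 4)) =O[𝓝[>] 0] fun θ => θ ^ 5 := by
  have h1 := hf.trans (isBigO_pow_of_le (show 5 ≤ 7 by norm_num))
  have h2 := (isBigO_refl (fun θ : ℝ => θ ^ 5) (𝓝[>] 0)).mul
    (isBigO_one_of_continuous (f := fun θ : ℝ => a₅ + a₆ * θ) (by fun_prop))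
  simp only [mul_one] at h2
  exact (h1.add h2).congr_left fun θ => by ring

/-- A function with leading term `θ²` at `0⁺` dominates `θ²`. -/
theorem sq_isBigO_of_hasJet {f : ℝ → ℝ} {a₃ a₄ a₅ a₆ : ℝ} (hf : HasJet f 0 0 1 a₃ a₄ a₅ a₆) :
    (fun θ : ℝ => θ ^ 2) =O[𝓝[>] 0] f := by
  have h2 : (fun θ => f θ - θ ^ 2) =O[𝓝[>] 0] fun θ : ℝ => θ ^ 3 := by
    have h1 := (isBigO_of_hasJet_order_two hf).trans (isBigO_pow_of_le (show 3 ≤ 5 by norm_num))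
    have h2 := (isBigO_refl (fun θ : ℝ => θ ^ 3) (𝓝[>] 0)).mul
      (isBigO_one_of_continuous (f := fun θ : ℝ => a₃ + a₄ * θ) (by fun_prop))
    simp only [mul_one] at h2
    exact (h1.add h2).congr_left fun θ => by ring
  have h3 : (fun θ => f θ - θ ^ 2) =o[𝓝[>] 0] fun θ : ℝ => θ ^ 2 := by
    refine h2.trans_isLittleO ?_
    exact (isLittleO_pow_pow (show 2 < 3 by norm_num)).mono nhdsWithin_le_nhds
  exact (IsEquivalent.isBigO_symm (u := f) (v := fun θ : ℝ => θ ^ 2) h3)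

theorem eventually_ne_zero : ∀ᶠ θ : ℝ in 𝓝[>] 0, θ ≠ 0 := by
  filter_upwards [self_mem_nhdsWithin] with θ hθ using ne_of_gt hθ

/-- Dividing a numerator that agrees with `E · limitSinSq²` up to `O(θ⁷)` by `limitSinSq²`,
which is of exact order `θ⁴`. -/
theorem isBigO_div_limitSinSq_sq {f E : ℝ → ℝ}
    (h : (fun θ => f θ - limitSinSq θ ^ 2 * E θ) =O[𝓝[>] 0] fun θ => θ ^ 7) :
    (fun θ => f θ / limitSinSq θ ^ 2 - E θ) =O[𝓝[>] 0] fun θ => θ ^ 3 := by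
  have hD := sq_isBigO_of_hasJet hasJet_limitSinSq
  have hD0 : ∀ᶠ θ in 𝓝[>] 0, θ ≠ 0 ∧ limitSinSq θ ≠ 0 := by
    filter_upwards [eventually_ne_zero, hD.eq_zero_imp] with θ h0 h1
    exact ⟨h0, fun h2 => pow_ne_zero 2 h0 (h1 h2)⟩
  have hinv : (fun θ => (limitSinSq θ ^ 2)⁻¹) =O[𝓝[>] 0] fun θ => ((θ ^ 2) ^ 2)⁻¹ :=
    (hD.pow 2).inv_rev (by
      filter_upwards [eventually_ne_zero] with θ h0 h1
      exact absurd h1 (by positivity))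
  refine (h.mul hinv).congr' ?_ ?_
  · filter_upwards [hD0] with θ hθ
    have := hθ.2
    field_simp
  · filter_upwards [eventually_ne_zero] with θ hθ
    field_simp

theorem meanNumerator_div_isBigO :
    (fun θ => meanNumerator θ / limitSinSq θ ^ 2 + 2
      - (-(8 / (15 * Real.pi)) * θ + 68 / (45 * Real.pi ^ 2) * θ ^ 2))
      =O[𝓝[>] 0] fun θ => θ ^ 3 := by
  have hp := Real.pi_ne_zero
  have h := isBigO_div_limitSinSq_sq (f := meanNumerator)
    (E := fun θ => -2 - (8 / (15 * Real.pi)) * θ + 68 / (45 * Real.pi ^ 2) * θ ^ 2) ?_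
  · exact h.congr_left fun θ => by ring
  have h1 := hasJet_limitSinSq_sq.mul ((hasJet_const (-2)).add
    (((hasJet_const (-8 / 15 * (1 / Real.pi))).mul hasJet_id).add
      ((hasJet_const (68 / 45 * (1 / Real.pi) ^ 2)).mul (hasJet_id.mul hasJet_id))))
  refine HasJet.isBigO ((hasJet_meanNumerator.add ((hasJet_const (-1)).mul h1)).congr
    (fun θ => ?_) ?_ ?_ ?_ ?_ ?_ ?_ ?_) <;> try ring1

theorem varNumerator_div_isBigO :
    (fun θ => varNumerator θ / limitSinSq θ ^ 2
      - (8 - 64 / (15 * Real.pi) * θ - (8 + 296 / (45 * Real.pi ^ 2)) * θ ^ 2))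
      =O[𝓝[>] 0] fun θ => θ ^ 3 := by
  have hp := Real.pi_ne_zero
  refine isBigO_div_limitSinSq_sq (f := varNumerator) ?_
  have h1 := hasJet_limitSinSq_sq.mul ((hasJet_const 8).add
    (((hasJet_const (-64 / 15 * (1 / Real.pi))).mul hasJet_id).add
      ((hasJet_const (-8 - 296 / 45 * (1 / Real.pi) ^ 2)).mul (hasJet_id.mul hasJet_id))))
  refine HasJet.isBigO ((hasJet_varNumerator.add ((hasJet_const (-1)).mul h1)).congr
    (fun θ => ?_) ?_ ?_ ?_ ?_ ?_ ?_ ?_) <;> try ring1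

theorem log_one_add_isBigO {v : ℝ → ℝ} (hv : v =O[𝓝[>] 0] fun θ => θ) :
    (fun θ => Real.log (1 + v θ) - (v θ - v θ ^ 2 / 2)) =O[𝓝[>] 0] fun θ => θ ^ 3 := by
  have hv0 : Tendsto v (𝓝[>] 0) (𝓝 0) :=
    hv.trans_tendsto (tendsto_id.mono_left nhdsWithin_le_nhds)
  refine IsBigO.trans (IsBigO.of_bound 2 ?_) (hv.pow 3)
  filter_upwards [hv0.eventually (Metric.ball_mem_nhds 0 (show (0 : ℝ) < 1 / 2 by norm_num))]
    with θ hθ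
  rw [dist_zero_right, Real.norm_eq_abs] at hθ
  have := Real.abs_log_sub_add_sum_range_le (x := -v θ) (by rw [abs_neg]; linarith) 2
  simp only [Finset.sum_range_succ, Finset.sum_range_zero, abs_neg, sub_neg_eq_add] at this
  rw [Real.norm_eq_abs, Real.norm_eq_abs, abs_pow]
  refine (le_of_eq ?_).trans (this.trans ?_)
  · congr 1; norm_num; ring
  · rw [div_le_iff₀ (by linarith)]
    have h3 : 0 ≤ |v θ| ^ 3 := by positivity
    change |v θ| ^ 3 ≤ _
    nlinarith

theorem log_limitSinSq_isBigO :
    (fun θ => Real.log (limitSinSq θ)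
      - (logSinSq θ - 2 / (3 * Real.pi) * θ - 2 / (9 * Real.pi ^ 2) * θ ^ 2))
      =O[𝓝[>] 0] fun θ => θ ^ 3 := by
  have hp := Real.pi_ne_zero
  have hs : HasJet (fun θ => Real.sin θ ^ 2) 0 0 1 0 (-1 / 3) 0 (2 / 45) := by
    refine (hasJet_sin.mul hasJet_sin).congr (fun θ => ?_) ?_ ?_ ?_ ?_ ?_ ?_ ?_ <;> ring
  have hsO := sq_isBigO_of_hasJet hs
  have hDO := sq_isBigO_of_hasJet hasJet_limitSinSq
  have hne : ∀ᶠ θ in 𝓝[>] 0, θ ≠ 0 ∧ limitSinSq θ ≠ 0 ∧ Real.sin θ ^ 2 ≠ 0 := by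
    filter_upwards [eventually_ne_zero, hDO.eq_zero_imp, hsO.eq_zero_imp] with θ h0 h1 h2
    exact ⟨h0, fun h => pow_ne_zero 2 h0 (h1 h), fun h => pow_ne_zero 2 h0 (h2 h)⟩
  -- the quotient `limitSinSq / sin²` is `1 - 2θ/(3π) + O(θ³)`
  have hdiff : (fun θ => limitSinSq θ - Real.sin θ ^ 2 * (1 - 2 / (3 * Real.pi) * θ))
      =O[𝓝[>] 0] fun θ => θ ^ 5 := by
    have h1 := hs.mul ((hasJet_const 1).add ((hasJet_const (-2 / 3 * (1 / Real.pi))).mul hasJet_id))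
    have h2 : HasJet (fun θ => limitSinSq θ - Real.sin θ ^ 2 * (1 - 2 / (3 * Real.pi) * θ))
        0 0 0 0 0 _ _ := (hasJet_limitSinSq.add ((hasJet_const (-1)).mul h1)).congr
      (fun θ => by field_simp; ring) (by ring) (by ring) (by ring) (by ring) (by ring) rfl rfl
    exact (isBigO_of_hasJet_order_two h2).congr_left fun θ => by ring
  have hinv : (fun θ => (Real.sin θ ^ 2)⁻¹) =O[𝓝[>] 0] fun θ => (θ ^ 2)⁻¹ :=
    hsO.inv_rev (by
      filter_upwards [eventually_ne_zero] with θ h0 h1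
      exact absurd h1 (by positivity))
  have hv : (fun θ => (limitSinSq θ / Real.sin θ ^ 2 - 1) + 2 / (3 * Real.pi) * θ)
      =O[𝓝[>] 0] fun θ => θ ^ 3 := by
    refine (hdiff.mul hinv).congr' ?_ ?_
    · filter_upwards [hne] with θ hθ
      have hsin : Real.sin θ ≠ 0 := fun h => hθ.2.2 (by rw [h]; norm_num)
      field_simp
      ring
    · filter_upwards [eventually_ne_zero] with θ hθ
      field_simp
  have hlin : ∀ c : ℝ, (fun θ : ℝ => c * θ) =O[𝓝[>] 0] fun θ => θ := fun c =>
    (isBigO_refl _ _).const_mul_left c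
  have hv1 : (fun θ => limitSinSq θ / Real.sin θ ^ 2 - 1) =O[𝓝[>] 0] fun θ => θ := by
    have h3 : (fun θ : ℝ => θ ^ 3) =O[𝓝[>] 0] fun θ => θ :=
      (isBigO_pow_of_le (show 1 ≤ 3 by norm_num)).congr_right fun θ => pow_one θ
    exact ((hv.trans h3).sub (hlin (2 / (3 * Real.pi)))).congr_left fun θ => by ring
  have hq : (fun θ => ((limitSinSq θ / Real.sin θ ^ 2 - 1) + 2 / (3 * Real.pi) * θ)
      * ((limitSinSq θ / Real.sin θ ^ 2 - 1) + -(2 / (3 * Real.pi)) * θ))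
      =O[𝓝[>] 0] fun θ => θ ^ 3 := by
    have := (hv.mul (hv1.add (hlin (-(2 / (3 * Real.pi)))))).trans
      ((isBigO_pow_of_le (show 3 ≤ 4 by norm_num)).congr_left fun θ => show θ ^ 4 = θ ^ 3 * θ by ring)
    exact this
  refine (((log_one_add_isBigO hv1).add hv).sub (hq.const_mul_left (1 / 2))).congr' ?_ .rfl
  filter_upwards [hne] with θ hθ
  rw [add_sub_cancel, Real.log_div hθ.2.1 hθ.2.2, logSinSq]
  field_simp
  ring

/-! ### Correlated Gaussian pairs -/

/-- The law of two independent standard Gaussian variables. -/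
noncomputable def pairLaw : Measure (ℝ × ℝ) := (gaussianReal 0 1).prod (gaussianReal 0 1)

instance : IsProbabilityMeasure pairLaw := by unfold pairLaw; infer_instance

/-- The coordinate of `p` in direction `θ`. Under `pairLaw`, `proj 0` and `proj θ` are standard
Gaussian variables with correlation `cos θ`. -/
noncomputable def proj (θ : ℝ) (p : ℝ × ℝ) : ℝ := Real.cos θ * p.1 + Real.sin θ * p.2

@[fun_prop]
theorem continuous_proj (θ : ℝ) : Continuous (proj θ) := by unfold proj; fun_prop

theorem proj_zero (p : ℝ × ℝ) : proj 0 p = p.1 := by simp [proj]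

theorem charFunDual_gaussianReal (L : StrongDual ℝ ℝ) :
    charFunDual (gaussianReal 0 1) L = Complex.exp (-(L 1 : ℂ) ^ 2 / 2) := by
  rw [charFunDual_eq_charFun_map_one]
  have : (gaussianReal 0 1).map L = gaussianReal 0 (.mk ((L 1) ^ 2) (sq_nonneg _)) := by
    have h : (L : ℝ → ℝ) = fun x => L 1 * x := by
      ext x
      have := L.map_smul x 1
      simp only [smul_eq_mul, mul_one] at this
      rw [this, mul_comm]
    rw [h, gaussianReal_map_const_mul]
    simp
  rw [this, charFun_gaussianReal]
  congr 1
  simp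
  ring

theorem charFunDual_pairLaw (L : StrongDual ℝ (ℝ × ℝ)) :
    charFunDual pairLaw L = Complex.exp (-((L (1, 0)) ^ 2 + (L (0, 1)) ^ 2 : ℝ) / 2) := by
  rw [pairLaw, charFunDual_prod, charFunDual_gaussianReal, charFunDual_gaussianReal,
    ← Complex.exp_add]
  congr 1
  simp
  ring

/-- The law of `(⟨a, w⟩, ⟨b, w⟩)` for a standard Gaussian vector `w` depends only on the lengths of
`a`, `b` and on the angle between them. -/
theorem stdGaussian_map_inner_pair {E : Type*} [NormedAddCommGroup E] [InnerProductSpace ℝ E]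
    [FiniteDimensional ℝ E] [MeasurableSpace E] [BorelSpace E] (a b : E) :
    (stdGaussian E).map (fun w => (inner ℝ a w, inner ℝ b w)) =
      pairLaw.map (fun p => (‖a‖ * proj 0 p,
        ‖b‖ * proj (InnerProductGeometry.angle a b) p)) := by
  set θ := InnerProductGeometry.angle a b with hθ
  let T : E →L[ℝ] ℝ × ℝ := (innerSL ℝ a).prod (innerSL ℝ b)
  let P₁ : ℝ × ℝ →L[ℝ] ℝ := ContinuousLinearMap.fst ℝ ℝ ℝ
  let P₂ : ℝ × ℝ →L[ℝ] ℝ := ContinuousLinearMap.snd ℝ ℝ ℝ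
  let S : ℝ × ℝ →L[ℝ] ℝ × ℝ := (‖a‖ • (Real.cos 0 • P₁ + Real.sin 0 • P₂)).prod
    (‖b‖ • (Real.cos θ • P₁ + Real.sin θ • P₂))
  change (stdGaussian E).map T = pairLaw.map S
  apply Measure.ext_of_charFunDual
  ext L
  rw [charFunDual_map, charFunDual_map, charFunDual_stdGaussian, charFunDual_pairLaw]
  have hL : ∀ x y : ℝ, L (x, y) = L (1, 0) * x + L (0, 1) * y := by
    intro x y
    have h : (x, y) = x • ((1, 0) : ℝ × ℝ) + y • ((0, 1) : ℝ × ℝ) := by ext <;> simp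
    rw [h, L.map_add, L.map_smul, L.map_smul, smul_eq_mul, smul_eq_mul]
    ring
  have hT : L.comp T = innerSL ℝ (L (1, 0) • a + L (0, 1) • b) := by
    ext w
    simp only [T, ContinuousLinearMap.comp_apply, ContinuousLinearMap.prod_apply, innerSL_apply_apply]
    rw [hL, inner_add_left, inner_smul_left, inner_smul_left]
    simp
  have hn : ‖L.comp T‖ ^ 2 = (L.comp S (1, 0)) ^ 2 + (L.comp S (0, 1)) ^ 2 := by
    rw [hT, innerSL_apply_norm, norm_add_sq_real, norm_smul, norm_smul, inner_smul_left,
      inner_smul_right]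
    have hcos : inner ℝ a b = Real.cos θ * (‖a‖ * ‖b‖) :=
      (InnerProductGeometry.cos_angle_mul_norm_mul_norm a b).symm
    have e1 : L.comp S (1, 0) = L (1, 0) * ‖a‖ + L (0, 1) * (‖b‖ * Real.cos θ) := by
      change L (_, _) = _
      rw [hL]
      simp [P₁, P₂]
    have e2 : L.comp S (0, 1) = L (0, 1) * (‖b‖ * Real.sin θ) := by
      change L (_, _) = _
      rw [hL]
      simp [P₁, P₂]
    simp only [e1, e2, hcos, Real.norm_eq_abs, mul_pow, sq_abs, starRingEnd_apply, star_trivial]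
    linear_combination (-(L (0, 1)) ^ 2 * ‖b‖ ^ 2) * Real.sin_sq_add_cos_sq θ
  congr 1
  rw [← hn]
  push_cast
  rfl

/-- The reflection of the plane that exchanges the directions `0` and `θ`. -/
noncomputable def swapDirections (θ : ℝ) (p : ℝ × ℝ) : ℝ × ℝ :=
  (Real.cos θ * p.1 + Real.sin θ * p.2, Real.sin θ * p.1 - Real.cos θ * p.2)

theorem measurePreserving_swapDirections (θ : ℝ) :
    MeasurePreserving (swapDirections θ) pairLaw pairLaw := by
  refine ⟨by unfold swapDirections; fun_prop, ?_⟩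
  let P₁ : ℝ × ℝ →L[ℝ] ℝ := ContinuousLinearMap.fst ℝ ℝ ℝ
  let P₂ : ℝ × ℝ →L[ℝ] ℝ := ContinuousLinearMap.snd ℝ ℝ ℝ
  let S : ℝ × ℝ →L[ℝ] ℝ × ℝ := (Real.cos θ • P₁ + Real.sin θ • P₂).prod
    (Real.sin θ • P₁ - Real.cos θ • P₂)
  change pairLaw.map S = pairLaw
  apply Measure.ext_of_charFunDual
  ext L
  rw [charFunDual_map, charFunDual_pairLaw, charFunDual_pairLaw]
  have hL : ∀ x y : ℝ, L (x, y) = L (1, 0) * x + L (0, 1) * y := by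
    intro x y
    have h : (x, y) = x • ((1, 0) : ℝ × ℝ) + y • ((0, 1) : ℝ × ℝ) := by ext <;> simp
    rw [h, L.map_add, L.map_smul, L.map_smul, smul_eq_mul, smul_eq_mul]
    ring
  congr 4
  simp only [S, P₁, P₂, ContinuousLinearMap.comp_apply, ContinuousLinearMap.prod_apply,
    smul_apply, add_apply, sub_apply,
    ContinuousLinearMap.coe_fst', ContinuousLinearMap.coe_snd', smul_eq_mul]
  rw [hL (_ + _), hL (Real.cos θ * 0 + _)]
  linear_combination ((L (1, 0)) ^ 2 + (L (0, 1)) ^ 2) * Real.sin_sq_add_cos_sq θ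

theorem proj_zero_swapDirections (θ : ℝ) (p : ℝ × ℝ) : proj 0 (swapDirections θ p) = proj θ p := by
  simp [proj, swapDirections]

theorem proj_swapDirections (θ : ℝ) (p : ℝ × ℝ) : proj θ (swapDirections θ p) = proj 0 p := by
  simp only [proj, swapDirections, Real.cos_zero, Real.sin_zero]
  linear_combination p.1 * Real.sin_sq_add_cos_sq θ

/-- The rectified coordinate in direction `θ`, normalized to have second moment `1`. -/
noncomputable def act (θ : ℝ) (p : ℝ × ℝ) : ℝ := Real.sqrt 2 * max (proj θ p) 0

@[fun_prop]
theorem continuous_act (θ : ℝ) : Continuous (act θ) := by unfold act; fun_prop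

theorem act_nonneg (θ : ℝ) (p : ℝ × ℝ) : 0 ≤ act θ p := by unfold act; positivity

/-- Moments of the pair `(act 0, act θ)` are symmetric. -/
theorem integral_act_swap (θ : ℝ) (a b : ℕ) :
    ∫ p, act θ p ^ a * act 0 p ^ b ∂pairLaw = ∫ p, act 0 p ^ a * act θ p ^ b ∂pairLaw := by
  have hm := measurePreserving_swapDirections θ
  have h := integral_map (μ := pairLaw) hm.measurable.aemeasurable
    (f := fun p => act θ p ^ a * act 0 p ^ b) (by fun_prop)
  rw [hm.map_eq] at h
  rw [h]
  simp only [act, proj_zero_swapDirections, proj_swapDirections]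

/-! ### Moments of the rectified pair by polar coordinates -/

theorem integral_pairLaw (g : ℝ × ℝ → ℝ) :
    ∫ p, g p ∂pairLaw =
      ∫ p : ℝ × ℝ, (2 * Real.pi)⁻¹ * Real.exp (-(p.1 ^ 2 + p.2 ^ 2) / 2) * g p := by
  have h1 : (1 : NNReal) ≠ 0 := one_ne_zero
  rw [pairLaw, gaussianReal_of_var_ne_zero _ h1,
    prod_withDensity (measurable_gaussianPDF _ _) (measurable_gaussianPDF _ _),
    integral_withDensity_eq_integral_toReal_smul (by fun_prop)
      (Eventually.of_forall fun p => ENNReal.mul_lt_top (gaussianPDF_lt_top) (gaussianPDF_lt_top))]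
  refine integral_congr_ae (Eventually.of_forall fun p => ?_)
  simp only [ENNReal.toReal_mul, toReal_gaussianPDF, gaussianPDFReal, smul_eq_mul]
  have hs : (Real.sqrt (2 * Real.pi * ((1 : NNReal) : ℝ)))⁻¹
      * (Real.sqrt (2 * Real.pi * ((1 : NNReal) : ℝ)))⁻¹ = (2 * Real.pi)⁻¹ := by
    rw [← mul_inv, Real.mul_self_sqrt (by positivity)]
    simp
  have he : Real.exp (-(p.1 ^ 2 + p.2 ^ 2) / 2) = Real.exp (-(p.1 - 0) ^ 2 / (2 * ((1 : NNReal) : ℝ)))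
      * Real.exp (-(p.2 - 0) ^ 2 / (2 * ((1 : NNReal) : ℝ))) := by
    rw [← Real.exp_add]
    congr 1
    simp
    ring
  rw [he, ← hs]
  ring

theorem integral_pow_mul_exp_neg_sq_div_two (m : ℕ) :
    ∫ r in Set.Ioi (0 : ℝ), r ^ (2 * m + 1) * Real.exp (-r ^ 2 / 2)
      = 2 ^ m * (m.factorial : ℝ) := by
  have h := integral_rpow_mul_exp_neg_mul_rpow (p := 2) (q := 2 * m + 1) (b := 1 / 2)
    (by norm_num) (by have : (0 : ℝ) ≤ m := Nat.cast_nonneg m; linarith) (by norm_num)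
  have h2 : ((2 * (m : ℝ) + 1 + 1) / 2) = m + 1 := by ring
  rw [h2, Real.Gamma_nat_eq_factorial] at h
  have h3 : ∀ r ∈ Set.Ioi (0 : ℝ), r ^ (2 * m + 1) * Real.exp (-r ^ 2 / 2)
      = r ^ (2 * (m : ℝ) + 1) * Real.exp (-(1 / 2) * r ^ (2 : ℝ)) := by
    intro r _
    rw [show (2 * (m : ℝ) + 1) = ((2 * m + 1 : ℕ) : ℝ) by push_cast; ring, Real.rpow_natCast,
      show (2 : ℝ) = ((2 : ℕ) : ℝ) by norm_num, Real.rpow_natCast]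
    congr 2
    push_cast
    ring
  rw [setIntegral_congr_fun measurableSet_Ioi h3, h, neg_div, h2, Real.rpow_neg (by norm_num),
    show ((m : ℝ) + 1) = ((m + 1 : ℕ) : ℝ) by push_cast; ring, Real.rpow_natCast, one_div, inv_pow,
    inv_inv, pow_succ]
  ring

theorem proj_polar (θ r φ : ℝ) :
    proj θ (r * Real.cos φ, r * Real.sin φ) = r * Real.cos (φ - θ) := by
  rw [proj, Real.cos_sub]; ring

/-- Separation of radius and angle in the mixed moments of the rectified pair. -/
theorem integral_act_pow_mul_polar (θ : ℝ) (a b m : ℕ) (hm : a + b = 2 * m) :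
    ∫ p, act 0 p ^ a * act θ p ^ b ∂pairLaw =
      2 ^ (2 * m) * (m.factorial : ℝ) * (2 * Real.pi)⁻¹
        * ∫ φ in Set.Ioo (-Real.pi) Real.pi, max (Real.cos φ) 0 ^ a * max (Real.cos (φ - θ)) 0 ^ b := by
  rw [integral_pairLaw, ← integral_comp_polarCoord_symm]
  have h : ∀ q ∈ polarCoord.target, q.1 • ((2 * Real.pi)⁻¹ *
      Real.exp (-((polarCoord.symm q).1 ^ 2 + (polarCoord.symm q).2 ^ 2) / 2) *
        (act 0 (polarCoord.symm q) ^ a * act θ (polarCoord.symm q) ^ b))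
      = (2 ^ m * (2 * Real.pi)⁻¹ * (q.1 ^ (2 * m + 1) * Real.exp (-q.1 ^ 2 / 2)))
        * (max (Real.cos q.2) 0 ^ a * max (Real.cos (q.2 - θ)) 0 ^ b) := by
    intro q hq
    rw [polarCoord_target] at hq
    have hq0 : 0 ≤ q.1 := le_of_lt hq.1
    have hmax : ∀ t : ℝ, max (q.1 * t) 0 = q.1 * max t 0 := fun t => by
      rw [mul_max_of_nonneg _ _ hq0, mul_zero]
    simp only [polarCoord_symm_apply, act, proj_polar, sub_zero, hmax, smul_eq_mul]
    have hr : (q.1 * Real.cos q.2) ^ 2 + (q.1 * Real.sin q.2) ^ 2 = q.1 ^ 2 := by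
      linear_combination q.1 ^ 2 * Real.sin_sq_add_cos_sq q.2
    have h2 : Real.sqrt 2 ^ a * Real.sqrt 2 ^ b = 2 ^ m := by
      rw [← pow_add, hm, pow_mul, Real.sq_sqrt (by norm_num)]
    have h3 : q.1 ^ (2 * m + 1) = q.1 * (q.1 ^ a * q.1 ^ b) := by
      rw [← pow_add, hm]; ring
    rw [hr, h3, ← h2]
    ring
  have hmeas : MeasurableSet polarCoord.target := polarCoord.open_target.measurableSet
  rw [setIntegral_congr_fun hmeas h, polarCoord_target, Measure.volume_eq_prod,
    setIntegral_prod_mul (fun r : ℝ => 2 ^ m * (2 * Real.pi)⁻¹ * (r ^ (2 * m + 1)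
      * Real.exp (-r ^ 2 / 2))) (fun φ : ℝ => max (Real.cos φ) 0 ^ a * max (Real.cos (φ - θ)) 0 ^ b),
    integral_const_mul, integral_pow_mul_exp_neg_sq_div_two]
  ring

/-- Both rectified cosines are positive only for angles between `θ - π/2` and `π/2`. -/
theorem integral_rectified_cos (θ : ℝ) (h0 : 0 ≤ θ) (hπ : θ ≤ Real.pi) (a b : ℕ) (ha : a ≠ 0)
    (hb : b ≠ 0) :
    ∫ φ in Set.Ioo (-Real.pi) Real.pi, max (Real.cos φ) 0 ^ a * max (Real.cos (φ - θ)) 0 ^ b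
      = ∫ φ in (θ - Real.pi / 2)..(Real.pi / 2), Real.cos φ ^ a * Real.cos (φ - θ) ^ b := by
  have hp := Real.pi_pos
  set f : ℝ → ℝ := fun φ => max (Real.cos φ) 0 ^ a * max (Real.cos (φ - θ)) 0 ^ b with hf
  have hc : Continuous f := by fun_prop
  have hi : ∀ u v : ℝ, IntervalIntegrable f volume u v := fun u v => hc.intervalIntegrable u v
  rw [← integral_Ioc_eq_integral_Ioo, ← intervalIntegral.integral_of_le (by linarith),
    ← intervalIntegral.integral_add_adjacent_intervals (hi _ (θ - Real.pi / 2)) (hi _ _),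
    ← intervalIntegral.integral_add_adjacent_intervals (hi (θ - Real.pi / 2) (Real.pi / 2))
      (hi _ _)]
  have h1 : ∫ φ in (-Real.pi)..(θ - Real.pi / 2), f φ = 0 := by
    rw [intervalIntegral.integral_congr (g := fun _ => (0 : ℝ)), intervalIntegral.integral_zero]
    intro φ hφ
    rw [Set.uIcc_of_le (by linarith)] at hφ
    simp only [hf]
    rcases le_total φ (-(Real.pi / 2)) with h | h
    · have : Real.cos φ ≤ 0 := by
        rw [← Real.cos_neg]
        exact Real.cos_nonpos_of_pi_div_two_le_of_le (by linarith) (by linarith [hφ.1])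
      rw [max_eq_right this, zero_pow ha, zero_mul]
    · have : Real.cos (φ - θ) ≤ 0 := by
        rw [← Real.cos_neg]
        exact Real.cos_nonpos_of_pi_div_two_le_of_le (by linarith [hφ.2]) (by linarith)
      rw [max_eq_right this, zero_pow hb, mul_zero]
  have h2 : ∫ φ in (Real.pi / 2)..Real.pi, f φ = 0 := by
    rw [intervalIntegral.integral_congr (g := fun _ => (0 : ℝ)), intervalIntegral.integral_zero]
    intro φ hφ
    rw [Set.uIcc_of_le (by linarith)] at hφ
    simp only [hf]
    have : Real.cos φ ≤ 0 := Real.cos_nonpos_of_pi_div_two_le_of_le hφ.1 (by linarith [hφ.2])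
    rw [max_eq_right this, zero_pow ha, zero_mul]
  rw [h1, h2, zero_add, add_zero]
  refine intervalIntegral.integral_congr fun φ hφ => ?_
  rw [Set.uIcc_of_le (by linarith)] at hφ
  simp only [hf]
  rw [max_eq_left (Real.cos_nonneg_of_mem_Icc ⟨by linarith [hφ.1], hφ.2⟩),
    max_eq_left (Real.cos_nonneg_of_mem_Icc ⟨by linarith [hφ.1], by linarith [hφ.2]⟩)]

theorem cos_mul_cos_sub (φ θ : ℝ) :
    Real.cos φ * Real.cos (φ - θ) = (Real.cos θ + Real.cos (2 * φ - θ)) / 2 := by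
  have h1 := Real.cos_sub φ (φ - θ)
  have h2 := Real.cos_add φ (φ - θ)
  rw [sub_sub_cancel] at h1
  rw [show φ + (φ - θ) = 2 * φ - θ by ring] at h2
  linear_combination (-1 / 2) * h1 + (-1 / 2) * h2

theorem integral_cos_mul_cos_sub (θ : ℝ) :
    ∫ φ in (θ - Real.pi / 2)..(Real.pi / 2), Real.cos φ ^ 1 * Real.cos (φ - θ) ^ 1
      = ((Real.pi - θ) * Real.cos θ + Real.sin θ) / 2 := by
  have hd : ∀ φ : ℝ, HasDerivAt (fun φ : ℝ => φ * Real.cos θ / 2 + Real.sin (2 * φ - θ) / 4)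
      (Real.cos φ ^ 1 * Real.cos (φ - θ) ^ 1) φ := by
    intro φ
    have h1 : HasDerivAt (fun φ : ℝ => 2 * φ - θ) 2 φ := by
      simpa using ((hasDerivAt_id φ).const_mul 2).sub_const θ
    have h2 := (((hasDerivAt_id φ).mul_const (Real.cos θ)).div_const 2).add (h1.sin.div_const 4)
    refine h2.congr_deriv ?_
    rw [pow_one, pow_one, cos_mul_cos_sub]
    ring
  rw [intervalIntegral.integral_eq_sub_of_hasDerivAt (fun φ _ => hd φ)
    (Continuous.intervalIntegrable (by fun_prop) _ _)]
  rw [show 2 * (Real.pi / 2) - θ = Real.pi - θ by ring,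
    show 2 * (θ - Real.pi / 2) - θ = -(Real.pi - θ) by ring, Real.sin_neg, Real.sin_pi_sub]
  ring

theorem integral_cos_sq_mul_cos_sub_sq (θ : ℝ) :
    ∫ φ in (θ - Real.pi / 2)..(Real.pi / 2), Real.cos φ ^ 2 * Real.cos (φ - θ) ^ 2
      = ((Real.pi - θ) * (1 + 2 * Real.cos θ ^ 2) + 3 * Real.sin θ * Real.cos θ) / 8 := by
  have hd : ∀ φ : ℝ, HasDerivAt (fun φ : ℝ => (Real.cos θ ^ 2 + 1 / 2) / 4 * φ
      + Real.cos θ * Real.sin (2 * φ - θ) / 4 + Real.sin (2 * (2 * φ - θ)) / 32)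
      (Real.cos φ ^ 2 * Real.cos (φ - θ) ^ 2) φ := by
    intro φ
    have h1 : HasDerivAt (fun φ : ℝ => 2 * φ - θ) 2 φ := by
      simpa using ((hasDerivAt_id φ).const_mul 2).sub_const θ
    have h2 := (((hasDerivAt_id φ).const_mul ((Real.cos θ ^ 2 + 1 / 2) / 4)).add
      ((h1.sin.const_mul (Real.cos θ)).div_const 4)).add (((h1.const_mul 2).sin).div_const 32)
    refine h2.congr_deriv ?_
    rw [← mul_pow, cos_mul_cos_sub, Real.cos_two_mul (2 * φ - θ)]
    ring
  rw [intervalIntegral.integral_eq_sub_of_hasDerivAt (fun φ _ => hd φ)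
    (Continuous.intervalIntegrable (by fun_prop) _ _)]
  rw [show 2 * (Real.pi / 2) - θ = Real.pi - θ by ring,
    show 2 * (θ - Real.pi / 2) - θ = -(Real.pi - θ) by ring, mul_neg, Real.sin_neg, Real.sin_neg,
    Real.sin_two_mul, Real.sin_pi_sub, Real.cos_pi_sub]
  ring

theorem integral_cos_cube_mul_cos_sub (θ : ℝ) :
    ∫ φ in (θ - Real.pi / 2)..(Real.pi / 2), Real.cos φ ^ 3 * Real.cos (φ - θ) ^ 1
      = (3 * Real.cos θ * (Real.pi - θ) + 2 * Real.sin θ + Real.sin θ * Real.cos θ ^ 2) / 8 := by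
  have hd : ∀ φ : ℝ, HasDerivAt (fun φ : ℝ => 3 / 8 * Real.cos θ * φ + Real.sin (2 * φ - θ) / 8
      + Real.cos θ * Real.sin (2 * φ) / 8 + Real.sin (4 * φ - θ) / 32)
      (Real.cos φ ^ 3 * Real.cos (φ - θ) ^ 1) φ := by
    intro φ
    have h1 : HasDerivAt (fun φ : ℝ => 2 * φ - θ) 2 φ := by
      simpa using ((hasDerivAt_id φ).const_mul 2).sub_const θ
    have h3 : HasDerivAt (fun φ : ℝ => 2 * φ) 2 φ := by
      simpa using (hasDerivAt_id φ).const_mul 2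
    have h4 : HasDerivAt (fun φ : ℝ => 4 * φ - θ) 4 φ := by
      simpa using ((hasDerivAt_id φ).const_mul 4).sub_const θ
    have h2 := ((((hasDerivAt_id φ).const_mul (3 / 8 * Real.cos θ)).add (h1.sin.div_const 8)).add
      ((h3.sin.const_mul (Real.cos θ)).div_const 8)).add (h4.sin.div_const 32)
    refine h2.congr_deriv ?_
    have e1 : Real.cos φ ^ 3 * Real.cos (φ - θ) ^ 1
        = Real.cos φ ^ 2 * (Real.cos φ * Real.cos (φ - θ)) := by ring
    have e2 : Real.cos (4 * φ - θ) + Real.cos θ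
        = 2 * (Real.cos (2 * φ) * Real.cos (2 * φ - θ)) := by
      rw [cos_mul_cos_sub (2 * φ) θ, show 2 * (2 * φ) - θ = 4 * φ - θ by ring]
      ring
    have e3 : Real.cos φ ^ 2 = 1 / 2 + Real.cos (2 * φ) / 2 := Real.cos_sq φ
    rw [e1, cos_mul_cos_sub, e3]
    linear_combination (1 / 8) * e2
  rw [intervalIntegral.integral_eq_sub_of_hasDerivAt (fun φ _ => hd φ)
    (Continuous.intervalIntegrable (by fun_prop) _ _)]
  rw [show 2 * (θ - Real.pi / 2) - θ = -(Real.pi - θ) by ring,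
    show 2 * (θ - Real.pi / 2) = -(Real.pi - 2 * θ) by ring,
    show 4 * (θ - Real.pi / 2) - θ = 3 * θ - 2 * Real.pi by ring,
    show 4 * (Real.pi / 2) - θ = 2 * Real.pi - θ by ring,
    show 2 * (Real.pi / 2) = Real.pi by ring, Real.sin_neg, Real.sin_neg,
    Real.sin_pi_sub, Real.sin_pi_sub, Real.sin_sub_two_pi, Real.sin_two_pi_sub, Real.sin_pi,
    Real.sin_two_mul, Real.sin_three_mul]
  linear_combination (1 / 8 * Real.sin θ) * Real.sin_sq_add_cos_sq θ

theorem integral_act_mul_act (θ : ℝ) (h0 : 0 ≤ θ) (hπ : θ ≤ Real.pi) :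
    ∫ p, act 0 p * act θ p ∂pairLaw = crossMoment θ := by
  have h := integral_act_pow_mul_polar θ 1 1 1 rfl
  rw [integral_rectified_cos θ h0 hπ 1 1 one_ne_zero one_ne_zero, integral_cos_mul_cos_sub] at h
  simp only [pow_one] at h
  rw [h, crossMoment]
  have := Real.pi_ne_zero
  field_simp
  norm_num
  ring

theorem integral_act_sq_mul_act_sq (θ : ℝ) (h0 : 0 ≤ θ) (hπ : θ ≤ Real.pi) :
    ∫ p, act 0 p ^ 2 * act θ p ^ 2 ∂pairLaw = sqSqMoment θ := by
  rw [integral_act_pow_mul_polar θ 2 2 2 rfl,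
    integral_rectified_cos θ h0 hπ 2 2 two_ne_zero two_ne_zero, integral_cos_sq_mul_cos_sub_sq,
    sqSqMoment]
  have := Real.pi_ne_zero
  field_simp
  norm_num [Nat.factorial]
  ring

theorem integral_act_cube_mul_act (θ : ℝ) (h0 : 0 ≤ θ) (hπ : θ ≤ Real.pi) :
    ∫ p, act 0 p ^ 3 * act θ p ∂pairLaw = cubeMoment θ := by
  have h := integral_act_pow_mul_polar θ 3 1 2 rfl
  rw [integral_rectified_cos θ h0 hπ 3 1 three_ne_zero one_ne_zero,
    integral_cos_cube_mul_cos_sub] at h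
  simp only [pow_one] at h
  rw [h, cubeMoment]
  have := Real.pi_ne_zero
  field_simp
  norm_num [Nat.factorial]
  ring

theorem integral_act_mul_act_cube (θ : ℝ) (h0 : 0 ≤ θ) (hπ : θ ≤ Real.pi) :
    ∫ p, act 0 p * act θ p ^ 3 ∂pairLaw = cubeMoment θ := by
  have h := integral_act_swap θ 3 1
  simp only [pow_one] at h
  rw [← integral_act_cube_mul_act θ h0 hπ, ← integral_congr_ae (Eventually.of_forall
    fun p => mul_comm (act θ p ^ 3) (act 0 p)), h]

theorem integral_act_pow (θ : ℝ) (a : ℕ) :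
    ∫ p, act θ p ^ a ∂pairLaw = ∫ p, act 0 p ^ a ∂pairLaw := by
  simpa using integral_act_swap θ a 0

theorem integral_act_sq (θ : ℝ) : ∫ p, act θ p ^ 2 ∂pairLaw = 1 := by
  have h := integral_act_mul_act 0 le_rfl Real.pi_pos.le
  simp only [← sq] at h
  rw [integral_act_pow, h]
  simp [crossMoment, Real.pi_ne_zero]

theorem integral_act_pow_four (θ : ℝ) : ∫ p, act θ p ^ 4 ∂pairLaw = 6 := by
  have h := integral_act_sq_mul_act_sq 0 le_rfl Real.pi_pos.le
  simp only [← pow_add] at h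
  rw [integral_act_pow, h]
  have := Real.pi_ne_zero
  simp [sqSqMoment]
  field_simp
  norm_num

/-! ### Moments of sums of independent copies -/

/-- The sum of `f` over the coordinates. -/
def coordSum {α : Type*} (f : α → ℝ) {n : ℕ} (ω : Fin n → α) : ℝ := ∑ i, f (ω i)

theorem coordSum_succ {α : Type*} (f : α → ℝ) {n : ℕ} (ω : Fin (n + 1) → α) :
    coordSum f ω = f (ω 0) + coordSum f fun i : Fin n => ω i.succ := by
  simp [coordSum, Fin.sum_univ_succ]

section Sums

variable {α β : Type*} [MeasurableSpace α] [MeasurableSpace β]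

/-- `f` is integrable with expectation `v`. -/
def HasMean (μ : Measure α) (f : α → ℝ) (v : ℝ) : Prop := Integrable f μ ∧ ∫ x, f x ∂μ = v

theorem HasMean.add {μ : Measure α} {f g : α → ℝ} {v w : ℝ} (hf : HasMean μ f v)
    (hg : HasMean μ g w) : HasMean μ (fun x => f x + g x) (v + w) :=
  ⟨hf.1.add hg.1, by rw [integral_add hf.1 hg.1, hf.2, hg.2]⟩

theorem HasMean.const_mul {μ : Measure α} {f : α → ℝ} {v : ℝ} (hf : HasMean μ f v) (c : ℝ) :
    HasMean μ (fun x => c * f x) (c * v) :=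
  ⟨hf.1.const_mul c, by rw [integral_const_mul, hf.2]⟩

theorem HasMean.sub {μ : Measure α} {f g : α → ℝ} {v w : ℝ} (hf : HasMean μ f v)
    (hg : HasMean μ g w) : HasMean μ (fun x => f x - g x) (v - w) :=
  ⟨hf.1.sub hg.1, by rw [integral_sub hf.1 hg.1, hf.2, hg.2]⟩

theorem hasMean_const (μ : Measure α) [IsProbabilityMeasure μ] (c : ℝ) :
    HasMean μ (fun _ => c) c := ⟨integrable_const c, by simp⟩

theorem HasMean.congr {μ : Measure α} {f g : α → ℝ} {v w : ℝ} (hf : HasMean μ f v)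
    (h : ∀ x, g x = f x) (hv : w = v) : HasMean μ g w := by
  rw [hv, show g = f from funext h]; exact hf

theorem HasMean.mul_prod {μ : Measure α} {ν : Measure β} [SFinite μ] [SFinite ν] {f : α → ℝ}
    {g : β → ℝ} {v w : ℝ} (hf : HasMean μ f v) (hg : HasMean ν g w) :
    HasMean (μ.prod ν) (fun z => f z.1 * g z.2) (v * w) :=
  ⟨hf.1.mul_prod hg.1, by rw [integral_prod_mul, hf.2, hg.2]⟩

theorem HasMean.of_split {μ : Measure α} [IsProbabilityMeasure μ] {n : ℕ}
    {F : (Fin (n + 1) → α) → ℝ} {G : α × (Fin n → α) → ℝ} {v : ℝ}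
    (hG : HasMean (μ.prod (Measure.pi fun _ : Fin n => μ)) G v)
    (h : ∀ ω, F ω = G (ω 0, fun i => ω i.succ)) :
    HasMean (Measure.pi fun _ : Fin (n + 1) => μ) F v := by
  have hm := measurePreserving_piFinSuccAbove (fun _ : Fin (n + 1) => μ) 0
  have hF : F = G ∘ MeasurableEquiv.piFinSuccAbove (fun _ : Fin (n + 1) => α) 0 := by
    ext ω
    rw [h]
    rfl
  rw [hF]
  refine ⟨(hm.integrable_comp_emb (MeasurableEquiv.measurableEmbedding _)).2 hG.1, ?_⟩
  rw [← hG.2]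
  exact hm.integral_comp' (f := MeasurableEquiv.piFinSuccAbove (fun _ : Fin (n + 1) => α) 0) G

variable {μ : Measure α} [IsProbabilityMeasure μ]

theorem hasMean_coordSum {p : α → ℝ} (hp : HasMean μ p 0) (n : ℕ) :
    HasMean (Measure.pi fun _ : Fin n => μ) (coordSum p) 0 := by
  induction n with
  | zero => exact (hasMean_const _ 0).congr (fun ω => by simp [coordSum]) rfl
  | succ n ih =>
    have h1 := (hp.mul_prod (hasMean_const (Measure.pi fun _ : Fin n => μ) 1)).add
      ((hasMean_const μ 1).mul_prod ih)
    exact HasMean.of_split (h1.congr (fun _ => rfl) (by ring)) fun ω => by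
      rw [coordSum_succ]; ring

theorem hasMean_coordSum_mul {p q : α → ℝ} {v : ℝ} (hp : HasMean μ p 0) (hq : HasMean μ q 0)
    (hpq : HasMean μ (fun x => p x * q x) v) (n : ℕ) :
    HasMean (Measure.pi fun _ : Fin n => μ) (fun ω => coordSum p ω * coordSum q ω) (n * v) := by
  induction n with
  | zero => exact (hasMean_const _ 0).congr (fun ω => by simp [coordSum]) (by simp)
  | succ n ih =>
    have h1 := (((hpq.mul_prod (hasMean_const (Measure.pi fun _ : Fin n => μ) 1)).add
      (hp.mul_prod (hasMean_coordSum hq n))).add (hq.mul_prod (hasMean_coordSum hp n))).add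
      ((hasMean_const μ 1).mul_prod ih)
    exact HasMean.of_split (h1.congr (fun _ => rfl) (by push_cast; ring)) fun ω => by
      rw [coordSum_succ, coordSum_succ]; ring

/-- The third mixed moment of centred sums grows only linearly: `E[S_p S_q S_r] = n E[p q r]`. -/
theorem hasMean_coordSum_mul_mul {p q r : α → ℝ} {u v w t : ℝ} (hp : HasMean μ p 0)
    (hq : HasMean μ q 0) (hr : HasMean μ r 0) (hpq : HasMean μ (fun x => p x * q x) u)
    (hpr : HasMean μ (fun x => p x * r x) v) (hqr : HasMean μ (fun x => q x * r x) w)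
    (hpqr : HasMean μ (fun x => p x * q x * r x) t) (n : ℕ) :
    HasMean (Measure.pi fun _ : Fin n => μ)
      (fun ω => coordSum p ω * coordSum q ω * coordSum r ω) (n * t) := by
  induction n with
  | zero => exact (hasMean_const _ 0).congr (fun ω => by simp [coordSum]) (by simp)
  | succ n ih =>
    have h1 := (((((((hpqr.mul_prod (hasMean_const (Measure.pi fun _ : Fin n => μ) 1)).add
      (hpq.mul_prod (hasMean_coordSum hr n))).add (hpr.mul_prod (hasMean_coordSum hq n))).add
      (hqr.mul_prod (hasMean_coordSum hp n))).add
      (hp.mul_prod (hasMean_coordSum_mul hq hr hqr n))).add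
      (hq.mul_prod (hasMean_coordSum_mul hp hr hpr n))).add
      (hr.mul_prod (hasMean_coordSum_mul hp hq hpq n))).add
      ((hasMean_const μ 1).mul_prod ih)
    exact HasMean.of_split (h1.congr (fun _ => rfl) (by push_cast; ring)) fun ω => by
      rw [coordSum_succ, coordSum_succ, coordSum_succ]; ring

theorem hasMean_coordSum_pow_four {p : α → ℝ} {m₂ m₃ m₄ : ℝ} (hp : HasMean μ p 0)
    (h2 : HasMean μ (fun x => p x * p x) m₂) (h3 : HasMean μ (fun x => p x * p x * p x) m₃)
    (h4 : HasMean μ (fun x => p x ^ 4) m₄) (n : ℕ) :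
    HasMean (Measure.pi fun _ : Fin n => μ) (fun ω => coordSum p ω ^ 4)
      (n * m₄ + 3 * n * (n - 1) * m₂ ^ 2) := by
  induction n with
  | zero => exact (hasMean_const _ 0).congr (fun ω => by simp [coordSum]) (by simp)
  | succ n ih =>
    have h1 := ((((h4.mul_prod (hasMean_const (Measure.pi fun _ : Fin n => μ) 1)).add
      ((h3.mul_prod (hasMean_coordSum hp n)).const_mul 4)).add
      ((h2.mul_prod (hasMean_coordSum_mul hp hp h2 n)).const_mul 6)).add
      ((hp.mul_prod (hasMean_coordSum_mul_mul hp hp hp h2 h2 h2 h3 n)).const_mul 4)).add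
      ((hasMean_const μ 1).mul_prod ih)
    exact HasMean.of_split (h1.congr (fun _ => rfl) (by push_cast; ring)) fun ω => by
      rw [coordSum_succ]; ring

/-! ### Exponential concentration -/

/-- Cramér–Chernoff: the sum of `n` copies of a centred variable with exponential moments exceeds
`n δ` with a probability that decays geometrically in `n`. -/
theorem exists_measure_coordSum_ge_le {p : α → ℝ} (hp : HasMean μ p 0) (hm : Measurable p)
    (hexp : ∃ c > 0, Integrable (fun x => Real.exp (c * |p x|)) μ) {δ : ℝ} (hδ : 0 < δ) :
    ∃ r, 0 < r ∧ r < 1 ∧ ∀ n : ℕ,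
      (Measure.pi fun _ : Fin n => μ).real {ω | n * δ ≤ coordSum p ω} ≤ r ^ n := by
  obtain ⟨c, hc, hint⟩ := hexp
  have hset : ∀ t ∈ Set.Ioo (-c) c, t ∈ integrableExpSet p μ := by
    intro t ht
    refine hint.mono' (by fun_prop) (Eventually.of_forall fun x => ?_)
    rw [Real.norm_of_nonneg (Real.exp_pos _).le]
    refine Real.exp_le_exp.2 ((le_abs_self _).trans ?_)
    rw [abs_mul]
    exact mul_le_mul_of_nonneg_right (abs_le.2 ⟨ht.1.le, ht.2.le⟩) (abs_nonneg _)
  have h0 : (0 : ℝ) ∈ interior (integrableExpSet p μ) :=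
    mem_interior.2 ⟨Set.Ioo (-c) c, hset, isOpen_Ioo, by simp [hc]⟩
  -- the derivative of `t ↦ exp (-t δ) E[exp (t p)]` at `0` is `-δ < 0`
  have hd : HasDerivAt (fun t => Real.exp (-(t * δ)) * mgf p μ t) (-δ) 0 := by
    have h1 := hasDerivAt_mgf h0
    have h2 : HasDerivAt (fun t : ℝ => Real.exp (-(t * δ))) (-δ) 0 := by
      simpa using (((hasDerivAt_id (0 : ℝ)).mul_const δ).neg).exp
    refine (h2.mul h1).congr_deriv ?_
    simp [hp.2]
  have hslope := hd.hasDerivWithinAt (s := Set.Ioi 0)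
  rw [hasDerivWithinAt_iff_tendsto_slope' (by simp)] at hslope
  have hev := hslope.eventually (gt_mem_nhds (show -δ < 0 by linarith))
  obtain ⟨t, ht⟩ := (hev.and (Ioo_mem_nhdsGT hc)).exists
  obtain ⟨hts, ht0, htc⟩ := ht
  have hlt : Real.exp (-(t * δ)) * mgf p μ t < 1 := by
    rw [slope_def_field, div_lt_iff₀ (by linarith)] at hts
    simp at hts
    linarith
  refine ⟨_, mul_pos (Real.exp_pos _) (mgf_pos (hset t ⟨by linarith, htc⟩)), hlt, fun n => ?_⟩
  have hmgf : mgf (coordSum p) (Measure.pi fun _ : Fin n => μ) t = mgf p μ t ^ n := by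
    simp only [mgf, coordSum, Finset.mul_sum, Real.exp_sum]
    rw [integral_fintype_prod_eq_pow (fun x => Real.exp (t * p x)), Fintype.card_fin]
  have hintn : Integrable (fun ω => Real.exp (t * coordSum p ω))
      (Measure.pi fun _ : Fin n => μ) := by
    simp only [coordSum, Finset.mul_sum, Real.exp_sum]
    exact Integrable.fintype_prod fun _ => hset t ⟨by linarith, htc⟩
  refine (measure_ge_le_exp_mul_mgf (n * δ) ht0.le hintn).trans (le_of_eq ?_)
  rw [hmgf, mul_pow, ← Real.exp_nat_mul]
  congr 2
  ring

theorem exists_measure_abs_coordSum_ge_le {p : α → ℝ} (hp : HasMean μ p 0) (hm : Measurable p)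
    (hexp : ∃ c > 0, Integrable (fun x => Real.exp (c * |p x|)) μ) {δ : ℝ} (hδ : 0 < δ) :
    ∃ r, 0 < r ∧ r < 1 ∧ ∀ n : ℕ,
      (Measure.pi fun _ : Fin n => μ).real {ω | n * δ ≤ |coordSum p ω|} ≤ 2 * r ^ n := by
  obtain ⟨r₁, h10, h11, h1⟩ := exists_measure_coordSum_ge_le hp hm hexp hδ
  obtain ⟨r₂, h20, h21, h2⟩ := exists_measure_coordSum_ge_le (p := fun x => -p x)
    ((hp.const_mul (-1)).congr (fun x => by ring) (by ring)) hm.neg (by simpa using hexp) hδ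
  refine ⟨max r₁ r₂, lt_max_of_lt_left h10, max_lt h11 h21, fun n => ?_⟩
  have hsub : {ω : Fin n → α | n * δ ≤ |coordSum p ω|} ⊆
      {ω | n * δ ≤ coordSum p ω} ∪ {ω | n * δ ≤ coordSum (fun x => -p x) ω} := by
    intro ω hω
    have : coordSum (fun x => -p x) ω = -coordSum p ω := by simp [coordSum]
    simp only [Set.mem_union, Set.mem_ofPred_eq, this] at hω ⊢
    exact le_abs.1 hω
  calc _ ≤ _ := measureReal_mono hsub
    _ ≤ _ := measureReal_union_le _ _
    _ ≤ r₁ ^ n + r₂ ^ n := add_le_add (h1 n) (h2 n)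
    _ ≤ max r₁ r₂ ^ n + max r₁ r₂ ^ n := add_le_add
        (pow_le_pow_left₀ h10.le (le_max_left _ _) n) (pow_le_pow_left₀ h20.le (le_max_right _ _) n)
    _ = 2 * max r₁ r₂ ^ n := by ring

end Sums

/-! ### Negative moments of minors of the activation matrix -/

/-- `|t|^(-1/2)` in `[0, ∞)`, with value `0` at `t = 0`. -/
noncomputable def invSqrtAbs (t : ℝ) : ENNReal := ENNReal.ofReal (|t| ^ (-(1 / 2) : ℝ))

theorem invSqrtAbs_zero : invSqrtAbs 0 = 0 := by
  rw [invSqrtAbs, abs_zero, Real.zero_rpow (by norm_num), ENNReal.ofReal_zero]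

@[fun_prop]
theorem measurable_invSqrtAbs : Measurable invSqrtAbs := by unfold invSqrtAbs; fun_prop

theorem invSqrtAbs_mul (s t : ℝ) : invSqrtAbs (s * t) = invSqrtAbs s * invSqrtAbs t := by
  rw [invSqrtAbs, invSqrtAbs, invSqrtAbs, abs_mul, Real.mul_rpow (abs_nonneg _) (abs_nonneg _),
    ENNReal.ofReal_mul (by positivity)]

theorem invSqrtAbs_neg (t : ℝ) : invSqrtAbs (-t) = invSqrtAbs t := by
  rw [invSqrtAbs, invSqrtAbs, abs_neg]

theorem gaussianReal_le_volume : gaussianReal 0 1 ≤ (volume : Measure ℝ) := by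
  rw [gaussianReal_of_var_ne_zero _ one_ne_zero]
  conv_rhs => rw [← withDensity_one (μ := (volume : Measure ℝ))]
  refine withDensity_mono (Eventually.of_forall fun x => ?_)
  simp only [gaussianPDF, Pi.one_apply]
  rw [← ENNReal.ofReal_one]
  refine ENNReal.ofReal_le_ofReal ?_
  rw [gaussianPDFReal]
  refine mul_le_one₀ (inv_le_one_of_one_le₀ ?_) (Real.exp_pos _).le (Real.exp_le_one_iff.2 ?_)
  · rw [Real.one_le_sqrt]
    have := Real.pi_gt_three
    simp
    linarith
  · rw [neg_div, neg_nonpos]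
    positivity

theorem lintegral_invSqrtAbs_unit_interval :
    ∫⁻ h in Set.Ioo (-1 : ℝ) 1, invSqrtAbs h < ⊤ := by
  have hpos : ∫⁻ h in Set.Ioc (0 : ℝ) 1, invSqrtAbs h < ⊤ := by
    have hi : IntegrableOn (fun x : ℝ => x ^ (-(1 / 2) : ℝ)) (Set.Ioc 0 1) :=
      (intervalIntegrable_iff_integrableOn_Ioc_of_le zero_le_one).1
        (intervalIntegral.intervalIntegrable_rpow' (by norm_num))
    refine lt_of_le_of_lt (le_of_eq ?_) hi.2
    refine setLIntegral_congr_fun measurableSet_Ioc fun x hx => ?_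
    rw [invSqrtAbs, abs_of_pos hx.1, Real.enorm_of_nonneg (Real.rpow_nonneg hx.1.le _)]
  have hneg : ∫⁻ h in Set.Ico (-1 : ℝ) 0, invSqrtAbs h < ⊤ := by
    have hmp := (Measure.measurePreserving_neg (volume : Measure ℝ)).setLIntegral_comp_preimage
      (s := Set.Ioc (0 : ℝ) 1) measurableSet_Ioc measurable_invSqrtAbs
    have hset : (Neg.neg ⁻¹' Set.Ioc (0 : ℝ) 1) = Set.Ico (-1 : ℝ) 0 := by
      ext x
      simp only [Set.mem_preimage, Set.mem_Ioc, Set.mem_Ico]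
      constructor <;> rintro ⟨h1, h2⟩ <;> constructor <;> linarith
    rw [hset] at hmp
    simp only [invSqrtAbs_neg] at hmp
    rw [hmp]
    exact hpos
  have hsub : Set.Ioo (-1 : ℝ) 1 ⊆ Set.Ico (-1 : ℝ) 0 ∪ ({0} ∪ Set.Ioc 0 1) := by
    intro x hx
    rcases lt_trichotomy x 0 with h | h | h
    · exact Or.inl ⟨hx.1.le, h⟩
    · exact Or.inr (Or.inl h)
    · exact Or.inr (Or.inr ⟨h, hx.2.le⟩)
  refine lt_of_le_of_lt (lintegral_mono_set hsub) (lt_of_le_of_lt (lintegral_union_le _ _ _) ?_)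
  refine ENNReal.add_lt_top.2 ⟨hneg, lt_of_le_of_lt (lintegral_union_le _ _ _) ?_⟩
  refine ENNReal.add_lt_top.2 ⟨?_, hpos⟩
  simp

/-- A bound for the negative moment of a Gaussian variable of variance `b²` that is uniform in the
mean. -/
noncomputable def invSqrtBound : ENNReal := 1 + ∫⁻ h in Set.Ioo (-1 : ℝ) 1, invSqrtAbs h

theorem invSqrtBound_lt_top : invSqrtBound < ⊤ :=
  ENNReal.add_lt_top.2 ⟨ENNReal.one_lt_top, lintegral_invSqrtAbs_unit_interval⟩

theorem lintegral_invSqrtAbs_affine_le (k : ℝ) {b : ℝ} (hb : b ≠ 0) :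
    ∫⁻ h, invSqrtAbs (k + b * h) ∂(gaussianReal 0 1) ≤ invSqrtBound * invSqrtAbs b := by
  have h1 : ∀ h : ℝ, invSqrtAbs (k + b * h) = invSqrtAbs (k / b + h) * invSqrtAbs b := by
    intro h
    rw [← invSqrtAbs_mul]
    congr 1
    field_simp
  simp only [h1]
  rw [lintegral_mul_const _ (by fun_prop)]
  gcongr
  have h2 : ∀ h : ℝ, invSqrtAbs (k / b + h) ≤
      1 + (Set.Ioo (-1 : ℝ) 1).indicator invSqrtAbs (k / b + h) := by
    intro h
    by_cases hm : k / b + h ∈ Set.Ioo (-1 : ℝ) 1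
    · rw [Set.indicator_of_mem hm]
      exact le_add_self
    · rw [Set.indicator_of_notMem hm, add_zero, invSqrtAbs, ← ENNReal.ofReal_one]
      refine ENNReal.ofReal_le_ofReal (Real.rpow_le_one_of_one_le_of_nonpos ?_ (by norm_num))
      by_contra hlt
      exact hm (abs_lt.1 (not_le.1 hlt))
  refine (lintegral_mono h2).trans ?_
  have hmi : Measurable ((Set.Ioo (-1 : ℝ) 1).indicator invSqrtAbs) :=
    measurable_invSqrtAbs.indicator measurableSet_Ioo
  rw [lintegral_add_left measurable_const, lintegral_const, measure_univ, mul_one, invSqrtBound]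
  refine add_le_add le_rfl ?_
  refine (lintegral_mono' gaussianReal_le_volume le_rfl).trans ?_
  rw [lintegral_add_left_eq_self (fun h => (Set.Ioo (-1 : ℝ) 1).indicator invSqrtAbs h),
    lintegral_indicator measurableSet_Ioo]

/-- A `2 × 2` minor of the matrix of activations. -/
noncomputable def minor (θ : ℝ) (x y : ℝ × ℝ) : ℝ := act 0 x * act θ y - act 0 y * act θ x

theorem invSqrtAbs_max_le (t : ℝ) : invSqrtAbs (max t 0) ≤ invSqrtAbs t := by
  rcases le_total t 0 with h | h
  · rw [max_eq_right h, invSqrtAbs_zero]; exact zero_le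
  · rw [max_eq_left h]

theorem lintegral_invSqrtAbs_act_lt_top {θ : ℝ} (hθ : Real.sin θ ≠ 0) :
    ∫⁻ p, invSqrtAbs (act θ p) ∂pairLaw < ⊤ := by
  rw [pairLaw, lintegral_prod _ (by fun_prop)]
  have h2 : Real.sqrt 2 ≠ 0 := by positivity
  refine lt_of_le_of_lt (lintegral_mono (g := fun _ =>
    invSqrtAbs (Real.sqrt 2) * (invSqrtBound * invSqrtAbs (Real.sin θ))) fun x => ?_) ?_
  · refine le_trans (lintegral_mono (g := fun y => invSqrtAbs (Real.sqrt 2) *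
      invSqrtAbs (Real.cos θ * x + Real.sin θ * y)) fun y => ?_) ?_
    · simp only [act, invSqrtAbs_mul]
      exact mul_le_mul' le_rfl (invSqrtAbs_max_le _)
    · rw [lintegral_const_mul _ (by fun_prop)]
      exact mul_le_mul' le_rfl (lintegral_invSqrtAbs_affine_le _ hθ)
  · rw [lintegral_const, measure_univ, mul_one]
    exact ENNReal.mul_lt_top ENNReal.ofReal_lt_top
      (ENNReal.mul_lt_top invSqrtBound_lt_top ENNReal.ofReal_lt_top)

theorem lintegral_invSqrtAbs_fst_lt_top :
    ∫⁻ p : ℝ × ℝ, invSqrtAbs p.1 ∂pairLaw < ⊤ := by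
  rw [pairLaw, lintegral_prod _ (by fun_prop)]
  simp only [lintegral_const, measure_univ, mul_one]
  have h := lintegral_invSqrtAbs_affine_le 0 one_ne_zero
  simp only [zero_add, one_mul] at h
  exact lt_of_le_of_lt h (ENNReal.mul_lt_top invSqrtBound_lt_top ENNReal.ofReal_lt_top)

theorem lintegral_invSqrtAbs_act_zero_lt_top :
    ∫⁻ p, invSqrtAbs (act 0 p) ∂pairLaw < ⊤ := by
  refine lt_of_le_of_lt (lintegral_mono (g := fun p : ℝ × ℝ => invSqrtAbs (Real.sqrt 2) *
    invSqrtAbs p.1) fun p => ?_) ?_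
  · simp only [act, proj_zero, invSqrtAbs_mul]
    gcongr
    exact invSqrtAbs_max_le _
  · rw [lintegral_const_mul _ (by fun_prop)]
    exact ENNReal.mul_lt_top ENNReal.ofReal_lt_top lintegral_invSqrtAbs_fst_lt_top

/-- A nonzero minor is either affine in the second Gaussian coordinate of `y`, or a product of two
activations. -/
theorem invSqrtAbs_minor_le (θ : ℝ) (x y : ℝ × ℝ) :
    invSqrtAbs (minor θ x y) ≤
      {p : ℝ × ℝ | 0 < p.1}.indicator (fun x => invSqrtAbs
        ((2 * x.1 * (Real.cos θ * y.1) - act 0 y * act θ x) + (2 * Real.sin θ * x.1) * y.2)) x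
      + invSqrtAbs (act θ x) * invSqrtAbs (act 0 y) := by
  have hprod : act 0 x * act θ y = 0 → invSqrtAbs (minor θ x y) =
      invSqrtAbs (act θ x) * invSqrtAbs (act 0 y) := by
    intro h
    rw [minor, h, zero_sub, invSqrtAbs_neg, invSqrtAbs_mul, mul_comm]
  by_cases hx : 0 < x.1
  · by_cases hy : 0 < proj θ y
    · have h2 : Real.sqrt 2 * Real.sqrt 2 = 2 := Real.mul_self_sqrt (by norm_num)
      have hm : minor θ x y = (2 * x.1 * (Real.cos θ * y.1) - act 0 y * act θ x)
          + (2 * Real.sin θ * x.1) * y.2 := by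
        have e1 : act 0 x = Real.sqrt 2 * x.1 := by rw [act, proj_zero, max_eq_left hx.le]
        have e2 : act θ y = Real.sqrt 2 * (Real.cos θ * y.1 + Real.sin θ * y.2) := by
          rw [act, max_eq_left hy.le, proj]
        rw [minor, e1, e2]
        linear_combination (x.1 * (Real.cos θ * y.1 + Real.sin θ * y.2)) * h2
      rw [Set.indicator_of_mem (by exact hx), hm]
      exact le_self_add
    · rw [hprod (by rw [show act θ y = 0 by rw [act, max_eq_right (not_lt.1 hy), mul_zero],
        mul_zero])]
      exact le_add_self
  · rw [hprod (by rw [show act 0 x = 0 by rw [act, proj_zero, max_eq_right (not_lt.1 hx), mul_zero],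
        zero_mul])]
    exact le_add_self

theorem lintegral_invSqrtAbs_minor_lt_top {θ : ℝ} (hθ : Real.sin θ ≠ 0) :
    ∫⁻ z : (ℝ × ℝ) × (ℝ × ℝ), invSqrtAbs (minor θ z.1 z.2) ∂(pairLaw.prod pairLaw) < ⊤ := by
  have hset : MeasurableSet {p : ℝ × ℝ | 0 < p.1} := measurableSet_lt measurable_const measurable_fst
  have hmeas : Measurable fun z : (ℝ × ℝ) × (ℝ × ℝ) => invSqrtAbs (minor θ z.1 z.2) := by
    unfold minor; fun_prop
  rw [lintegral_prod _ hmeas.aemeasurable]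
  set A : ENNReal := ∫⁻ y, invSqrtAbs (act 0 y) ∂pairLaw with hA
  have hbound : ∀ x : ℝ × ℝ, ∫⁻ y, invSqrtAbs (minor θ x y) ∂pairLaw ≤
      invSqrtBound * invSqrtAbs (2 * Real.sin θ) * invSqrtAbs x.1 + invSqrtAbs (act θ x) * A := by
    intro x
    refine (lintegral_mono fun y => invSqrtAbs_minor_le θ x y).trans ?_
    rw [lintegral_add_right _ (by fun_prop), lintegral_const_mul _ (by fun_prop)]
    gcongr
    by_cases hx : 0 < x.1
    · have hmem : x ∈ {p : ℝ × ℝ | 0 < p.1} := hx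
      simp only [Set.indicator_of_mem hmem]
      rw [pairLaw, lintegral_prod _ (by fun_prop)]
      refine le_trans (lintegral_mono (g := fun _ => invSqrtBound *
        invSqrtAbs (2 * Real.sin θ * x.1)) fun y₁ => ?_) ?_
      · have hfst : ∀ y₂ : ℝ, act 0 (y₁, y₂) = act 0 (y₁, 0) := fun y₂ => by
          simp only [act, proj_zero]
        simp only [hfst]
        exact lintegral_invSqrtAbs_affine_le _ (mul_ne_zero (mul_ne_zero two_ne_zero hθ) hx.ne')
      · rw [lintegral_const, measure_univ, mul_one, invSqrtAbs_mul (2 * Real.sin θ), mul_assoc]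
    · have hmem : x ∉ {p : ℝ × ℝ | 0 < p.1} := hx
      simp only [Set.indicator_of_notMem hmem, lintegral_zero]
      exact zero_le
  refine lt_of_le_of_lt (lintegral_mono hbound) ?_
  rw [lintegral_add_left (by fun_prop), lintegral_const_mul _ (by fun_prop),
    lintegral_mul_const _ (by fun_prop)]
  refine ENNReal.add_lt_top.2 ⟨ENNReal.mul_lt_top (ENNReal.mul_lt_top invSqrtBound_lt_top
    ENNReal.ofReal_lt_top) lintegral_invSqrtAbs_fst_lt_top,
    ENNReal.mul_lt_top (lintegral_invSqrtAbs_act_lt_top hθ) lintegral_invSqrtAbs_act_zero_lt_top⟩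

/-- The law of `n` independent standard Gaussian pairs, one for each neuron of a layer. -/
noncomputable def layerLaw (n : ℕ) : Measure (Fin n → ℝ × ℝ) := Measure.pi fun _ => pairLaw

instance (n : ℕ) : IsProbabilityMeasure (layerLaw n) := by unfold layerLaw; infer_instance

theorem measurePreserving_eval_pair {n : ℕ} {i j : Fin n} (hij : i ≠ j) :
    MeasurePreserving (fun ω : Fin n → ℝ × ℝ => (ω i, ω j)) (layerLaw n) (pairLaw.prod pairLaw) := by
  refine ⟨by fun_prop, ?_⟩
  have hind : iIndepFun (fun (i : Fin n) (ω : Fin n → ℝ × ℝ) => ω i) (layerLaw n) :=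
    iIndepFun_pi (X := fun _ => id) fun _ => aemeasurable_id
  have h := (indepFun_iff_map_prod_eq_prod_map_map (measurable_pi_apply i).aemeasurable
    (measurable_pi_apply j).aemeasurable).1
    (hind.indepFun hij)
  rw [h]
  congr 1 <;> exact (measurePreserving_eval (fun _ : Fin n => pairLaw) _).map_eq

/-- The negative moment of a minor does not depend on which two neurons it is built from. -/
theorem exists_hasMean_minor {θ : ℝ} (hθ : Real.sin θ ≠ 0) :
    ∃ v : ℝ, 0 ≤ v ∧ ∀ (n : ℕ) (i j : Fin n), i ≠ j →
      HasMean (layerLaw n) (fun ω => |minor θ (ω i) (ω j)| ^ (-(1 / 2) : ℝ)) v := by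
  set f : (ℝ × ℝ) × (ℝ × ℝ) → ℝ := fun z => |minor θ z.1 z.2| ^ (-(1 / 2) : ℝ) with hf
  have hmeas : Measurable f := by simp only [hf, minor]; fun_prop
  have hint : Integrable f (pairLaw.prod pairLaw) := by
    refine ⟨hmeas.aestronglyMeasurable, ?_⟩
    refine lt_of_le_of_lt (le_of_eq ?_) (lintegral_invSqrtAbs_minor_lt_top hθ)
    refine lintegral_congr fun z => ?_
    rw [Real.enorm_of_nonneg (by positivity), invSqrtAbs]
  refine ⟨∫ z, f z ∂(pairLaw.prod pairLaw), integral_nonneg fun z => by positivity,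
    fun n i j hij => ?_⟩
  have hmp := measurePreserving_eval_pair hij
  refine ⟨(hmp.integrable_comp hmeas.aestronglyMeasurable).2 hint, ?_⟩
  rw [← hmp.map_eq, integral_map hmp.measurable.aemeasurable hmeas.aestronglyMeasurable]

/-! ### Integrability of polynomials in the activations -/

/-- All moments of `f` under `pairLaw` are finite. -/
def HasAllMoments (f : ℝ × ℝ → ℝ) : Prop := ∀ q : ENNReal, q ≠ ⊤ → MemLp f q pairLaw

theorem HasAllMoments.mul {f g : ℝ × ℝ → ℝ} (hf : HasAllMoments f) (hg : HasAllMoments g) :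
    HasAllMoments fun p => f p * g p := by
  intro q hq
  have : ENNReal.HolderTriple (2 * q) (2 * q) q := ⟨by
    rw [ENNReal.mul_inv (Or.inl (by norm_num)) (Or.inl (by norm_num)), ← add_mul,
      ENNReal.inv_two_add_inv_two, one_mul]⟩
  have h2 : 2 * q ≠ ⊤ := ENNReal.mul_ne_top (by norm_num) hq
  exact (hg _ h2).mul (hf _ h2)

theorem HasAllMoments.pow {f : ℝ × ℝ → ℝ} (hf : HasAllMoments f) (k : ℕ) :
    HasAllMoments fun p => f p ^ k := by
  induction k with
  | zero => intro q _; simp only [pow_zero]; exact memLp_const 1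
  | succ k ih => simp only [pow_succ]; exact ih.mul hf

theorem HasAllMoments.sub {f g : ℝ × ℝ → ℝ} (hf : HasAllMoments f) (hg : HasAllMoments g) :
    HasAllMoments fun p => f p - g p := fun q hq => (hf q hq).sub (hg q hq)

theorem HasAllMoments.add {f g : ℝ × ℝ → ℝ} (hf : HasAllMoments f) (hg : HasAllMoments g) :
    HasAllMoments fun p => f p + g p := fun q hq => (hf q hq).add (hg q hq)

theorem hasAllMoments_const (c : ℝ) : HasAllMoments fun _ => c := fun _ _ => memLp_const c

theorem HasAllMoments.hasMean {f : ℝ × ℝ → ℝ} (hf : HasAllMoments f) :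
    HasMean pairLaw f (∫ p, f p ∂pairLaw) := ⟨memLp_one_iff_integrable.1 (hf 1 (by norm_num)), rfl⟩

theorem isGaussian_pairLaw : IsGaussian pairLaw := by unfold pairLaw; infer_instance

theorem act_le (θ : ℝ) (p : ℝ × ℝ) : act θ p ≤ 4 * ‖p‖ := by
  have h1 : |proj θ p| ≤ 2 * ‖p‖ := by
    have h3 : |p.1| ≤ ‖p‖ := norm_fst_le p
    have h4 : |p.2| ≤ ‖p‖ := norm_snd_le p
    calc |proj θ p| ≤ |Real.cos θ * p.1| + |Real.sin θ * p.2| := abs_add_le _ _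
      _ = |Real.cos θ| * |p.1| + |Real.sin θ| * |p.2| := by rw [abs_mul, abs_mul]
      _ ≤ 1 * ‖p‖ + 1 * ‖p‖ := by
        gcongr
        · exact Real.abs_cos_le_one θ
        · exact Real.abs_sin_le_one θ
      _ = 2 * ‖p‖ := by ring
  have h2 : Real.sqrt 2 ≤ 2 := by
    rw [Real.sqrt_le_left (by norm_num)]; norm_num
  calc act θ p ≤ 2 * (2 * ‖p‖) := by
        unfold act
        refine mul_le_mul h2 (max_le ((le_abs_self _).trans h1) (by positivity))
          (le_max_right _ _) (by norm_num)
    _ = 4 * ‖p‖ := by ring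

theorem hasAllMoments_act (θ : ℝ) : HasAllMoments (act θ) := by
  intro q hq
  have := isGaussian_pairLaw
  refine ((IsGaussian.memLp_id pairLaw q hq).norm.const_mul 4).mono'
    (by fun_prop) (Eventually.of_forall fun p => ?_)
  rw [Real.norm_of_nonneg (act_nonneg θ p)]
  exact act_le θ p

/-- The centred square of an activation. -/
noncomputable def centredSq (θ : ℝ) (p : ℝ × ℝ) : ℝ := act θ p ^ 2 - 1

/-- The centred product of the two activations. -/
noncomputable def centredProd (θ : ℝ) (p : ℝ × ℝ) : ℝ := act 0 p * act θ p - crossMoment θ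

@[fun_prop]
theorem continuous_centredSq (θ : ℝ) : Continuous (centredSq θ) := by unfold centredSq; fun_prop

@[fun_prop]
theorem continuous_centredProd (θ : ℝ) : Continuous (centredProd θ) := by
  unfold centredProd; fun_prop

theorem hasAllMoments_centredSq (θ : ℝ) : HasAllMoments (centredSq θ) :=
  ((hasAllMoments_act θ).pow 2).sub (hasAllMoments_const 1)

theorem hasAllMoments_centredProd (θ : ℝ) : HasAllMoments (centredProd θ) :=
  ((hasAllMoments_act 0).mul (hasAllMoments_act θ)).sub (hasAllMoments_const _)

theorem hasMean_act_pow (θ : ℝ) (a b : ℕ) : HasMean pairLaw (fun p => act 0 p ^ a * act θ p ^ b)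
    (∫ p, act 0 p ^ a * act θ p ^ b ∂pairLaw) :=
  (((hasAllMoments_act 0).pow a).mul ((hasAllMoments_act θ).pow b)).hasMean

theorem hasMean_act_sq (θ : ℝ) : HasMean pairLaw (fun p => act θ p ^ 2) 1 :=
  ⟨((hasAllMoments_act θ).pow 2).hasMean.1, integral_act_sq θ⟩

theorem hasMean_act_pow_four (θ : ℝ) : HasMean pairLaw (fun p => act θ p ^ 4) 6 :=
  ⟨((hasAllMoments_act θ).pow 4).hasMean.1, integral_act_pow_four θ⟩

theorem hasMean_centredSq (θ : ℝ) : HasMean pairLaw (centredSq θ) 0 :=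
  ((hasMean_act_sq θ).sub (hasMean_const _ 1)).congr (fun _ => rfl) (by ring)

section AngleRange

variable {θ : ℝ} (h0 : 0 ≤ θ) (hπ : θ ≤ Real.pi)

include h0 hπ

theorem hasMean_act_mul_act : HasMean pairLaw (fun p => act 0 p * act θ p) (crossMoment θ) :=
  ⟨((hasAllMoments_act 0).mul (hasAllMoments_act θ)).hasMean.1, integral_act_mul_act θ h0 hπ⟩

theorem hasMean_centredProd : HasMean pairLaw (centredProd θ) 0 :=
  ((hasMean_act_mul_act h0 hπ).sub (hasMean_const _ (crossMoment θ))).congr (fun _ => rfl) (by ring)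

theorem hasMean_centredSq_mul_centredSq :
    HasMean pairLaw (fun p => centredSq 0 p * centredSq θ p) (sqSqMoment θ - 1) := by
  have h : HasMean pairLaw (fun p => act 0 p ^ 2 * act θ p ^ 2) (sqSqMoment θ) :=
    ⟨(hasMean_act_pow θ 2 2).1, integral_act_sq_mul_act_sq θ h0 hπ⟩
  exact (((h.sub (hasMean_act_sq 0)).sub (hasMean_act_sq θ)).add (hasMean_const _ 1)).congr
    (fun p => by simp only [centredSq]; ring) (by ring)

theorem hasMean_centredSq_zero_mul_centredProd :
    HasMean pairLaw (fun p => centredSq 0 p * centredProd θ p) (cubeMoment θ - crossMoment θ) := by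
  have h : HasMean pairLaw (fun p => act 0 p ^ 3 * act θ p) (cubeMoment θ) :=
    ⟨(((hasAllMoments_act 0).pow 3).mul (hasAllMoments_act θ)).hasMean.1,
      integral_act_cube_mul_act θ h0 hπ⟩
  exact (((h.sub (hasMean_act_mul_act h0 hπ)).sub ((hasMean_act_sq 0).const_mul
    (crossMoment θ))).add (hasMean_const _ (crossMoment θ))).congr
    (fun p => by simp only [centredSq, centredProd]; ring) (by ring)

theorem hasMean_centredSq_mul_centredProd :
    HasMean pairLaw (fun p => centredSq θ p * centredProd θ p) (cubeMoment θ - crossMoment θ) := by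
  have h : HasMean pairLaw (fun p => act 0 p * act θ p ^ 3) (cubeMoment θ) :=
    ⟨((hasAllMoments_act 0).mul ((hasAllMoments_act θ).pow 3)).hasMean.1,
      integral_act_mul_act_cube θ h0 hπ⟩
  exact (((h.sub (hasMean_act_mul_act h0 hπ)).sub ((hasMean_act_sq θ).const_mul
    (crossMoment θ))).add (hasMean_const _ (crossMoment θ))).congr
    (fun p => by simp only [centredSq, centredProd]; ring) (by ring)

theorem hasMean_centredProd_sq :
    HasMean pairLaw (fun p => centredProd θ p * centredProd θ p)
      (sqSqMoment θ - crossMoment θ ^ 2) := by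
  have h : HasMean pairLaw (fun p => act 0 p ^ 2 * act θ p ^ 2) (sqSqMoment θ) :=
    ⟨(hasMean_act_pow θ 2 2).1, integral_act_sq_mul_act_sq θ h0 hπ⟩
  exact ((h.sub ((hasMean_act_mul_act h0 hπ).const_mul (2 * crossMoment θ))).add
    (hasMean_const _ (crossMoment θ ^ 2))).congr
    (fun p => by simp only [centredProd]; ring) (by ring)

end AngleRange

theorem hasMean_centredSq_sq (θ : ℝ) :
    HasMean pairLaw (fun p => centredSq θ p * centredSq θ p) 5 :=
  (((hasMean_act_pow_four θ).sub ((hasMean_act_sq θ).const_mul 2)).add (hasMean_const _ 1)).congr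
    (fun p => by simp only [centredSq]; ring) (by ring)

/-- Fernique's theorem gives exponential moments of quadratic functions of the activations. -/
theorem exists_integrable_exp_abs {f : ℝ × ℝ → ℝ} (hf : Continuous f) {C : ℝ}
    (h : ∀ p, |f p| ≤ C * (1 + ‖p‖ ^ 2)) :
    ∃ c > 0, Integrable (fun p => Real.exp (c * |f p|)) pairLaw := by
  have := isGaussian_pairLaw
  obtain ⟨c, hc, hint⟩ := IsGaussian.exists_integrable_exp_sq pairLaw
  set D := max C 1 with hD
  have hD1 : 1 ≤ D := le_max_right _ _
  refine ⟨c / D, by positivity, (hint.const_mul (Real.exp c)).mono' (by fun_prop)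
    (Eventually.of_forall fun p => ?_)⟩
  rw [Real.norm_of_nonneg (Real.exp_pos _).le, ← Real.exp_add, Real.exp_le_exp]
  calc c / D * |f p| ≤ c / D * (D * (1 + ‖p‖ ^ 2)) := by
        gcongr
        exact (h p).trans (by gcongr; exact le_max_left _ _)
    _ = c + c * ‖p‖ ^ 2 := by field_simp

theorem act_mul_act_le (θ φ : ℝ) (p : ℝ × ℝ) : act θ p * act φ p ≤ 16 * ‖p‖ ^ 2 := by
  calc act θ p * act φ p ≤ (4 * ‖p‖) * (4 * ‖p‖) :=
        mul_le_mul (act_le θ p) (act_le φ p) (act_nonneg φ p) (by positivity)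
    _ = 16 * ‖p‖ ^ 2 := by ring

theorem exists_integrable_exp_centredSq (θ : ℝ) :
    ∃ c > 0, Integrable (fun p => Real.exp (c * |centredSq θ p|)) pairLaw := by
  refine exists_integrable_exp_abs (by fun_prop) (C := 16) fun p => ?_
  have h1 := act_mul_act_le θ θ p
  have h2 := act_nonneg θ p
  rw [centredSq, abs_le]
  constructor <;> nlinarith [sq_nonneg ‖p‖]

theorem exists_integrable_exp_centredProd (θ : ℝ) :
    ∃ c > 0, Integrable (fun p => Real.exp (c * |centredProd θ p|)) pairLaw := by
  refine exists_integrable_exp_abs (by fun_prop) (C := 16 + |crossMoment θ|) fun p => ?_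
  have h1 := act_mul_act_le 0 θ p
  have h2 := mul_nonneg (act_nonneg 0 p) (act_nonneg θ p)
  have h3 := abs_nonneg (crossMoment θ)
  have h4 := le_abs_self (crossMoment θ)
  have h5 := neg_abs_le (crossMoment θ)
  rw [centredProd, abs_le]
  constructor <;> nlinarith [sq_nonneg ‖p‖, mul_nonneg h3 (sq_nonneg ‖p‖)]

/-! ### The fourth moment of `ln sin²` -/

/-- `sin²` of the angle between the two activation vectors of a layer, as a function of the
Gaussian pairs of its neurons; the value is `1` if one of the vectors vanishes. -/
noncomputable def layerSinSq (θ : ℝ) {n : ℕ} (ω : Fin n → ℝ × ℝ) : ℝ :=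
  1 - coordSum (fun p => act 0 p * act θ p) ω ^ 2
    / (coordSum (fun p => act 0 p ^ 2) ω * coordSum (fun p => act θ p ^ 2) ω)

theorem continuous_coordSum {f : ℝ × ℝ → ℝ} (hf : Continuous f) (n : ℕ) :
    Continuous fun ω : Fin n → ℝ × ℝ => coordSum f ω := by
  unfold coordSum; fun_prop

theorem measurable_layerSinSq (θ : ℝ) (n : ℕ) :
    Measurable fun ω : Fin n → ℝ × ℝ => layerSinSq θ ω := by
  have h1 := (continuous_coordSum (f := fun p => act 0 p * act θ p) (by fun_prop) n).measurable
  have h2 := (continuous_coordSum (f := fun p => act 0 p ^ 2) (by fun_prop) n).measurable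
  have h3 := (continuous_coordSum (f := fun p => act θ p ^ 2) (by fun_prop) n).measurable
  exact measurable_const.sub ((h1.pow_const 2).div (h2.mul h3))

/-- Lagrange's identity. -/
theorem sum_sq_minor (θ : ℝ) {n : ℕ} (ω : Fin n → ℝ × ℝ) :
    ∑ i, ∑ j, minor θ (ω i) (ω j) ^ 2 =
      2 * (coordSum (fun p => act 0 p ^ 2) ω * coordSum (fun p => act θ p ^ 2) ω
        - coordSum (fun p => act 0 p * act θ p) ω ^ 2) := by
  have h1 : coordSum (fun p => act 0 p ^ 2) ω * coordSum (fun p => act θ p ^ 2) ω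
      = ∑ i, ∑ j, act 0 (ω i) ^ 2 * act θ (ω j) ^ 2 := Finset.sum_mul_sum _ _ _ _
  have h2 : coordSum (fun p => act 0 p ^ 2) ω * coordSum (fun p => act θ p ^ 2) ω
      = ∑ i, ∑ j, act 0 (ω j) ^ 2 * act θ (ω i) ^ 2 := by rw [h1, Finset.sum_comm]
  have h3 : coordSum (fun p => act 0 p * act θ p) ω ^ 2
      = ∑ i, ∑ j, (act 0 (ω i) * act θ (ω i)) * (act 0 (ω j) * act θ (ω j)) := by
    rw [sq]; exact Finset.sum_mul_sum _ _ _ _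
  rw [mul_sub, two_mul (_ * _)]
  nth_rewrite 1 [h1]
  rw [h2, h3, Finset.mul_sum, ← Finset.sum_add_distrib, ← Finset.sum_sub_distrib]
  refine Finset.sum_congr rfl fun i _ => ?_
  rw [Finset.mul_sum, ← Finset.sum_add_distrib, ← Finset.sum_sub_distrib]
  refine Finset.sum_congr rfl fun j _ => ?_
  rw [minor]
  ring

theorem coordSum_nonneg {f : ℝ × ℝ → ℝ} (hf : ∀ p, 0 ≤ f p) {n : ℕ} (ω : Fin n → ℝ × ℝ) :
    0 ≤ coordSum f ω := Finset.sum_nonneg fun i _ => hf (ω i)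

theorem layerSinSq_mem_Icc (θ : ℝ) {n : ℕ} (ω : Fin n → ℝ × ℝ) :
    layerSinSq θ ω ∈ Set.Icc 0 1 := by
  have hl := sum_sq_minor θ ω
  have h0 : 0 ≤ ∑ i, ∑ j, minor θ (ω i) (ω j) ^ 2 := by positivity
  have ha : 0 ≤ coordSum (fun p => act 0 p ^ 2) ω := coordSum_nonneg (fun p => sq_nonneg _) ω
  have hb : 0 ≤ coordSum (fun p => act θ p ^ 2) ω := coordSum_nonneg (fun p => sq_nonneg _) ω
  rw [layerSinSq]
  constructor
  · rw [sub_nonneg]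
    exact div_le_one_of_le₀ (by linarith) (mul_nonneg ha hb)
  · rw [sub_le_self_iff]
    positivity

/-- `(log t)⁴` grows more slowly than `t^(-1/8)` as `t → 0`. -/
theorem log_pow_four_le {t : ℝ} (h0 : 0 < t) (h1 : t ≤ 1) :
    Real.log t ^ 4 ≤ 32 ^ 4 * (t⁻¹) ^ (1 / 8 : ℝ) := by
  have h := Real.log_le_rpow_div (x := t⁻¹) (by positivity) (ε := 1 / 32) (by norm_num)
  rw [Real.log_inv] at h
  have hl : Real.log t ≤ 0 := Real.log_nonpos h0.le h1
  calc Real.log t ^ 4 = (-Real.log t) ^ 4 := by ring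
    _ ≤ ((t⁻¹) ^ (1 / 32 : ℝ) / (1 / 32)) ^ 4 := pow_le_pow_left₀ (by linarith) h 4
    _ = 32 ^ 4 * ((t⁻¹) ^ (1 / 32 : ℝ)) ^ 4 := by ring
    _ = 32 ^ 4 * (t⁻¹) ^ (1 / 8 : ℝ) := by
      congr 1
      rw [← Real.rpow_natCast, ← Real.rpow_mul (by positivity)]
      norm_num

/-- Only nonvanishing minors matter: if they all vanish, then `layerSinSq` is `0` or `1`, where
`Real.log` is `0`. -/
theorem log_layerSinSq_pow_four_le (θ : ℝ) {n : ℕ} (ω : Fin n → ℝ × ℝ) :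
    Real.log (layerSinSq θ ω) ^ 4 ≤ 32 ^ 4 *
      (1 + 2 * (coordSum (fun p => act 0 p ^ 2) ω * coordSum (fun p => act θ p ^ 2) ω)
        + ∑ i, ∑ j, |minor θ (ω i) (ω j)| ^ (-(1 / 2) : ℝ)) := by
  have hl := sum_sq_minor θ ω
  have ha : 0 ≤ coordSum (fun p => act 0 p ^ 2) ω := coordSum_nonneg (fun p => sq_nonneg _) ω
  have hb : 0 ≤ coordSum (fun p => act θ p ^ 2) ω := coordSum_nonneg (fun p => sq_nonneg _) ω
  have hmem := layerSinSq_mem_Icc θ ω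
  set P := coordSum (fun p => act 0 p ^ 2) ω * coordSum (fun p => act θ p ^ 2) ω with hP
  have hP0 : 0 ≤ P := mul_nonneg ha hb
  have hsum : ∀ i j, |minor θ (ω i) (ω j)| ^ (-(1 / 2) : ℝ) ≤
      ∑ i, ∑ j, |minor θ (ω i) (ω j)| ^ (-(1 / 2) : ℝ) := fun i j =>
    (Finset.single_le_sum (f := fun j => |minor θ (ω i) (ω j)| ^ (-(1 / 2) : ℝ))
      (fun _ _ => by positivity) (Finset.mem_univ j)).trans
    (Finset.single_le_sum (f := fun i => ∑ j, |minor θ (ω i) (ω j)| ^ (-(1 / 2) : ℝ))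
      (fun _ _ => by positivity) (Finset.mem_univ i))
  have hnn : 0 ≤ ∑ i, ∑ j, |minor θ (ω i) (ω j)| ^ (-(1 / 2) : ℝ) := by positivity
  by_cases hz : ∀ i j, minor θ (ω i) (ω j) = 0
  · have hlog : Real.log (layerSinSq θ ω) = 0 := by
      simp only [hz, ne_eq, OfNat.ofNat_ne_zero, not_false_eq_true, zero_pow,
        Finset.sum_const_zero] at hl
      have hc : coordSum (fun p => act 0 p * act θ p) ω ^ 2 = P := by linarith
      rw [layerSinSq, ← hP, hc]
      rcases eq_or_ne P 0 with h | h
      · simp [h]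
      · simp [div_self h]
    rw [hlog, zero_pow four_ne_zero]
    positivity
  · push Not at hz
    -- a single nonzero minor `d` gives `layerSinSq⁻¹ ≤ 2 P / d²`
    obtain ⟨i, j, hij⟩ := hz
    have hd : 0 < minor θ (ω i) (ω j) ^ 2 := by positivity
    have hle : minor θ (ω i) (ω j) ^ 2 ≤ ∑ i, ∑ j, minor θ (ω i) (ω j) ^ 2 :=
      (Finset.single_le_sum (f := fun j => minor θ (ω i) (ω j) ^ 2)
        (fun _ _ => by positivity) (Finset.mem_univ j)).trans
      (Finset.single_le_sum (f := fun i => ∑ j, minor θ (ω i) (ω j) ^ 2)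
        (fun _ _ => by positivity) (Finset.mem_univ i))
    set d := minor θ (ω i) (ω j) with hdef
    have hPpos : 0 < P := by
      have := sq_nonneg (coordSum (fun p => act 0 p * act θ p) ω)
      linarith
    have ht : layerSinSq θ ω = (P - coordSum (fun p => act 0 p * act θ p) ω ^ 2) / P := by
      rw [layerSinSq, ← hP]; field_simp
    have htpos : 0 < layerSinSq θ ω := by
      rw [ht]; exact div_pos (by linarith) hPpos
    have hinv : (layerSinSq θ ω)⁻¹ ≤ 2 * P * (d ^ 2)⁻¹ := by
      rw [ht, inv_div, div_le_iff₀ (by linarith)]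
      have : 1 ≤ (d ^ 2)⁻¹ * (2 * (P - coordSum (fun p => act 0 p * act θ p) ω ^ 2)) := by
        rw [inv_mul_eq_div, one_le_div hd]; linarith
      nlinarith
    have hy : ((d ^ 2)⁻¹) ^ (1 / 8 : ℝ) = |d| ^ (-(1 / 4) : ℝ) := by
      rw [← sq_abs, ← Real.rpow_natCast, ← Real.rpow_neg (abs_nonneg d),
        ← Real.rpow_mul (abs_nonneg d)]
      norm_num
    have hx : (2 * P) ^ (1 / 8 : ℝ) * (2 * P) ^ (1 / 8 : ℝ) ≤ 1 + 2 * P := by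
      rw [← Real.rpow_add (by positivity)]
      calc (2 * P) ^ (1 / 8 + 1 / 8 : ℝ) ≤ (1 + 2 * P) ^ (1 / 8 + 1 / 8 : ℝ) :=
            Real.rpow_le_rpow (by positivity) (by linarith) (by norm_num)
        _ ≤ (1 + 2 * P) ^ (1 : ℝ) :=
            Real.rpow_le_rpow_of_exponent_le (by linarith) (by norm_num)
        _ = 1 + 2 * P := Real.rpow_one _
    have hyy : |d| ^ (-(1 / 4) : ℝ) * |d| ^ (-(1 / 4) : ℝ) = |d| ^ (-(1 / 2) : ℝ) := by
      rw [← Real.rpow_add (abs_pos.2 hij)]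
      norm_num
    refine (log_pow_four_le htpos hmem.2).trans ?_
    gcongr
    calc ((layerSinSq θ ω)⁻¹) ^ (1 / 8 : ℝ) ≤ (2 * P * (d ^ 2)⁻¹) ^ (1 / 8 : ℝ) :=
          Real.rpow_le_rpow (by positivity) hinv (by norm_num)
      _ = (2 * P) ^ (1 / 8 : ℝ) * |d| ^ (-(1 / 4) : ℝ) := by
          rw [Real.mul_rpow (by positivity) (by positivity), hy]
      _ ≤ (1 + 2 * P) + |d| ^ (-(1 / 2) : ℝ) := by
          have hx0 : 0 ≤ (2 * P) ^ (1 / 8 : ℝ) := by positivity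
          have hy0 : 0 ≤ |d| ^ (-(1 / 4) : ℝ) := by positivity
          nlinarith [sq_nonneg ((2 * P) ^ (1 / 8 : ℝ) - |d| ^ (-(1 / 4) : ℝ))]
      _ ≤ _ := by gcongr; exact hsum i j

theorem coordSum_act_sq (θ : ℝ) {n : ℕ} (ω : Fin n → ℝ × ℝ) :
    coordSum (fun p => act θ p ^ 2) ω = n + coordSum (centredSq θ) ω := by
  simp [coordSum, centredSq]

theorem coordSum_act_mul_act (θ : ℝ) {n : ℕ} (ω : Fin n → ℝ × ℝ) :
    coordSum (fun p => act 0 p * act θ p) ω = n * crossMoment θ + coordSum (centredProd θ) ω := by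
  simp [coordSum, centredProd]

/-- If the angle is `π`, no neuron is active for both inputs. -/
theorem layerSinSq_pi {n : ℕ} (ω : Fin n → ℝ × ℝ) : layerSinSq Real.pi ω = 1 := by
  have h : ∀ p : ℝ × ℝ, act 0 p * act Real.pi p = 0 := by
    intro p
    simp only [act, proj, Real.cos_zero, Real.sin_zero, Real.cos_pi, Real.sin_pi]
    rcases le_total p.1 0 with h | h
    · rw [max_eq_right (a := 1 * p.1 + 0 * p.2) (by linarith)]; ring
    · rw [max_eq_right (a := -1 * p.1 + 0 * p.2) (by linarith)]; ring
  simp [layerSinSq, h, coordSum]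

theorem exists_log_layerSinSq_pow_four_le {θ : ℝ} (hθ : θ ∈ Set.Ioc 0 Real.pi) :
    ∃ C : ℝ, 0 ≤ C ∧ ∀ n : ℕ, 1 ≤ n →
      Integrable (fun ω => Real.log (layerSinSq θ ω) ^ 4) (layerLaw n) ∧
      ∫ ω, Real.log (layerSinSq θ ω) ^ 4 ∂(layerLaw n) ≤ C * n ^ 2 := by
  rcases eq_or_lt_of_le hθ.2 with rfl | hlt
  -- `exists_hasMean_minor` needs `sin θ ≠ 0`; for `θ = π` the logarithm vanishes identically
  · exact ⟨0, le_rfl, fun n _ => by simp [layerSinSq_pi]⟩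
  have hsin : Real.sin θ ≠ 0 := (Real.sin_pos_of_pos_of_lt_pi hθ.1 hlt).ne'
  obtain ⟨v, hv0, hv⟩ := exists_hasMean_minor hsin
  have hw0 : 0 ≤ sqSqMoment θ := by
    rw [← integral_act_sq_mul_act_sq θ hθ.1.le hθ.2]
    exact integral_nonneg fun p => by positivity
  refine ⟨32 ^ 4 * (3 + 2 * sqSqMoment θ + v), by positivity, fun n hn => ?_⟩
  have hn1 : (1 : ℝ) ≤ n := by exact_mod_cast hn
  have hP : HasMean (layerLaw n) (fun ω => coordSum (fun p => act 0 p ^ 2) ω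
      * coordSum (fun p => act θ p ^ 2) ω) (n * (sqSqMoment θ - 1) + n ^ 2) := by
    have h1 := (hasMean_coordSum_mul (hasMean_centredSq 0) (hasMean_centredSq θ)
      (hasMean_centredSq_mul_centredSq hθ.1.le hθ.2) n)
    have h2 := (hasMean_coordSum (hasMean_centredSq 0) n).const_mul n
    have h3 := (hasMean_coordSum (hasMean_centredSq θ) n).const_mul n
    exact (((h1.add h2).add h3).add (hasMean_const _ ((n : ℝ) ^ 2))).congr
      (fun ω => by rw [coordSum_act_sq, coordSum_act_sq]; ring) (by ring)
  have hij : ∀ i j : Fin n, Integrable (fun ω => |minor θ (ω i) (ω j)| ^ (-(1 / 2) : ℝ))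
      (layerLaw n) ∧ ∫ ω, |minor θ (ω i) (ω j)| ^ (-(1 / 2) : ℝ) ∂(layerLaw n) ≤ v := by
    intro i j
    by_cases h : i = j
    · subst h
      have h0 : ∀ ω : Fin n → ℝ × ℝ, |minor θ (ω i) (ω i)| ^ (-(1 / 2) : ℝ) = 0 := fun ω => by
        rw [minor, sub_self, abs_zero, Real.zero_rpow (by norm_num)]
      simp only [h0]
      exact ⟨integrable_const _, by simpa using hv0⟩
    · exact ⟨(hv n i j h).1, (hv n i j h).2.le⟩
  have hS : Integrable (fun ω => ∑ i, ∑ j, |minor θ (ω i) (ω j)| ^ (-(1 / 2) : ℝ)) (layerLaw n) :=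
    integrable_finsetSum _ fun i _ => integrable_finsetSum _ fun j _ => (hij i j).1
  have hSle : ∫ ω, ∑ i, ∑ j, |minor θ (ω i) (ω j)| ^ (-(1 / 2) : ℝ) ∂(layerLaw n) ≤ n ^ 2 * v := by
    rw [integral_finsetSum _ fun i _ => integrable_finsetSum _ fun j _ => (hij i j).1]
    calc _ ≤ ∑ _i : Fin n, ∑ _j : Fin n, v := Finset.sum_le_sum fun i _ => by
          rw [integral_finsetSum _ fun j _ => (hij i j).1]
          exact Finset.sum_le_sum fun j _ => (hij i j).2
      _ = n ^ 2 * v := by simp; ring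
  have hint := ((((hasMean_const (layerLaw n) 1).add (hP.const_mul 2)).1).add hS).const_mul (32 ^ 4)
  have hmeas : Measurable fun ω : Fin n → ℝ × ℝ => Real.log (layerSinSq θ ω) ^ 4 :=
    (Real.measurable_log.comp (measurable_layerSinSq θ n)).pow_const 4
  refine ⟨hint.mono' hmeas.aestronglyMeasurable (Eventually.of_forall fun ω => ?_), ?_⟩
  · rw [Real.norm_of_nonneg (by positivity)]
    exact log_layerSinSq_pow_four_le θ ω
  · refine (integral_mono_of_nonneg (Eventually.of_forall fun ω => by positivity) hint
      (Eventually.of_forall fun ω => log_layerSinSq_pow_four_le θ ω)).trans ?_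
    simp only [Pi.add_apply]
    rw [integral_const_mul, integral_add ((hasMean_const (layerLaw n) 1).add (hP.const_mul 2)).1 hS,
      ((hasMean_const (layerLaw n) 1).add (hP.const_mul 2)).2, mul_assoc]
    gcongr
    have e1 : (n : ℝ) * sqSqMoment θ ≤ n ^ 2 * sqSqMoment θ :=
      mul_le_mul_of_nonneg_right (by nlinarith) hw0
    have e2 : (1 : ℝ) ≤ n ^ 2 := by nlinarith
    linarith

/-! ### Third-order expansion of `ln (1 - Z² / (X Y))` -/

/-- The linear form in the deviations of `X Y - Z²` from its value `D` at `(1, 1, K)`, relative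
to `D`. -/
noncomputable def relLin (K D a b c : ℝ) : ℝ := (a + b - 2 * K * c) / D

/-- The quadratic form in the deviations of `X Y - Z²` from `D`, relative to `D`. -/
noncomputable def relQuad (D a b c : ℝ) : ℝ := (a * b - c ^ 2) / D

/-- The linear part of `ln (1 - Z² / (X Y))` at `(X, Y, Z) = (1 + a, 1 + b, K + c)`. -/
noncomputable def logLin (K D a b c : ℝ) : ℝ := relLin K D a b c - a - b

/-- The quadratic part of `ln (1 - Z² / (X Y))`. -/
noncomputable def logQuad (K D a b c : ℝ) : ℝ :=
  relQuad D a b c - relLin K D a b c ^ 2 / 2 + a ^ 2 / 2 + b ^ 2 / 2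

/-- The cubic part of `ln (1 - Z² / (X Y))`. -/
noncomputable def logCub (K D a b c : ℝ) : ℝ :=
  -(relLin K D a b c * relQuad D a b c) + relLin K D a b c ^ 3 / 3 - a ^ 3 / 3 - b ^ 3 / 3

theorem abs_log_one_add_sub_le {x : ℝ} (hx : |x| ≤ 1 / 2) :
    |Real.log (1 + x) - (x - x ^ 2 / 2 + x ^ 3 / 3)| ≤ 2 * |x| ^ 4 := by
  have := Real.abs_log_sub_add_sum_range_le (x := -x) (by rw [abs_neg]; linarith) 3
  simp only [Finset.sum_range_succ, Finset.sum_range_zero, abs_neg, sub_neg_eq_add] at this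
  refine (le_of_eq ?_).trans (this.trans ?_)
  · congr 1; norm_num; ring
  · rw [div_le_iff₀ (by linarith)]
    have h4 : 0 ≤ |x| ^ 4 := by positivity
    change |x| ^ 4 ≤ _
    nlinarith

section Deviations

variable {K D a b c M : ℝ}

theorem abs_relLin_le (hD : 0 < D) (hK : |K| ≤ 1) (ha : |a| ≤ M * D) (hb : |b| ≤ M * D)
    (hc : |c| ≤ M * D) : |relLin K D a b c| ≤ 4 * M := by
  rw [relLin, abs_div, abs_of_pos hD, div_le_iff₀ hD]
  have h1 : |2 * K * c| ≤ 2 * (M * D) := by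
    rw [abs_mul, abs_mul, abs_two]
    have := mul_le_mul hK hc (abs_nonneg c) zero_le_one
    nlinarith
  calc |a + b - 2 * K * c| ≤ |a + b| + |2 * K * c| := abs_sub _ _
    _ ≤ |a| + |b| + |2 * K * c| := by gcongr; exact abs_add_le _ _
    _ ≤ 4 * M * D := by linarith

theorem abs_relQuad_le (hD : 0 < D) (hD1 : D ≤ 1) (ha : |a| ≤ M * D) (hb : |b| ≤ M * D)
    (hc : |c| ≤ M * D) : |relQuad D a b c| ≤ 2 * M ^ 2 := by
  rw [relQuad, abs_div, abs_of_pos hD, div_le_iff₀ hD]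
  have hM : 0 ≤ M * D := (abs_nonneg a).trans ha
  calc |a * b - c ^ 2| ≤ |a * b| + |c ^ 2| := abs_sub _ _
    _ = |a| * |b| + |c| ^ 2 := by rw [abs_mul, abs_pow]
    _ ≤ (M * D) * (M * D) + (M * D) ^ 2 := by gcongr
    _ = 2 * M ^ 2 * D * D := by ring
    _ ≤ 2 * M ^ 2 * D * 1 := by gcongr
    _ = 2 * M ^ 2 * D := mul_one _

theorem abs_le_of_le_mul (hD : 0 < D) (hD1 : D ≤ 1) {t : ℝ} (ht : |t| ≤ M * D) : |t| ≤ M := by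
  have hM : 0 ≤ M := nonneg_of_mul_nonneg_left ((abs_nonneg t).trans ht) hD
  nlinarith

theorem abs_logLin_le (hD : 0 < D) (hD1 : D ≤ 1) (hK : |K| ≤ 1) (ha : |a| ≤ M * D)
    (hb : |b| ≤ M * D) (hc : |c| ≤ M * D) : |logLin K D a b c| ≤ 6 * M := by
  have h1 := abs_le.1 (abs_relLin_le hD hK ha hb hc)
  have h2 := abs_le.1 (abs_le_of_le_mul hD hD1 ha)
  have h3 := abs_le.1 (abs_le_of_le_mul hD hD1 hb)
  rw [logLin, abs_le]
  constructor <;> linarith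

theorem abs_logQuad_le (hD : 0 < D) (hD1 : D ≤ 1) (hK : |K| ≤ 1) (ha : |a| ≤ M * D)
    (hb : |b| ≤ M * D) (hc : |c| ≤ M * D) : |logQuad K D a b c| ≤ 11 * M ^ 2 := by
  have h1 := sq_le_sq' (abs_le.1 (abs_relLin_le hD hK ha hb hc)).1
    (abs_le.1 (abs_relLin_le hD hK ha hb hc)).2
  have h2 := sq_le_sq' (abs_le.1 (abs_le_of_le_mul hD hD1 ha)).1
    (abs_le.1 (abs_le_of_le_mul hD hD1 ha)).2
  have h3 := sq_le_sq' (abs_le.1 (abs_le_of_le_mul hD hD1 hb)).1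
    (abs_le.1 (abs_le_of_le_mul hD hD1 hb)).2
  have h4 := abs_le.1 (abs_relQuad_le hD hD1 ha hb hc)
  rw [logQuad, abs_le]
  constructor <;> nlinarith [sq_nonneg (relLin K D a b c), sq_nonneg a, sq_nonneg b]

theorem abs_logCub_le (hD : 0 < D) (hD1 : D ≤ 1) (hK : |K| ≤ 1) (ha : |a| ≤ M * D)
    (hb : |b| ≤ M * D) (hc : |c| ≤ M * D) : |logCub K D a b c| ≤ 31 * M ^ 3 := by
  have hl := abs_relLin_le hD hK ha hb hc
  have hw := abs_relQuad_le hD hD1 ha hb hc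
  have h2 : |a ^ 3| ≤ M ^ 3 := by
    rw [abs_pow]; exact pow_le_pow_left₀ (abs_nonneg _) (abs_le_of_le_mul hD hD1 ha) 3
  have h3 : |b ^ 3| ≤ M ^ 3 := by
    rw [abs_pow]; exact pow_le_pow_left₀ (abs_nonneg _) (abs_le_of_le_mul hD hD1 hb) 3
  have h4 : |relLin K D a b c ^ 3| ≤ (4 * M) ^ 3 := by
    rw [abs_pow]; exact pow_le_pow_left₀ (abs_nonneg _) hl 3
  have h5 : |relLin K D a b c * relQuad D a b c| ≤ 4 * M * (2 * M ^ 2) := by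
    rw [abs_mul]
    exact mul_le_mul hl hw (abs_nonneg _) ((abs_nonneg _).trans hl)
  have hM3 : 0 ≤ M ^ 3 := (abs_nonneg _).trans h2
  rw [abs_le] at h2 h3 h4 h5
  rw [logCub, abs_le]
  constructor <;> nlinarith

/-- The expansion holds when the deviations are small compared with `D`. -/
theorem log_expansion_near (hD : 0 < D) (hDK : D = 1 - K ^ 2) (ha : |a| ≤ M * D)
    (hb : |b| ≤ M * D) (hc : |c| ≤ M * D) (hM : M ≤ 1 / 12) :
    0 < 1 + a ∧ 0 < 1 + b ∧ 0 < 1 - (K + c) ^ 2 / ((1 + a) * (1 + b)) ∧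
    |Real.log (1 - (K + c) ^ 2 / ((1 + a) * (1 + b)))
      - (Real.log D + logLin K D a b c + logQuad K D a b c + logCub K D a b c)| ≤ 1400 * M ^ 4 := by
  have hD1 : D ≤ 1 := by nlinarith [sq_nonneg K]
  have hK : |K| ≤ 1 := by rw [← sq_le_one_iff_abs_le_one]; linarith
  have hM0 : 0 ≤ M := nonneg_of_mul_nonneg_left ((abs_nonneg a).trans ha) hD
  have ha' := abs_le_of_le_mul hD hD1 ha
  have hb' := abs_le_of_le_mul hD hD1 hb
  have hl := abs_relLin_le hD hK ha hb hc
  have hw := abs_relQuad_le hD hD1 ha hb hc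
  set l := relLin K D a b c with hldef
  set w := relQuad D a b c with hwdef
  have hw5 : |w| ≤ M := hw.trans (by nlinarith)
  have hu : |l + w| ≤ 5 * M := (abs_add_le _ _).trans (by linarith)
  have ha0 : 0 < 1 + a := by have := (abs_le.1 ha').1; linarith
  have hb0 : 0 < 1 + b := by have := (abs_le.1 hb').1; linarith
  have hu0 : 0 < 1 + (l + w) := by have := (abs_le.1 hu).1; linarith
  -- the logarithm splits into those of `1 + l + w`, `1 + a` and `1 + b`
  have hfac : 1 - (K + c) ^ 2 / ((1 + a) * (1 + b)) = D * (1 + (l + w)) / ((1 + a) * (1 + b)) := by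
    have hne := hD.ne'
    rw [hldef, hwdef, relLin, relQuad]
    field_simp
    rw [hDK]
    ring
  refine ⟨ha0, hb0, by rw [hfac]; positivity, ?_⟩
  rw [hfac, Real.log_div (by positivity) (by positivity), Real.log_mul hD.ne' hu0.ne',
    Real.log_mul ha0.ne' hb0.ne']
  have e1 := abs_log_one_add_sub_le (x := l + w) (hu.trans (by linarith))
  have e2 := abs_log_one_add_sub_le (x := a) (ha'.trans (by linarith))
  have e3 := abs_log_one_add_sub_le (x := b) (hb'.trans (by linarith))
  have p1 : |l + w| ^ 4 ≤ (5 * M) ^ 4 := pow_le_pow_left₀ (abs_nonneg _) hu 4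
  have p2 : |a| ^ 4 ≤ M ^ 4 := pow_le_pow_left₀ (abs_nonneg _) ha' 4
  have p3 : |b| ^ 4 ≤ M ^ 4 := pow_le_pow_left₀ (abs_nonneg _) hb' 4
  have hM4 : 0 ≤ M ^ 4 := by positivity
  -- the terms of order at least four in the expansion at `l + w`
  have r1 : |w ^ 2| ≤ 4 * M ^ 4 := by
    rw [abs_pow]
    calc |w| ^ 2 ≤ (2 * M ^ 2) ^ 2 := pow_le_pow_left₀ (abs_nonneg _) hw 2
      _ = 4 * M ^ 4 := by ring
  have r2 : |l ^ 2 * w| ≤ 32 * M ^ 4 := by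
    rw [abs_mul, abs_pow]
    calc |l| ^ 2 * |w| ≤ (4 * M) ^ 2 * (2 * M ^ 2) := by gcongr
      _ = 32 * M ^ 4 := by ring
  have r3 : |l * w ^ 2| ≤ 4 * M ^ 4 := by
    rw [abs_mul]
    calc |l| * |w ^ 2| ≤ 1 * (4 * M ^ 4) := by
          refine mul_le_mul (hl.trans (by linarith)) r1 (abs_nonneg _) zero_le_one
      _ = 4 * M ^ 4 := one_mul _
  have r4 : |w ^ 3| ≤ 4 * M ^ 4 := by
    rw [pow_succ, abs_mul]
    calc |w ^ 2| * |w| ≤ (4 * M ^ 4) * 1 := by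
          refine mul_le_mul r1 (hw5.trans (by linarith)) (abs_nonneg _) (by positivity)
      _ = 4 * M ^ 4 := mul_one _
  rw [abs_le] at e1 e2 e3 r1 r2 r3 r4
  rw [abs_le, logLin, logQuad, logCub, ← hldef, ← hwdef]
  constructor <;> nlinarith

end Deviations

/-- The size of the deviations relative to `D`. -/
noncomputable def relDev (D a b c : ℝ) : ℝ := max |a| (max |b| |c|) / D

/-- `ln (1 - Z² / (X Y))` where the deviations are small compared with `D`, and `0` elsewhere. -/
noncomputable def truncLog (K D a b c : ℝ) : ℝ :=
  if relDev D a b c ≤ 1 / 12 then Real.log (1 - (K + c) ^ 2 / ((1 + a) * (1 + b))) else 0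

theorem abs_le_relDev_mul {D a b c : ℝ} (hD : 0 < D) :
    |a| ≤ relDev D a b c * D ∧ |b| ≤ relDev D a b c * D ∧ |c| ≤ relDev D a b c * D := by
  rw [relDev, div_mul_cancel₀ _ hD.ne']
  exact ⟨le_max_left _ _, (le_max_left _ _).trans (le_max_right _ _),
    (le_max_right _ _).trans (le_max_right _ _)⟩

/-- After truncation the error of the expansion is of fourth order everywhere: far from the centre
every polynomial of lower degree is dominated by the fourth power of the deviation. -/
theorem exists_truncLog_expansion {K D : ℝ} (hD : 0 < D) (hDK : D = 1 - K ^ 2) :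
    ∃ C, 0 ≤ C ∧ ∀ a b c : ℝ,
      |truncLog K D a b c - (Real.log D + logLin K D a b c + logQuad K D a b c
        + logCub K D a b c)| ≤ C * relDev D a b c ^ 4 ∧
      |(if relDev D a b c ≤ 1 / 12 then (truncLog K D a b c - Real.log D) ^ 2 else 0)
        - (logLin K D a b c ^ 2 + 2 * (logLin K D a b c * logQuad K D a b c))|
          ≤ C * relDev D a b c ^ 4 := by
  have hD1 : D ≤ 1 := by nlinarith [sq_nonneg K]
  have hK : |K| ≤ 1 := by rw [← sq_le_one_iff_abs_le_one]; linarith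
  refine ⟨|Real.log D| * 12 ^ 4 + 50000, by positivity, fun a b c => ?_⟩
  obtain ⟨ha, hb, hc⟩ := abs_le_relDev_mul (a := a) (b := b) (c := c) hD
  set M := relDev D a b c with hMdef
  have hM0 : 0 ≤ M := nonneg_of_mul_nonneg_left ((abs_nonneg a).trans ha) hD
  have hM4 : 0 ≤ M ^ 4 := by positivity
  have h1 := abs_logLin_le hD hD1 hK ha hb hc
  have h2 := abs_logQuad_le hD hD1 hK ha hb hc
  have h3 := abs_logCub_le hD hD1 hK ha hb hc
  set x := logLin K D a b c
  set y := logQuad K D a b c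
  set z := logCub K D a b c
  have hlog0 : 0 ≤ |Real.log D| * 12 ^ 4 * M ^ 4 := by positivity
  by_cases hM : M ≤ 1 / 12
  · have ht : truncLog K D a b c = Real.log (1 - (K + c) ^ 2 / ((1 + a) * (1 + b))) := by
      rw [truncLog, ← hMdef, if_pos hM]
    have h4 := (log_expansion_near hD hDK ha hb hc hM).2.2.2
    rw [if_pos hM, ht]
    set f := Real.log (1 - (K + c) ^ 2 / ((1 + a) * (1 + b)))
    refine ⟨h4.trans (by nlinarith), ?_⟩
    -- `r` is of third order, so only `x ^ 2 + 2 * x * y` has order below four in the square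
    set r := f - Real.log D - x - y with hr
    have hM43 : M ^ 4 ≤ M ^ 3 / 12 := by
      have : 0 ≤ M ^ 3 := by positivity
      nlinarith
    have hr3 : |r| ≤ 148 * M ^ 3 := by
      have e : r = (f - (Real.log D + x + y + z)) + z := by rw [hr]; ring
      rw [e]
      refine (abs_add_le _ _).trans ?_
      have : 0 ≤ M ^ 3 := by positivity
      linarith
    have e : (f - Real.log D) ^ 2 - (x ^ 2 + 2 * (x * y))
        = y ^ 2 + 2 * (x * r) + 2 * (y * r) + r ^ 2 := by rw [hr]; ring
    have b1 : |y ^ 2| ≤ 121 * M ^ 4 := by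
      rw [abs_pow]
      calc |y| ^ 2 ≤ (11 * M ^ 2) ^ 2 := pow_le_pow_left₀ (abs_nonneg _) h2 2
        _ = 121 * M ^ 4 := by ring
    have b2 : |x * r| ≤ 888 * M ^ 4 := by
      rw [abs_mul]
      calc |x| * |r| ≤ (6 * M) * (148 * M ^ 3) := by gcongr
        _ = 888 * M ^ 4 := by ring
    have b3 : |y * r| ≤ 1628 * M ^ 4 := by
      rw [abs_mul]
      calc |y| * |r| ≤ (11 * M ^ 2) * (148 * M ^ 3) := by gcongr
        _ = 1628 * M ^ 4 * M := by ring
        _ ≤ 1628 * M ^ 4 * 1 := by gcongr; linarith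
        _ = 1628 * M ^ 4 := mul_one _
    have b4 : |r ^ 2| ≤ 21904 * M ^ 4 := by
      rw [abs_pow]
      calc |r| ^ 2 ≤ (148 * M ^ 3) ^ 2 := pow_le_pow_left₀ (abs_nonneg _) hr3 2
        _ = 21904 * M ^ 4 * M ^ 2 := by ring
        _ ≤ 21904 * M ^ 4 * 1 := by gcongr; nlinarith
        _ = 21904 * M ^ 4 := mul_one _
    rw [e]
    rw [abs_le] at b1 b2 b3 b4 ⊢
    constructor <;> linarith
  · have ht : truncLog K D a b c = 0 := by rw [truncLog, ← hMdef, if_neg hM]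
    rw [if_neg hM, ht]
    push Not at hM
    have m1 : 1 ≤ 12 * M := by linarith
    have q3 : M ^ 3 ≤ 12 * M ^ 4 := by
      have : 0 ≤ M ^ 3 := by positivity
      nlinarith
    have q2 : M ^ 2 ≤ 12 ^ 2 * M ^ 4 := by
      have : 0 ≤ M ^ 2 := by positivity
      nlinarith
    have q1 : M ≤ 12 ^ 3 * M ^ 4 := by nlinarith
    have q0 : 1 ≤ 12 ^ 4 * M ^ 4 := by nlinarith
    have hlog : |Real.log D| ≤ |Real.log D| * 12 ^ 4 * M ^ 4 := by
      have := mul_le_mul_of_nonneg_left q0 (abs_nonneg (Real.log D))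
      linarith
    constructor
    · rw [zero_sub, abs_neg]
      refine (abs_add_le _ _).trans ?_
      have e1 := abs_add_le (Real.log D + x) y
      have e2 := abs_add_le (Real.log D) x
      nlinarith
    · rw [zero_sub, abs_neg]
      have b1 : |x ^ 2| ≤ 36 * M ^ 2 := by
        rw [abs_pow]
        calc |x| ^ 2 ≤ (6 * M) ^ 2 := pow_le_pow_left₀ (abs_nonneg _) h1 2
          _ = 36 * M ^ 2 := by ring
      have b2 : |x * y| ≤ 66 * M ^ 3 := by
        rw [abs_mul]
        calc |x| * |y| ≤ (6 * M) * (11 * M ^ 2) := by gcongr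
          _ = 66 * M ^ 3 := by ring
      have b3 : |x ^ 2 + 2 * (x * y)| ≤ 36 * M ^ 2 + 132 * M ^ 3 := by
        rw [abs_le] at b1 b2 ⊢
        constructor <;> linarith
      nlinarith

/-! ### Moments of the averaged deviations -/

theorem crossMoment_mem_Ico {θ : ℝ} (hθ : θ ∈ Set.Ioc 0 Real.pi) : crossMoment θ ∈ Set.Ico 0 1 := by
  have hp := Real.pi_pos
  have hd : ∀ t : ℝ, HasDerivAt (fun t => Real.sin t + (Real.pi - t) * Real.cos t)
      (-((Real.pi - t) * Real.sin t)) t := by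
    intro t
    have h := (Real.hasDerivAt_sin t).add
      (((hasDerivAt_id t).const_sub Real.pi).mul (Real.hasDerivAt_cos t))
    refine h.congr_deriv ?_
    simp only [id]
    ring
  have hanti : StrictAntiOn (fun t => Real.sin t + (Real.pi - t) * Real.cos t)
      (Set.Icc 0 Real.pi) := by
    refine strictAntiOn_of_deriv_neg (convex_Icc _ _) (by fun_prop) fun t ht => ?_
    rw [interior_Icc] at ht
    rw [(hd t).deriv, neg_lt_zero]
    exact mul_pos (by linarith [ht.2]) (Real.sin_pos_of_pos_of_lt_pi ht.1 ht.2)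
  have h1 := hanti (Set.left_mem_Icc.2 hp.le) ⟨hθ.1.le, hθ.2⟩ hθ.1
  have h2 := hanti.antitoneOn ⟨hθ.1.le, hθ.2⟩ (Set.right_mem_Icc.2 hp.le) hθ.2
  simp only [Real.sin_zero, Real.cos_zero, Real.sin_pi, Real.cos_pi] at h1 h2
  rw [crossMoment]
  constructor
  · exact div_nonneg (by linarith) hp.le
  · rw [div_lt_one hp]; linarith

theorem limitSinSq_pos {θ : ℝ} (hθ : θ ∈ Set.Ioc 0 Real.pi) : 0 < limitSinSq θ := by
  have h := crossMoment_mem_Ico hθ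
  rw [limitSinSq]
  nlinarith [h.1, h.2]

/-- The average of `f` over the coordinates. -/
noncomputable def coordAvg (f : ℝ × ℝ → ℝ) {n : ℕ} (ω : Fin n → ℝ × ℝ) : ℝ := coordSum f ω / n

theorem measurable_coordAvg {f : ℝ × ℝ → ℝ} (hf : Continuous f) (n : ℕ) :
    Measurable fun ω : Fin n → ℝ × ℝ => coordAvg f ω :=
  (continuous_coordSum hf n).measurable.div_const _

/-- `f` is centred and has finite moments of all orders. -/
def IsCentred (f : ℝ × ℝ → ℝ) : Prop := HasAllMoments f ∧ HasMean pairLaw f 0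

theorem IsCentred.add {f g : ℝ × ℝ → ℝ} (hf : IsCentred f) (hg : IsCentred g) :
    IsCentred fun p => f p + g p :=
  ⟨hf.1.add hg.1, (hf.2.add hg.2).congr (fun _ => rfl) (by ring)⟩

theorem IsCentred.const_mul {f : ℝ × ℝ → ℝ} (hf : IsCentred f) (c : ℝ) :
    IsCentred fun p => c * f p :=
  ⟨(hasAllMoments_const c).mul hf.1, (hf.2.const_mul c).congr (fun _ => rfl) (by ring)⟩

theorem hasMean_coordAvg {p : ℝ × ℝ → ℝ} (hp : IsCentred p) (n : ℕ) :
    HasMean (layerLaw n) (coordAvg p) 0 :=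
  ((hasMean_coordSum hp.2 n).const_mul (n : ℝ)⁻¹).congr
    (fun ω => by rw [coordAvg]; ring) (by ring)

theorem hasMean_coordAvg_mul {p q : ℝ × ℝ → ℝ} (hp : IsCentred p) (hq : IsCentred q) {v : ℝ}
    (hpq : HasMean pairLaw (fun x => p x * q x) v) {n : ℕ} (hn : 1 ≤ n) :
    HasMean (layerLaw n) (fun ω => coordAvg p ω * coordAvg q ω) (v / n) := by
  have hn0 : (n : ℝ) ≠ 0 := by positivity
  exact ((hasMean_coordSum_mul hp.2 hq.2 hpq n).const_mul ((n : ℝ) ^ 2)⁻¹).congr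
    (fun ω => by rw [coordAvg, coordAvg]; field_simp) (by field_simp)

/-- Expectations that are a constant multiple of `1 / n²`. -/
def HasMeanInvSq (F : (n : ℕ) → (Fin n → ℝ × ℝ) → ℝ) : Prop :=
  ∃ t : ℝ, ∀ n : ℕ, 1 ≤ n → HasMean (layerLaw n) (F n) (t / n ^ 2)

theorem HasMeanInvSq.add {F G : (n : ℕ) → (Fin n → ℝ × ℝ) → ℝ} (hF : HasMeanInvSq F)
    (hG : HasMeanInvSq G) : HasMeanInvSq fun n ω => F n ω + G n ω := by
  obtain ⟨s, hs⟩ := hF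
  obtain ⟨t, ht⟩ := hG
  exact ⟨s + t, fun n hn => ((hs n hn).add (ht n hn)).congr (fun _ => rfl) (by ring)⟩

theorem HasMeanInvSq.const_mul {F : (n : ℕ) → (Fin n → ℝ × ℝ) → ℝ} (hF : HasMeanInvSq F) (c : ℝ) :
    HasMeanInvSq fun n ω => c * F n ω := by
  obtain ⟨s, hs⟩ := hF
  exact ⟨c * s, fun n hn => ((hs n hn).const_mul c).congr (fun _ => rfl) (by ring)⟩

theorem HasMeanInvSq.congr {F G : (n : ℕ) → (Fin n → ℝ × ℝ) → ℝ} (hF : HasMeanInvSq F)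
    (h : ∀ n ω, G n ω = F n ω) : HasMeanInvSq G := by
  obtain ⟨s, hs⟩ := hF
  exact ⟨s, fun n hn => (hs n hn).congr (h n) rfl⟩

theorem hasMeanInvSq_coordAvg_mul_mul {p q r : ℝ × ℝ → ℝ} (hp : IsCentred p) (hq : IsCentred q)
    (hr : IsCentred r) :
    HasMeanInvSq fun _ ω => coordAvg p ω * coordAvg q ω * coordAvg r ω := by
  refine ⟨∫ x, p x * q x * r x ∂pairLaw, fun n hn => ?_⟩
  have hn0 : (n : ℝ) ≠ 0 := by positivity
  exact ((hasMean_coordSum_mul_mul hp.2 hq.2 hr.2 (hp.1.mul hq.1).hasMean (hp.1.mul hr.1).hasMean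
    (hq.1.mul hr.1).hasMean ((hp.1.mul hq.1).mul hr.1).hasMean n).const_mul ((n : ℝ) ^ 3)⁻¹).congr
    (fun ω => by simp only [coordAvg]; field_simp) (by field_simp)

theorem exists_coordAvg_pow_four_le {p : ℝ × ℝ → ℝ} (hp : IsCentred p) :
    ∃ C : ℝ, 0 ≤ C ∧ ∀ n : ℕ, 1 ≤ n → Integrable (fun ω => coordAvg p ω ^ 4) (layerLaw n) ∧
      ∫ ω, coordAvg p ω ^ 4 ∂(layerLaw n) ≤ C / n ^ 2 := by
  set m₂ := ∫ x, p x * p x ∂pairLaw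
  set m₄ := ∫ x, p x ^ 4 ∂pairLaw with hm4
  have h4 : 0 ≤ m₄ := integral_nonneg fun x => by positivity
  refine ⟨m₄ + 3 * m₂ ^ 2, by positivity, fun n hn => ?_⟩
  have hn1 : (1 : ℝ) ≤ n := by exact_mod_cast hn
  have hn0 : (n : ℝ) ≠ 0 := by positivity
  have h := ((hasMean_coordSum_pow_four hp.2 (hp.1.mul hp.1).hasMean
    ((hp.1.mul hp.1).mul hp.1).hasMean (hp.1.pow 4).hasMean n).const_mul ((n : ℝ) ^ 4)⁻¹).congr
    (g := fun ω => coordAvg p ω ^ 4) (fun ω => by rw [coordAvg]; field_simp) rfl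
  refine ⟨h.1, h.2.le.trans ?_⟩
  rw [inv_mul_eq_div, div_le_div_iff₀ (by positivity) (by positivity)]
  have e : (n : ℝ) * m₄ + 3 * n * (n - 1) * m₂ ^ 2 ≤ (m₄ + 3 * m₂ ^ 2) * n ^ 2 := by
    have e1 : (n : ℝ) * m₄ ≤ n ^ 2 * m₄ := mul_le_mul_of_nonneg_right (by nlinarith) h4
    have e2 : (n : ℝ) * (n - 1) * m₂ ^ 2 ≤ n ^ 2 * m₂ ^ 2 :=
      mul_le_mul_of_nonneg_right (by nlinarith) (sq_nonneg _)
    linarith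
  calc _ ≤ (m₄ + 3 * m₂ ^ 2) * n ^ 2 * n ^ 2 := mul_le_mul_of_nonneg_right e (by positivity)
    _ = (m₄ + 3 * m₂ ^ 2) * n ^ 4 := by ring

theorem isCentred_centredSq (θ : ℝ) : IsCentred (centredSq θ) :=
  ⟨hasAllMoments_centredSq θ, hasMean_centredSq θ⟩

theorem isCentred_centredProd {θ : ℝ} (hθ : θ ∈ Set.Ioc 0 Real.pi) : IsCentred (centredProd θ) :=
  ⟨hasAllMoments_centredProd θ, hasMean_centredProd hθ.1.le hθ.2⟩

/-- A form in the three averaged deviations of `A²`, `B²` and `A B`. -/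
noncomputable def atDev (θ : ℝ) (F : ℝ → ℝ → ℝ → ℝ) {n : ℕ} (ω : Fin n → ℝ × ℝ) : ℝ :=
  F (coordAvg (centredSq 0) ω) (coordAvg (centredSq θ) ω) (coordAvg (centredProd θ) ω)

theorem hasMean_quadratic {θ : ℝ} (hθ : θ ∈ Set.Ioc 0 Real.pi) {n : ℕ} (hn : 1 ≤ n)
    (c₁ c₂ c₃ c₄ c₅ c₆ : ℝ) :
    HasMean (layerLaw n) (atDev θ fun a b c => c₁ * (a * a) + c₂ * (b * b) + c₃ * (c * c)
        + c₄ * (a * b) + c₅ * (a * c) + c₆ * (b * c))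
      ((c₁ * 5 + c₂ * 5 + c₃ * (sqSqMoment θ - crossMoment θ ^ 2) + c₄ * (sqSqMoment θ - 1)
        + (c₅ + c₆) * (cubeMoment θ - crossMoment θ)) / n) := by
  have hA := isCentred_centredSq 0
  have hB := isCentred_centredSq θ
  have hC := isCentred_centredProd hθ
  refine (((((((hasMean_coordAvg_mul hA hA (hasMean_centredSq_sq 0) hn).const_mul c₁).add
    ((hasMean_coordAvg_mul hB hB (hasMean_centredSq_sq θ) hn).const_mul c₂)).add
    ((hasMean_coordAvg_mul hC hC (hasMean_centredProd_sq hθ.1.le hθ.2) hn).const_mul c₃)).add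
    ((hasMean_coordAvg_mul hA hB (hasMean_centredSq_mul_centredSq hθ.1.le hθ.2) hn).const_mul
      c₄)).add
    ((hasMean_coordAvg_mul hA hC (hasMean_centredSq_zero_mul_centredProd hθ.1.le hθ.2)
      hn).const_mul c₅)).add
    ((hasMean_coordAvg_mul hB hC (hasMean_centredSq_mul_centredProd hθ.1.le hθ.2) hn).const_mul
      c₆)).congr (fun ω => rfl) (by ring)

/-- The coefficient of `1 / n` in the mean of `ln sin²`. -/
noncomputable def meanCoeff (θ : ℝ) : ℝ := meanNumerator θ / limitSinSq θ ^ 2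

/-- The coefficient of `1 / n` in the variance of `ln sin²`. -/
noncomputable def varCoeff (θ : ℝ) : ℝ := varNumerator θ / limitSinSq θ ^ 2

theorem hasMean_logQuad {θ : ℝ} (hθ : θ ∈ Set.Ioc 0 Real.pi) {n : ℕ} (hn : 1 ≤ n) :
    HasMean (layerLaw n) (atDev θ (logQuad (crossMoment θ) (limitSinSq θ))) (meanCoeff θ / n) := by
  rw [meanCoeff, meanNumerator]
  have hD := (limitSinSq_pos hθ).ne'
  have hDK : limitSinSq θ = 1 - crossMoment θ ^ 2 := rfl
  set K := crossMoment θ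
  set D := limitSinSq θ
  refine (hasMean_quadratic hθ hn (1 / 2 - 1 / (2 * D ^ 2)) (1 / 2 - 1 / (2 * D ^ 2))
    (-1 / D - 2 * K ^ 2 / D ^ 2) (1 / D - 1 / D ^ 2) (2 * K / D ^ 2) (2 * K / D ^ 2)).congr
    (fun ω => ?_) ?_
  · simp only [atDev, logQuad, relQuad, relLin]
    field_simp
    ring
  · congr 1
    field_simp
    rw [hDK]
    ring

theorem hasMean_logLin_sq {θ : ℝ} (hθ : θ ∈ Set.Ioc 0 Real.pi) {n : ℕ} (hn : 1 ≤ n) :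
    HasMean (layerLaw n) (atDev θ fun a b c => logLin (crossMoment θ) (limitSinSq θ) a b c ^ 2)
      (varCoeff θ / n) := by
  rw [varCoeff, varNumerator]
  have hD := (limitSinSq_pos hθ).ne'
  have hDK : limitSinSq θ = 1 - crossMoment θ ^ 2 := rfl
  set K := crossMoment θ
  set D := limitSinSq θ
  refine (hasMean_quadratic hθ hn ((K ^ 2 / D) ^ 2) ((K ^ 2 / D) ^ 2) ((2 * K / D) ^ 2)
    (2 * (K ^ 2 / D) ^ 2) (-4 * K ^ 3 / D ^ 2) (-4 * K ^ 3 / D ^ 2)).congr (fun ω => ?_) ?_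
  · have e : ∀ a b c : ℝ, logLin K D a b c = K ^ 2 / D * (a + b) - 2 * K / D * c := by
      intro a b c
      rw [logLin, relLin]
      field_simp
      rw [hDK]
      ring
    simp only [atDev, e]
    ring
  · congr 1
    field_simp
    ring

theorem coordAvg_add (f g : ℝ × ℝ → ℝ) {n : ℕ} (ω : Fin n → ℝ × ℝ) :
    coordAvg (fun p => f p + g p) ω = coordAvg f ω + coordAvg g ω := by
  simp only [coordAvg, coordSum, Finset.sum_add_distrib, add_div]

theorem coordAvg_const_mul (c : ℝ) (f : ℝ × ℝ → ℝ) {n : ℕ} (ω : Fin n → ℝ × ℝ) :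
    coordAvg (fun p => c * f p) ω = c * coordAvg f ω := by
  simp only [coordAvg, coordSum, ← Finset.mul_sum, mul_div_assoc]

/-- Linear forms in the deviations are averages of a centred function. -/
theorem exists_coordAvg_eq_linear {θ : ℝ} (hθ : θ ∈ Set.Ioc 0 Real.pi) (u v w : ℝ) :
    ∃ p, IsCentred p ∧ ∀ (n : ℕ) (ω : Fin n → ℝ × ℝ),
      coordAvg p ω = atDev θ (fun a b c => u * a + v * b + w * c) ω :=
  ⟨_, (((isCentred_centredSq 0).const_mul u).add ((isCentred_centredSq θ).const_mul v)).add
    ((isCentred_centredProd hθ).const_mul w), fun n ω => by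
      rw [coordAvg_add, coordAvg_add, coordAvg_const_mul, coordAvg_const_mul, coordAvg_const_mul]
      rfl⟩

theorem hasMean_logLin {θ : ℝ} (hθ : θ ∈ Set.Ioc 0 Real.pi) (n : ℕ) :
    HasMean (layerLaw n) (atDev θ (logLin (crossMoment θ) (limitSinSq θ))) 0 := by
  set K := crossMoment θ
  set D := limitSinSq θ
  obtain ⟨p, hp, h⟩ := exists_coordAvg_eq_linear hθ (1 / D - 1) (1 / D - 1) (-2 * K / D)
  refine (hasMean_coordAvg hp n).congr (fun ω => ?_) rfl
  rw [h]
  simp only [atDev, logLin, relLin]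
  ring

theorem hasMeanInvSq_logCub {θ : ℝ} (hθ : θ ∈ Set.Ioc 0 Real.pi) :
    HasMeanInvSq fun _ => atDev θ (logCub (crossMoment θ) (limitSinSq θ)) := by
  have hA := isCentred_centredSq 0
  have hB := isCentred_centredSq θ
  have hC := isCentred_centredProd hθ
  set K := crossMoment θ
  set D := limitSinSq θ
  obtain ⟨r, hr, h⟩ := exists_coordAvg_eq_linear hθ (1 / D) (1 / D) (-2 * K / D)
  refine (((((hasMeanInvSq_coordAvg_mul_mul hr hA hB).const_mul (-1 / D)).add
    ((hasMeanInvSq_coordAvg_mul_mul hr hC hC).const_mul (1 / D))).add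
    ((hasMeanInvSq_coordAvg_mul_mul hr hr hr).const_mul (1 / 3))).add
    (((hasMeanInvSq_coordAvg_mul_mul hA hA hA).const_mul (-1 / 3)).add
      ((hasMeanInvSq_coordAvg_mul_mul hB hB hB).const_mul (-1 / 3)))).congr fun n ω => ?_
  rw [h]
  simp only [atDev, logCub, relLin, relQuad]
  ring

theorem hasMeanInvSq_logLin_mul_logQuad {θ : ℝ} (hθ : θ ∈ Set.Ioc 0 Real.pi) :
    HasMeanInvSq fun _ => atDev θ fun a b c => logLin (crossMoment θ) (limitSinSq θ) a b c
      * logQuad (crossMoment θ) (limitSinSq θ) a b c := by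
  have hA := isCentred_centredSq 0
  have hB := isCentred_centredSq θ
  have hC := isCentred_centredProd hθ
  set K := crossMoment θ
  set D := limitSinSq θ
  obtain ⟨r, hr, h⟩ := exists_coordAvg_eq_linear hθ (1 / D) (1 / D) (-2 * K / D)
  obtain ⟨l, hl, h'⟩ := exists_coordAvg_eq_linear hθ (1 / D - 1) (1 / D - 1) (-2 * K / D)
  refine (((((hasMeanInvSq_coordAvg_mul_mul hl hA hB).const_mul (1 / D)).add
    ((hasMeanInvSq_coordAvg_mul_mul hl hC hC).const_mul (-1 / D))).add
    ((hasMeanInvSq_coordAvg_mul_mul hl hr hr).const_mul (-1 / 2))).add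
    (((hasMeanInvSq_coordAvg_mul_mul hl hA hA).const_mul (1 / 2)).add
      ((hasMeanInvSq_coordAvg_mul_mul hl hB hB).const_mul (1 / 2)))).congr fun n ω => ?_
  rw [h, h']
  simp only [atDev, logLin, logQuad, relLin, relQuad]
  ring

theorem exists_integral_relDev_pow_four_le {θ : ℝ} (hθ : θ ∈ Set.Ioc 0 Real.pi) :
    ∃ C : ℝ, 0 ≤ C ∧ ∀ n : ℕ, 1 ≤ n →
      Integrable (atDev θ fun a b c => relDev (limitSinSq θ) a b c ^ 4) (layerLaw n) ∧
      ∫ ω, atDev θ (fun a b c => relDev (limitSinSq θ) a b c ^ 4) ω ∂(layerLaw n) ≤ C / n ^ 2 := by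
  obtain ⟨CA, hA0, hA⟩ := exists_coordAvg_pow_four_le (isCentred_centredSq 0)
  obtain ⟨CB, hB0, hB⟩ := exists_coordAvg_pow_four_le (isCentred_centredSq θ)
  obtain ⟨CC, hC0, hC⟩ := exists_coordAvg_pow_four_le (isCentred_centredProd hθ)
  have hD := limitSinSq_pos hθ
  set D := limitSinSq θ
  have hle : ∀ a b c : ℝ, relDev D a b c ^ 4 ≤ (D ^ 4)⁻¹ * (a ^ 4 + b ^ 4 + c ^ 4) := by
    intro a b c
    rw [relDev, div_pow, div_eq_inv_mul]
    gcongr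
    have e : ∀ x : ℝ, |x| ^ 4 = x ^ 4 := fun x => Even.pow_abs (by decide) x
    have ha : 0 ≤ a ^ 4 := by positivity
    have hb : 0 ≤ b ^ 4 := by positivity
    have hc : 0 ≤ c ^ 4 := by positivity
    rcases max_choice |a| (max |b| |c|) with h | h <;> rw [h]
    · rw [e]; linarith
    · rcases max_choice |b| |c| with h' | h' <;> rw [h', e] <;> linarith
  refine ⟨(D ^ 4)⁻¹ * (CA + CB + CC), by positivity, fun n hn => ?_⟩
  have hAB : Integrable (fun ω => coordAvg (centredSq 0) ω ^ 4 + coordAvg (centredSq θ) ω ^ 4)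
      (layerLaw n) := (hA n hn).1.add (hB n hn).1
  have hABC : Integrable (fun ω => coordAvg (centredSq 0) ω ^ 4 + coordAvg (centredSq θ) ω ^ 4
      + coordAvg (centredProd θ) ω ^ 4) (layerLaw n) := hAB.add (hC n hn).1
  have hint := hABC.const_mul ((D ^ 4)⁻¹)
  have hmeas : Measurable (fun ω : Fin n → ℝ × ℝ =>
      atDev θ (fun a b c => relDev D a b c ^ 4) ω) := by
    have h1 := measurable_coordAvg (continuous_centredSq 0) n
    have h2 := measurable_coordAvg (continuous_centredSq θ) n
    have h3 := measurable_coordAvg (continuous_centredProd θ) n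
    simp only [atDev, relDev]
    fun_prop
  refine ⟨hint.mono' hmeas.aestronglyMeasurable (Eventually.of_forall fun ω => ?_), ?_⟩
  · rw [Real.norm_of_nonneg (by simp only [atDev]; positivity)]
    exact hle _ _ _
  · refine (integral_mono_of_nonneg (Eventually.of_forall fun ω => by
      simp only [Pi.zero_apply]; positivity) hint
      (Eventually.of_forall fun ω => hle _ _ _)).trans ?_
    rw [integral_const_mul, integral_add hAB (hC n hn).1, integral_add (hA n hn).1 (hB n hn).1,
      mul_div_assoc, add_div, add_div]
    gcongr
    · exact (hA n hn).2
    · exact (hB n hn).2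
    · exact (hC n hn).2

/-! ### Mean and variance in a layer of large width -/

/-- The configurations for which the averaged deviations are small compared with `limitSinSq θ`. -/
def centralSet (θ : ℝ) (n : ℕ) : Set (Fin n → ℝ × ℝ) :=
  {ω | atDev θ (relDev (limitSinSq θ)) ω ≤ 1 / 12}

theorem measurableSet_centralSet (θ : ℝ) (n : ℕ) : MeasurableSet (centralSet θ n) := by
  have h1 := measurable_coordAvg (continuous_centredSq 0) n
  have h2 := measurable_coordAvg (continuous_centredSq θ) n
  have h3 := measurable_coordAvg (continuous_centredProd θ) n
  refine measurableSet_le ?_ measurable_const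
  exact (h1.abs.max (h2.abs.max h3.abs)).div_const _

theorem layerSinSq_eq_atDev (θ : ℝ) {n : ℕ} (hn : 1 ≤ n) (ω : Fin n → ℝ × ℝ) :
    layerSinSq θ ω = atDev θ (fun a b c => 1 - (crossMoment θ + c) ^ 2 / ((1 + a) * (1 + b))) ω := by
  have hn0 : (n : ℝ) ≠ 0 := by positivity
  have e1 : (n : ℝ) + coordSum (centredSq 0) ω = n * (1 + coordAvg (centredSq 0) ω) := by
    rw [coordAvg]; field_simp
  have e2 : (n : ℝ) + coordSum (centredSq θ) ω = n * (1 + coordAvg (centredSq θ) ω) := by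
    rw [coordAvg]; field_simp
  have e3 : (n : ℝ) * crossMoment θ + coordSum (centredProd θ) ω
      = n * (crossMoment θ + coordAvg (centredProd θ) ω) := by
    rw [coordAvg]; field_simp
  simp only [layerSinSq, atDev]
  rw [coordSum_act_sq, coordSum_act_sq, coordSum_act_mul_act, e1, e2, e3,
    show ∀ x y z : ℝ, ((n : ℝ) * x) ^ 2 / ((n * y) * (n * z)) = (n * n * x ^ 2) / (n * n * (y * z))
      from fun x y z => by ring, mul_div_mul_left _ _ (mul_ne_zero hn0 hn0)]

/-- In the central set the angle of the layer is nondegenerate. -/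
theorem pos_of_mem_centralSet {θ : ℝ} (hθ : θ ∈ Set.Ioc 0 Real.pi) {n : ℕ} (hn : 1 ≤ n)
    {ω : Fin n → ℝ × ℝ} (h : ω ∈ centralSet θ n) :
    0 < coordSum (fun p => act 0 p ^ 2) ω ∧ 0 < coordSum (fun p => act θ p ^ 2) ω ∧
      0 < layerSinSq θ ω := by
  have hD := limitSinSq_pos hθ
  have hn0 : (0 : ℝ) < n := by positivity
  obtain ⟨ha, hb, hc⟩ := abs_le_relDev_mul (a := coordAvg (centredSq 0) ω)
    (b := coordAvg (centredSq θ) ω) (c := coordAvg (centredProd θ) ω) hD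
  obtain ⟨h1, h2, h3, -⟩ := log_expansion_near (K := crossMoment θ) hD rfl ha hb hc h
  rw [coordSum_act_sq, coordSum_act_sq, layerSinSq_eq_atDev θ hn]
  refine ⟨?_, ?_, h3⟩
  · have : (n : ℝ) + coordSum (centredSq 0) ω = n * (1 + coordAvg (centredSq 0) ω) := by
      rw [coordAvg]; field_simp
    rw [this]; positivity
  · have : (n : ℝ) + coordSum (centredSq θ) ω = n * (1 + coordAvg (centredSq θ) ω) := by
      rw [coordAvg]; field_simp
    rw [this]; positivity

theorem exists_measure_compl_centralSet_le {θ : ℝ} (hθ : θ ∈ Set.Ioc 0 Real.pi) :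
    ∃ C : ℝ, 0 ≤ C ∧ ∀ n : ℕ, 1 ≤ n → (layerLaw n).real (centralSet θ n)ᶜ ≤ C / n ^ 6 := by
  have hD := limitSinSq_pos hθ
  have hδ : 0 < limitSinSq θ / 12 := by positivity
  obtain ⟨r₁, h10, h11, h1⟩ := exists_measure_abs_coordSum_ge_le (hasMean_centredSq 0)
    (continuous_centredSq 0).measurable (exists_integrable_exp_centredSq 0) hδ
  obtain ⟨r₂, h20, h21, h2⟩ := exists_measure_abs_coordSum_ge_le (hasMean_centredSq θ)
    (continuous_centredSq θ).measurable (exists_integrable_exp_centredSq θ) hδ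
  obtain ⟨r₃, h30, h31, h3⟩ := exists_measure_abs_coordSum_ge_le (hasMean_centredProd hθ.1.le hθ.2)
    (continuous_centredProd θ).measurable (exists_integrable_exp_centredProd θ) hδ
  have hbdd : ∀ r : ℝ, 0 < r → r < 1 → ∃ B : ℝ, 0 ≤ B ∧ ∀ n : ℕ, (n : ℝ) ^ 6 * r ^ n ≤ B := by
    intro r hr0 hr1
    have ht := tendsto_pow_const_mul_const_pow_of_abs_lt_one 6 (by rwa [abs_of_pos hr0])
    obtain ⟨B, hB⟩ := ht.bddAbove_range
    exact ⟨max B 0, le_max_right _ _, fun n => (hB ⟨n, rfl⟩).trans (le_max_left _ _)⟩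
  obtain ⟨B₁, hB10, hB1⟩ := hbdd r₁ h10 h11
  obtain ⟨B₂, hB20, hB2⟩ := hbdd r₂ h20 h21
  obtain ⟨B₃, hB30, hB3⟩ := hbdd r₃ h30 h31
  refine ⟨2 * (B₁ + B₂ + B₃), by positivity, fun n hn => ?_⟩
  have hn0 : (0 : ℝ) < n := by positivity
  have hsub : (centralSet θ n)ᶜ ⊆ ({ω | n * (limitSinSq θ / 12) ≤ |coordSum (centredSq 0) ω|} ∪
      {ω | n * (limitSinSq θ / 12) ≤ |coordSum (centredSq θ) ω|}) ∪
      {ω | n * (limitSinSq θ / 12) ≤ |coordSum (centredProd θ) ω|} := by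
    intro ω hω
    by_contra hcon
    simp only [Set.mem_union, Set.mem_ofPred_eq, not_or, not_le] at hcon
    refine hω ?_
    have key : ∀ f : ℝ × ℝ → ℝ, |coordSum f ω| < n * (limitSinSq θ / 12) →
        |coordAvg f ω| ≤ limitSinSq θ / 12 := by
      intro f hf
      rw [coordAvg, abs_div, Nat.abs_cast, div_le_iff₀ hn0]
      linarith
    change max _ (max _ _) / limitSinSq θ ≤ 1 / 12
    rw [div_le_iff₀ hD]
    have := max_le (key _ hcon.1.1) (max_le (key _ hcon.1.2) (key _ hcon.2))
    linarith
  calc (layerLaw n).real (centralSet θ n)ᶜ ≤ _ := measureReal_mono hsub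
    _ ≤ _ := (measureReal_union_le _ _).trans (add_le_add_left (measureReal_union_le _ _) _)
    _ ≤ 2 * r₁ ^ n + 2 * r₂ ^ n + 2 * r₃ ^ n := add_le_add (add_le_add (h1 n) (h2 n)) (h3 n)
    _ ≤ 2 * (B₁ + B₂ + B₃) / n ^ 6 := by
      rw [le_div_iff₀ (by positivity)]
      nlinarith [hB1 n, hB2 n, hB3 n]

/-- `ln sin²` of the angle of a layer, as a function of the Gaussian pairs of its neurons. -/
noncomputable def layerLog (θ : ℝ) {n : ℕ} (ω : Fin n → ℝ × ℝ) : ℝ := Real.log (layerSinSq θ ω)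

theorem measurable_layerLog (θ : ℝ) (n : ℕ) :
    Measurable fun ω : Fin n → ℝ × ℝ => layerLog θ ω :=
  Real.measurable_log.comp (measurable_layerSinSq θ n)

theorem integrable_layerLog_sq {θ : ℝ} (hθ : θ ∈ Set.Ioc 0 Real.pi) {n : ℕ} (hn : 1 ≤ n) :
    Integrable (fun ω => layerLog θ ω ^ 2) (layerLaw n) := by
  obtain ⟨C, -, hC⟩ := exists_log_layerSinSq_pow_four_le hθ
  refine ((hC n hn).1.add (integrable_const 1)).mono'
    ((measurable_layerLog θ n).pow_const 2).aestronglyMeasurable (Eventually.of_forall fun ω => ?_)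
  rw [Real.norm_of_nonneg (sq_nonneg _)]
  simp only [layerLog, Pi.add_apply]
  nlinarith [sq_nonneg (Real.log (layerSinSq θ ω) ^ 2 - 1)]

theorem memLp_layerLog {θ : ℝ} (hθ : θ ∈ Set.Ioc 0 Real.pi) {n : ℕ} (hn : 1 ≤ n) :
    MemLp (fun ω => layerLog θ ω) 2 (layerLaw n) :=
  (memLp_two_iff_integrable_sq (measurable_layerLog θ n).aestronglyMeasurable).2
    (integrable_layerLog_sq hθ hn)

/-- The part of the second moment outside the central set is negligible. By
`Φ² ≤ Φ⁴ / n⁴ + n⁴`, the polynomial bound on the fourth moment is enough. -/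
theorem exists_integral_compl_centralSet_le {θ : ℝ} (hθ : θ ∈ Set.Ioc 0 Real.pi) :
    ∃ C : ℝ, 0 ≤ C ∧ ∀ n : ℕ, 1 ≤ n →
      ∫ ω in (centralSet θ n)ᶜ, (1 + layerLog θ ω ^ 2) ∂(layerLaw n) ≤ C / n ^ 2 := by
  obtain ⟨C₁, h10, h1⟩ := exists_log_layerSinSq_pow_four_le hθ
  obtain ⟨C₂, h20, h2⟩ := exists_measure_compl_centralSet_le hθ
  refine ⟨C₁ + 2 * C₂, by positivity, fun n hn => ?_⟩
  have hn0 : (0 : ℝ) < n := by positivity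
  have hn1 : (1 : ℝ) ≤ n := by exact_mod_cast hn
  have hG := (measurableSet_centralSet θ n).compl
  have hint4 : Integrable (fun ω => layerLog θ ω ^ 4 / (n : ℝ) ^ 4) (layerLaw n) :=
    (h1 n hn).1.div_const _
  have hint : Integrable (fun ω => layerLog θ ω ^ 4 / n ^ 4 + 2 * (n : ℝ) ^ 4)
      ((layerLaw n).restrict (centralSet θ n)ᶜ) :=
    (hint4.add (integrable_const _)).restrict
  have hn4 : (1 : ℝ) ≤ n ^ 4 := one_le_pow₀ hn1
  have hle : ∀ ω : Fin n → ℝ × ℝ,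
      1 + layerLog θ ω ^ 2 ≤ layerLog θ ω ^ 4 / n ^ 4 + 2 * (n : ℝ) ^ 4 := by
    intro ω
    have e : layerLog θ ω ^ 2 = (layerLog θ ω ^ 2 / n ^ 2) * n ^ 2 := by field_simp
    have e' : layerLog θ ω ^ 4 / n ^ 4 = (layerLog θ ω ^ 2 / n ^ 2) ^ 2 := by field_simp
    rw [e']
    nlinarith [sq_nonneg (layerLog θ ω ^ 2 / n ^ 2 - n ^ 2),
      sq_nonneg (layerLog θ ω ^ 2 / n ^ 2 + n ^ 2)]
  calc ∫ ω in (centralSet θ n)ᶜ, (1 + layerLog θ ω ^ 2) ∂(layerLaw n)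
      ≤ ∫ ω in (centralSet θ n)ᶜ, (layerLog θ ω ^ 4 / n ^ 4 + 2 * (n : ℝ) ^ 4) ∂(layerLaw n) :=
        integral_mono_of_nonneg (Eventually.of_forall fun ω => by
          simp only [Pi.zero_apply]; positivity) hint (Eventually.of_forall hle)
    _ = ∫ ω in (centralSet θ n)ᶜ, layerLog θ ω ^ 4 / n ^ 4 ∂(layerLaw n)
        + (layerLaw n).real (centralSet θ n)ᶜ * (2 * (n : ℝ) ^ 4) := by
        rw [integral_add hint4.restrict (integrable_const _),
          setIntegral_const, smul_eq_mul]
    _ ≤ C₁ * n ^ 2 / n ^ 4 + C₂ / n ^ 6 * (2 * (n : ℝ) ^ 4) := by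
        gcongr
        · refine (setIntegral_le_integral hint4
            (Eventually.of_forall fun ω => by simp only [Pi.zero_apply]; positivity)).trans ?_
          rw [integral_div]
          gcongr
          exact (h1 n hn).2
        · exact h2 n hn
    _ = (C₁ + 2 * C₂) / n ^ 2 := by field_simp

theorem truncLog_atDev (θ : ℝ) {n : ℕ} (hn : 1 ≤ n) (ω : Fin n → ℝ × ℝ) :
    atDev θ (truncLog (crossMoment θ) (limitSinSq θ)) ω
      = (centralSet θ n).indicator (fun ω => layerLog θ ω) ω := by
  classical
  rw [Set.indicator_apply, layerLog, layerSinSq_eq_atDev θ hn]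
  rfl

/-- First and second moments of the deviation of `ln sin²` from its limit, over the central set. -/
theorem exists_integral_centralSet {θ : ℝ} (hθ : θ ∈ Set.Ioc 0 Real.pi) :
    ∃ C : ℝ, 0 ≤ C ∧ ∀ n : ℕ, 1 ≤ n →
      |(∫ ω in centralSet θ n, layerLog θ ω ∂(layerLaw n))
        - (Real.log (limitSinSq θ) + meanCoeff θ / n)| ≤ C / n ^ 2 ∧
      |(∫ ω in centralSet θ n, (layerLog θ ω - Real.log (limitSinSq θ)) ^ 2 ∂(layerLaw n))
        - varCoeff θ / n| ≤ C / n ^ 2 := by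
  have hD := limitSinSq_pos hθ
  obtain ⟨C, hC0, hC⟩ := exists_truncLog_expansion (K := crossMoment θ) hD rfl
  obtain ⟨C', hC'0, hC'⟩ := exists_integral_relDev_pow_four_le hθ
  obtain ⟨t, ht⟩ := hasMeanInvSq_logCub hθ
  obtain ⟨s, hs⟩ := hasMeanInvSq_logLin_mul_logQuad hθ
  refine ⟨C * C' + |t| + 2 * |s|, by positivity, fun n hn => ?_⟩
  have hn0 : (0 : ℝ) < n := by positivity
  have hG := measurableSet_centralSet θ n
  -- comparison of an integral over the central set with the mean of its polynomial approximation
  have key : ∀ (f : (Fin n → ℝ × ℝ) → ℝ) (g : (Fin n → ℝ × ℝ) → ℝ) (v : ℝ),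
      Integrable f (layerLaw n) → HasMean (layerLaw n) g v →
      (∀ ω, |(centralSet θ n).indicator f ω - g ω| ≤
        C * atDev θ (fun a b c => relDev (limitSinSq θ) a b c ^ 4) ω) →
      |(∫ ω in centralSet θ n, f ω ∂(layerLaw n)) - v| ≤ C * C' / n ^ 2 := by
    intro f g v hf hg hfg
    rw [← integral_indicator hG, ← hg.2, ← integral_sub (hf.indicator hG) hg.1]
    refine (abs_integral_le_integral_abs).trans ?_
    refine (integral_mono_of_nonneg (Eventually.of_forall fun ω => abs_nonneg _)
      ((hC' n hn).1.const_mul C) (Eventually.of_forall hfg)).trans ?_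
    rw [integral_const_mul, mul_div_assoc]
    exact mul_le_mul_of_nonneg_left (hC' n hn).2 hC0
  have hΦ : Integrable (fun ω => layerLog θ ω) (layerLaw n) :=
    (memLp_layerLog hθ hn).integrable (by norm_num)
  have hΦ2 : Integrable (fun ω => (layerLog θ ω - Real.log (limitSinSq θ)) ^ 2) (layerLaw n) :=
    ((memLp_layerLog hθ hn).sub (memLp_const _)).integrable_sq
  constructor
  · have h := key _ _ _ hΦ ((((hasMean_const (layerLaw n) (Real.log (limitSinSq θ))).add
      (hasMean_logLin hθ n)).add (hasMean_logQuad hθ hn)).add (ht n hn)) fun ω => by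
        rw [← truncLog_atDev θ hn]
        exact (hC _ _ _).1
    calc _ = |((∫ ω in centralSet θ n, layerLog θ ω ∂(layerLaw n))
          - (Real.log (limitSinSq θ) + 0 + meanCoeff θ / n + t / n ^ 2)) + t / n ^ 2| := by
          congr 1; ring
      _ ≤ C * C' / n ^ 2 + |t / n ^ 2| := (abs_add_le _ _).trans (by gcongr)
      _ = (C * C' + |t|) / n ^ 2 := by
          rw [abs_div, abs_of_pos (show (0 : ℝ) < n ^ 2 by positivity), add_div]
      _ ≤ _ := div_le_div_of_nonneg_right (by linarith [abs_nonneg s]) (by positivity)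
  · have h := key _ _ _ hΦ2 ((hasMean_logLin_sq hθ hn).add ((hs n hn).const_mul 2)) fun ω => by
      refine (le_of_eq ?_).trans (hC _ _ _).2
      congr 2
      by_cases hω : ω ∈ centralSet θ n
      · have hω' : atDev θ (relDev (limitSinSq θ)) ω ≤ 1 / 12 := hω
        rw [Set.indicator_of_mem hω]
        have e := truncLog_atDev θ hn ω
        rw [Set.indicator_of_mem hω] at e
        rw [← e]
        exact (if_pos hω').symm
      · have hω' : ¬ atDev θ (relDev (limitSinSq θ)) ω ≤ 1 / 12 := hω
        rw [Set.indicator_of_notMem hω]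
        exact (if_neg hω').symm
    calc _ = |((∫ ω in centralSet θ n, (layerLog θ ω - Real.log (limitSinSq θ)) ^ 2 ∂(layerLaw n))
          - (varCoeff θ / n + 2 * (s / n ^ 2))) + 2 * (s / n ^ 2)| := by
          congr 1; ring
      _ ≤ C * C' / n ^ 2 + |2 * (s / n ^ 2)| := (abs_add_le _ _).trans (by gcongr)
      _ = (C * C' + 2 * |s|) / n ^ 2 := by
          rw [abs_mul, abs_two, abs_div, abs_of_pos (show (0 : ℝ) < n ^ 2 by positivity), add_div]
          ring
      _ ≤ _ := div_le_div_of_nonneg_right (by linarith [abs_nonneg t]) (by positivity)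

/-- The same expansions over any event containing the central set. -/
theorem exists_setIntegral_layerLog {θ : ℝ} (hθ : θ ∈ Set.Ioc 0 Real.pi) :
    ∃ C : ℝ, 0 ≤ C ∧ ∀ n : ℕ, 1 ≤ n → ∀ E : Set (Fin n → ℝ × ℝ), MeasurableSet E →
      centralSet θ n ⊆ E →
      |(∫ ω in E, layerLog θ ω ∂(layerLaw n))
        - (Real.log (limitSinSq θ) + meanCoeff θ / n)| ≤ C / n ^ 2 ∧
      |(∫ ω in E, (layerLog θ ω - Real.log (limitSinSq θ)) ^ 2 ∂(layerLaw n))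
        - varCoeff θ / n| ≤ C / n ^ 2 ∧
      1 - (layerLaw n).real E ≤ C / n ^ 2 := by
  obtain ⟨C₁, h10, h1⟩ := exists_integral_centralSet hθ
  obtain ⟨C₂, h20, h2⟩ := exists_integral_compl_centralSet_le hθ
  set f₀ := Real.log (limitSinSq θ) with hf0
  refine ⟨C₁ + (2 + 2 * f₀ ^ 2) * C₂, by positivity, fun n hn E hE hGE => ?_⟩
  have hn0 : (0 : ℝ) < n := by positivity
  have hG := measurableSet_centralSet θ n
  have hw : Integrable (fun ω => 1 + layerLog θ ω ^ 2) (layerLaw n) :=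
    (integrable_const 1).add (integrable_layerLog_sq hθ hn)
  -- the integrals over `E` and over the central set differ by a negligible amount
  have key : ∀ (f : (Fin n → ℝ × ℝ) → ℝ), Integrable f (layerLaw n) →
      (∀ ω, |f ω| ≤ (2 + 2 * f₀ ^ 2) * (1 + layerLog θ ω ^ 2)) →
      |(∫ ω in E, f ω ∂(layerLaw n)) - ∫ ω in centralSet θ n, f ω ∂(layerLaw n)|
        ≤ (2 + 2 * f₀ ^ 2) * C₂ / n ^ 2 := by
    intro f hf hle
    rw [← setIntegral_sdiff hG hf.integrableOn hGE]
    refine (abs_integral_le_integral_abs).trans ?_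
    calc ∫ ω in E \ centralSet θ n, |f ω| ∂(layerLaw n)
        ≤ ∫ ω in (centralSet θ n)ᶜ, |f ω| ∂(layerLaw n) :=
          setIntegral_mono_set hf.abs.integrableOn (Eventually.of_forall fun ω => abs_nonneg _)
            (Eventually.of_forall fun ω hω => hω.2)
      _ ≤ ∫ ω in (centralSet θ n)ᶜ, (2 + 2 * f₀ ^ 2) * (1 + layerLog θ ω ^ 2) ∂(layerLaw n) :=
          integral_mono hf.abs.restrict (hw.const_mul _).restrict hle
      _ ≤ (2 + 2 * f₀ ^ 2) * C₂ / n ^ 2 := by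
          rw [integral_const_mul, mul_div_assoc]
          exact mul_le_mul_of_nonneg_left (h2 n hn) (by positivity)
  have hΦ : Integrable (fun ω => layerLog θ ω) (layerLaw n) :=
    (memLp_layerLog hθ hn).integrable (by norm_num)
  have hΦ2 : Integrable (fun ω => (layerLog θ ω - f₀) ^ 2) (layerLaw n) :=
    ((memLp_layerLog hθ hn).sub (memLp_const _)).integrable_sq
  refine ⟨?_, ?_, ?_⟩
  · have k := key _ hΦ fun ω => by
      have hx : |layerLog θ ω| ≤ 1 + layerLog θ ω ^ 2 := by
        rw [abs_le]
        constructor <;> nlinarith [sq_nonneg (layerLog θ ω - 1), sq_nonneg (layerLog θ ω + 1)]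
      nlinarith [sq_nonneg f₀, sq_nonneg (layerLog θ ω),
        mul_nonneg (sq_nonneg f₀) (sq_nonneg (layerLog θ ω))]
    rw [add_div]
    exact (abs_sub_le _ _ _).trans ((add_le_add k (h1 n hn).1).trans (add_comm _ _).le)
  · have k := key _ hΦ2 fun ω => by
      rw [abs_of_nonneg (sq_nonneg _)]
      nlinarith [sq_nonneg (layerLog θ ω + f₀), sq_nonneg f₀, sq_nonneg (layerLog θ ω),
        mul_nonneg (sq_nonneg f₀) (sq_nonneg (layerLog θ ω))]
    rw [add_div]
    exact (abs_sub_le _ _ _).trans ((add_le_add k (h1 n hn).2).trans (add_comm _ _).le)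
  · have e : 1 - (layerLaw n).real E ≤ (layerLaw n).real (centralSet θ n)ᶜ := by
      rw [← probReal_compl_eq_one_sub hE]
      exact measureReal_mono (Set.compl_subset_compl.2 hGE)
    have e2 : (layerLaw n).real (centralSet θ n)ᶜ ≤
        ∫ ω in (centralSet θ n)ᶜ, (1 + layerLog θ ω ^ 2) ∂(layerLaw n) := by
      rw [← setIntegral_one_eq_measureReal]
      exact integral_mono (integrable_const _) hw.restrict fun ω => by
        simp only
        nlinarith [sq_nonneg (layerLog θ ω)]
    refine (e.trans (e2.trans (h2 n hn))).trans ?_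
    gcongr
    nlinarith [mul_nonneg (sq_nonneg f₀) h20]

/-- Conditional mean and variance of `ln sin²` given an event containing the central set. -/
theorem exists_cond_layerLog {θ : ℝ} (hθ : θ ∈ Set.Ioc 0 Real.pi) :
    ∃ (C : ℝ) (n₀ : ℕ), 0 ≤ C ∧ 1 ≤ n₀ ∧ ∀ n : ℕ, n₀ ≤ n → ∀ E : Set (Fin n → ℝ × ℝ),
      MeasurableSet E → centralSet θ n ⊆ E →
      MemLp (fun ω => layerLog θ ω) 2 ((layerLaw n)[|E]) ∧
      |(∫ ω, layerLog θ ω ∂((layerLaw n)[|E]))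
        - (Real.log (limitSinSq θ) + meanCoeff θ / n)| ≤ C / n ^ 2 ∧
      |variance (fun ω => layerLog θ ω) ((layerLaw n)[|E]) - varCoeff θ / n| ≤ C / n ^ 2 := by
  obtain ⟨C, hC0, hC⟩ := exists_setIntegral_layerLog hθ
  set f₀ := Real.log (limitSinSq θ) with hf0
  -- from this width on, `E` has probability at least `1 / 2`
  obtain ⟨n₀, hn₀⟩ := exists_nat_ge (2 * C + 1)
  set A := 2 * C * (1 + |f₀| + |meanCoeff θ| + |varCoeff θ|) with hA
  have hA0 : 0 ≤ A := by positivity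
  refine ⟨A + (A + |meanCoeff θ|) ^ 2, max n₀ 1, by positivity, le_max_right _ _,
    fun n hn E hE hGE => ?_⟩
  have hn1 : 1 ≤ n := (le_max_right _ _).trans hn
  have hn1' : (1 : ℝ) ≤ n := by exact_mod_cast hn1
  have hn0 : (0 : ℝ) < n := by positivity
  have hnC : 2 * C + 1 ≤ (n : ℝ) := hn₀.trans (by exact_mod_cast (le_max_left _ _).trans hn)
  obtain ⟨c1, c2, c3⟩ := hC n hn1 E hE hGE
  set e := (layerLaw n).real E with he
  have hε : 0 ≤ C / (n : ℝ) ^ 2 := by positivity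
  have he1 : e ≤ 1 := measureReal_le_one
  have he2 : 1 / 2 ≤ e := by
    have : C / (n : ℝ) ^ 2 ≤ 1 / 2 := by
      rw [div_le_iff₀ (by positivity)]
      nlinarith
    linarith
  have hint : ∀ f : (Fin n → ℝ × ℝ) → ℝ,
      ∫ ω, f ω ∂((layerLaw n)[|E]) = e⁻¹ * ∫ ω in E, f ω ∂(layerLaw n) := by
    intro f
    rw [ProbabilityTheory.cond, integral_smul_measure, ENNReal.toReal_inv, smul_eq_mul]
    rfl
  have : IsProbabilityMeasure ((layerLaw n)[|E]) := by
    refine cond_isProbabilityMeasure fun h0 => ?_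
    rw [he, measureReal_def, h0, ENNReal.toReal_zero] at he2
    norm_num at he2
  -- dividing by the probability of `E`, which is `1 - O(n⁻²)`
  have key : ∀ x y Y : ℝ, |x - y| ≤ C / n ^ 2 → |y| ≤ Y → |e⁻¹ * x - y| ≤ 2 * C * (1 + Y) / n ^ 2 := by
    intro x y Y h1 h2
    have hpos : 0 < e := by linarith
    have e1 : e⁻¹ * x - y = e⁻¹ * ((x - y) + (1 - e) * y) := by field_simp; ring
    have h3 : |(1 - e) * y| ≤ C / n ^ 2 * Y := by
      rw [abs_mul, abs_of_nonneg (show 0 ≤ 1 - e by linarith)]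
      exact mul_le_mul c3 h2 (abs_nonneg _) hε
    have h4 : e⁻¹ ≤ 2 := by
      rw [inv_le_comm₀ hpos (by norm_num)]; linarith
    rw [e1, abs_mul, abs_of_pos (inv_pos.2 hpos)]
    calc e⁻¹ * |(x - y) + (1 - e) * y| ≤ 2 * (C / n ^ 2 + C / n ^ 2 * Y) := by
          refine mul_le_mul h4 ((abs_add_le _ _).trans (add_le_add h1 h3)) (abs_nonneg _)
            (by norm_num)
      _ = 2 * C * (1 + Y) / n ^ 2 := by ring
  have hdiv : ∀ q : ℝ, |q / n| ≤ |q| := fun q => by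
    rw [abs_div, Nat.abs_cast]
    exact div_le_self (abs_nonneg _) hn1'
  have hmem : MemLp (fun ω => layerLog θ ω) 2 ((layerLaw n)[|E]) := by
    refine ((memLp_layerLog hθ hn1).restrict E).smul_measure ?_
    rw [ne_eq, ENNReal.inv_eq_top]
    intro h0
    rw [he, measureReal_def, h0, ENNReal.toReal_zero] at he2
    norm_num at he2
  have m1 : |(∫ ω, layerLog θ ω ∂((layerLaw n)[|E])) - (f₀ + meanCoeff θ / n)| ≤ A / n ^ 2 := by
    rw [hint]
    refine (key _ _ (|f₀| + |meanCoeff θ|) c1 ((abs_add_le _ _).trans (add_le_add le_rfl (hdiv _)))).trans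
      ?_
    rw [hA]
    gcongr 2 * C * ?_ / _
    linarith [abs_nonneg (varCoeff θ)]
  have m2 : |(∫ ω, (layerLog θ ω - f₀) ^ 2 ∂((layerLaw n)[|E])) - varCoeff θ / n| ≤ A / n ^ 2 := by
    rw [hint]
    refine (key _ _ |varCoeff θ| c2 (hdiv _)).trans ?_
    rw [hA]
    gcongr 2 * C * ?_ / _
    linarith [abs_nonneg (meanCoeff θ), abs_nonneg f₀]
  refine ⟨hmem, m1.trans (by gcongr; linarith [sq_nonneg (A + |meanCoeff θ|)]), ?_⟩
  have hvar : variance (fun ω => layerLog θ ω) ((layerLaw n)[|E])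
      = (∫ ω, (layerLog θ ω - f₀) ^ 2 ∂((layerLaw n)[|E]))
        - ((∫ ω, layerLog θ ω ∂((layerLaw n)[|E])) - f₀) ^ 2 := by
    have hsub : MemLp (fun ω => layerLog θ ω - f₀) 2 ((layerLaw n)[|E]) :=
      hmem.sub (memLp_const f₀)
    rw [← variance_sub_const hmem.aestronglyMeasurable f₀, variance_eq_sub hsub,
      integral_sub (hmem.integrable (by norm_num)) (integrable_const _)]
    simp
  have hd : ((∫ ω, layerLog θ ω ∂((layerLaw n)[|E])) - f₀) ^ 2 ≤ (A + |meanCoeff θ|) ^ 2 / n ^ 2 := by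
    rw [← div_pow, ← sq_abs]
    refine pow_le_pow_left₀ (abs_nonneg _) ?_ 2
    have e1 : (∫ ω, layerLog θ ω ∂((layerLaw n)[|E])) - f₀ =
        ((∫ ω, layerLog θ ω ∂((layerLaw n)[|E])) - (f₀ + meanCoeff θ / n)) + meanCoeff θ / n := by
      ring
    rw [e1, add_div]
    refine (abs_add_le _ _).trans (add_le_add (m1.trans ?_) ?_)
    · rw [sq]
      refine div_le_div_of_nonneg_left hA0 hn0 (by nlinarith)
    · rw [abs_div, Nat.abs_cast]
  rw [hvar, add_div]
  calc _ = |((∫ ω, (layerLog θ ω - f₀) ^ 2 ∂((layerLaw n)[|E])) - varCoeff θ / n)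
        - ((∫ ω, layerLog θ ω ∂((layerLaw n)[|E])) - f₀) ^ 2| := by congr 1; ring
    _ ≤ _ := (abs_sub _ _).trans (add_le_add m2 (by rw [abs_of_nonneg (sq_nonneg _)]; exact hd))

/-! ### One layer: the angle of the rectified Gaussian vectors -/

/-- ReLU with values in Euclidean space. -/
noncomputable def reluVec {n : ℕ} (z : Fin n → ℝ) : EuclideanSpace ℝ (Fin n) :=
  WithLp.toLp 2 (relu z)

/-- The angle between two vectors, as a function on pairs. -/
noncomputable def pairAngle {E : Type*} [NormedAddCommGroup E] [InnerProductSpace ℝ E]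
    (p : E × E) : ℝ :=
  InnerProductGeometry.angle p.1 p.2

/-- The pairs of linearly independent vectors, stated in the form in which nondegeneracy of a layer
is. -/
def nonparallel (E : Type*) [NormedAddCommGroup E] [InnerProductSpace ℝ E] : Set (E × E) :=
  {p | p.1 ≠ 0 ∧ p.2 ≠ 0 ∧ Real.sin (pairAngle p) ≠ 0}

/-- The pair of post-activation vectors, up to positive scalars, of a layer whose neurons see the
Gaussian pairs `ω`, if the angle between the inputs of the layer is `θ`. -/
noncomputable def modelOutput {n : ℕ} (θ : ℝ) (ω : Fin n → ℝ × ℝ) :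
    EuclideanSpace ℝ (Fin n) × EuclideanSpace ℝ (Fin n) :=
  (reluVec fun i => proj 0 (ω i), reluVec fun i => proj θ (ω i))

theorem measurable_reluVec (n : ℕ) : Measurable (reluVec (n := n)) := by
  refine (WithLp.measurable_toLp 2 _).comp (measurable_pi_lambda _ fun i => ?_)
  exact (measurable_pi_apply i).max measurable_const

theorem reluVec_smul {n : ℕ} {r : ℝ} (hr : 0 ≤ r) (z : Fin n → ℝ) :
    reluVec (fun i => r * z i) = r • reluVec z := by
  ext i
  simp only [reluVec, relu, PiLp.smul_apply, smul_eq_mul]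
  rw [mul_max_of_nonneg _ _ hr, mul_zero]

section Measurability

variable {E : Type*} [NormedAddCommGroup E] [InnerProductSpace ℝ E] [MeasurableSpace E]
  [BorelSpace E] [SecondCountableTopology E]

theorem measurable_pairAngle : Measurable (pairAngle (E := E)) := by
  refine Real.measurable_arccos.comp (Measurable.div ?_ ?_)
  · exact measurable_fst.inner measurable_snd
  · exact measurable_fst.norm.mul measurable_snd.norm

theorem measurableSet_nonparallel : MeasurableSet (nonparallel E) := by
  refine (measurable_fst (measurableSet_singleton 0).compl).inter
    ((measurable_snd (measurableSet_singleton 0).compl).inter ?_)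
  exact (Real.measurable_sin.comp measurable_pairAngle) (measurableSet_singleton 0).compl

end Measurability

theorem pairAngle_smul_smul {E : Type*} [NormedAddCommGroup E] [InnerProductSpace ℝ E] {a b : ℝ}
    (ha : 0 < a) (hb : 0 < b) (p : E × E) : pairAngle (a • p.1, b • p.2) = pairAngle p := by
  simp only [pairAngle]
  rw [InnerProductGeometry.angle_smul_left_of_pos _ _ ha,
    InnerProductGeometry.angle_smul_right_of_pos _ _ hb]

theorem smul_smul_mem_nonparallel {E : Type*} [NormedAddCommGroup E] [InnerProductSpace ℝ E]
    {a b : ℝ} (ha : 0 < a) (hb : 0 < b) (p : E × E) :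
    (a • p.1, b • p.2) ∈ nonparallel E ↔ p ∈ nonparallel E := by
  have := pairAngle_smul_smul ha hb p
  simp only [nonparallel, Set.mem_ofPred_eq, this]
  simp [ha.ne', hb.ne']

theorem measurable_modelOutput (n : ℕ) :
    Measurable fun q : ℝ × (Fin n → ℝ × ℝ) => modelOutput q.1 q.2 := by
  have h : ∀ i, Measurable fun q : ℝ × (Fin n → ℝ × ℝ) => q.2 i := fun i =>
    (measurable_pi_apply i).comp measurable_snd
  refine Measurable.prodMk ((measurable_reluVec n).comp (measurable_pi_lambda _ fun i => ?_))
    ((measurable_reluVec n).comp (measurable_pi_lambda _ fun i => ?_))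
  · exact (continuous_proj 0).measurable.comp (h i)
  · exact ((Real.measurable_cos.comp measurable_fst).mul (h i).fst).add
      ((Real.measurable_sin.comp measurable_fst).mul (h i).snd)

theorem measurable_modelOutput_right (θ : ℝ) (n : ℕ) :
    Measurable fun ω : Fin n → ℝ × ℝ => modelOutput θ ω :=
  (measurable_modelOutput n).comp measurable_prodMk_left

theorem norm_reluVec_proj_sq (θ : ℝ) {n : ℕ} (ω : Fin n → ℝ × ℝ) :
    ‖reluVec fun i => proj θ (ω i)‖ ^ 2 = coordSum (fun p => act θ p ^ 2) ω / 2 := by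
  rw [EuclideanSpace.norm_sq_eq, coordSum, Finset.sum_div]
  refine Finset.sum_congr rfl fun i _ => ?_
  simp only [reluVec, relu, act, mul_pow, Real.sq_sqrt zero_le_two, Real.norm_eq_abs, sq_abs]
  ring

theorem inner_reluVec_proj (θ : ℝ) {n : ℕ} (ω : Fin n → ℝ × ℝ) :
    inner ℝ (reluVec fun i => proj 0 (ω i)) (reluVec fun i => proj θ (ω i))
      = coordSum (fun p => act 0 p * act θ p) ω / 2 := by
  rw [PiLp.inner_apply, coordSum, Finset.sum_div]
  refine Finset.sum_congr rfl fun i _ => ?_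
  have h : √(2 : ℝ) * √2 = 2 := Real.mul_self_sqrt zero_le_two
  simp only [reluVec, relu, act, RCLike.inner_apply, conj_trivial]
  linear_combination (-(max (proj 0 (ω i)) 0 * max (proj θ (ω i)) 0) / 2) * h

/-- Also in the degenerate cases: if one of the vectors vanishes then the angle is `π / 2` and the
quotient in `layerSinSq` is `0`. -/
theorem sin_sq_pairAngle_modelOutput (θ : ℝ) {n : ℕ} (ω : Fin n → ℝ × ℝ) :
    Real.sin (pairAngle (modelOutput θ ω)) ^ 2 = layerSinSq θ ω := by
  rw [Real.sin_sq, pairAngle, InnerProductGeometry.cos_angle, div_pow, mul_pow]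
  simp only [modelOutput]
  rw [norm_reluVec_proj_sq, norm_reluVec_proj_sq, inner_reluVec_proj, layerSinSq]
  congr 1
  rw [div_pow, div_mul_div_comm, show (2 : ℝ) ^ 2 = 2 * 2 by norm_num,
    div_div_div_cancel_right₀ (by norm_num)]

theorem logSinSq_pairAngle_modelOutput (θ : ℝ) {n : ℕ} (ω : Fin n → ℝ × ℝ) :
    logSinSq (pairAngle (modelOutput θ ω)) = layerLog θ ω := by
  rw [logSinSq, layerLog, sin_sq_pairAngle_modelOutput]

theorem modelOutput_mem_nonparallel {θ : ℝ} (hθ : θ ∈ Set.Ioc 0 Real.pi) {n : ℕ} (hn : 1 ≤ n)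
    {ω : Fin n → ℝ × ℝ} (h : ω ∈ centralSet θ n) :
    modelOutput θ ω ∈ nonparallel (EuclideanSpace ℝ (Fin n)) := by
  obtain ⟨h1, h2, h3⟩ := pos_of_mem_centralSet hθ hn h
  have key : ∀ t, 0 < coordSum (fun p => act t p ^ 2) ω →
      (reluVec fun i => proj t (ω i)) ≠ 0 := by
    intro t ht h0
    have := norm_reluVec_proj_sq t ω
    rw [h0, norm_zero] at this
    linarith
  refine ⟨key 0 h1, key θ h2, fun h0 => ?_⟩
  have e := sin_sq_pairAngle_modelOutput θ ω
  rw [h0] at e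
  linarith [e]

/-- Inputs that are positive multiples of each other give parallel outputs. -/
theorem modelOutput_zero_notMem_nonparallel {n : ℕ} (ω : Fin n → ℝ × ℝ) :
    modelOutput 0 ω ∉ nonparallel (EuclideanSpace ℝ (Fin n)) := by
  rintro ⟨h1, -, h3⟩
  refine h3 ?_
  simp only [modelOutput, pairAngle] at h1 ⊢
  rw [InnerProductGeometry.angle_self h1, Real.sin_zero]

/-! ### The conditional law of the angle in one layer -/

/-- The event that the model layer is nondegenerate and its angle lies in `B`. -/
def modelEvent (n : ℕ) (B : Set ℝ) (θ : ℝ) : Set (Fin n → ℝ × ℝ) :=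
  {ω | modelOutput θ ω ∈ nonparallel (EuclideanSpace ℝ (Fin n)) ∧ pairAngle (modelOutput θ ω) ∈ B}

theorem measurableSet_angle_event {E : Type*} [NormedAddCommGroup E] [InnerProductSpace ℝ E]
    [MeasurableSpace E] [BorelSpace E] [SecondCountableTopology E] {B : Set ℝ}
    (hB : MeasurableSet B) : MeasurableSet {p : E × E | p ∈ nonparallel E ∧ pairAngle p ∈ B} :=
  measurableSet_nonparallel.inter (measurable_pairAngle hB)

theorem measurableSet_modelEvent (n : ℕ) {B : Set ℝ} (hB : MeasurableSet B) (θ : ℝ) :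
    MeasurableSet (modelEvent n B θ) :=
  measurable_modelOutput_right θ n (measurableSet_angle_event hB)

theorem measurable_measure_modelEvent (n : ℕ) {B : Set ℝ} (hB : MeasurableSet B) :
    Measurable fun θ => layerLaw n (modelEvent n B θ) :=
  measurable_measure_prodMk_left (ν := layerLaw n)
    (measurable_modelOutput n (measurableSet_angle_event hB))

theorem map_cond_modelEvent_apply (n : ℕ) (θ : ℝ) {B : Set ℝ} (hB : MeasurableSet B) :
    ((layerLaw n)[|modelEvent n Set.univ θ]).map (fun ω => pairAngle (modelOutput θ ω)) B
      = (layerLaw n (modelEvent n Set.univ θ))⁻¹ * layerLaw n (modelEvent n B θ) := by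
  have hm : Measurable fun ω : Fin n → ℝ × ℝ => pairAngle (modelOutput θ ω) :=
    measurable_pairAngle.comp (measurable_modelOutput_right θ n)
  rw [Measure.map_apply hm hB, cond_apply (measurableSet_modelEvent n .univ θ)]
  congr 2
  ext ω
  simp [modelEvent]

/-- The law of the angle in a layer of width `n`, given nondegeneracy, if the angle in the
previous layer is `θ`. -/
noncomputable def angleKernel (n : ℕ) : Kernel ℝ ℝ where
  toFun θ := ((layerLaw n)[|modelEvent n Set.univ θ]).map fun ω => pairAngle (modelOutput θ ω)
  measurable' := by
    refine Measure.measurable_of_measurable_coe _ fun B hB => ?_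
    simp_rw [map_cond_modelEvent_apply n _ hB]
    exact (measurable_measure_modelEvent n .univ).inv.mul (measurable_measure_modelEvent n hB)

theorem angleKernel_apply (n : ℕ) (θ : ℝ) : angleKernel n θ =
    ((layerLaw n)[|modelEvent n Set.univ θ]).map fun ω => pairAngle (modelOutput θ ω) := rfl

instance (n : ℕ) : IsFiniteKernel (angleKernel n) := by
  refine ⟨⟨1, ENNReal.one_lt_top, fun θ => ?_⟩⟩
  rw [angleKernel_apply, map_cond_modelEvent_apply n θ .univ]
  exact ENNReal.inv_mul_le_one _

/-- The factor is the probability of nondegeneracy. If it vanishes, so do both sides. -/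
theorem mul_angleKernel_apply (n : ℕ) (θ : ℝ) {B : Set ℝ} (hB : MeasurableSet B) :
    layerLaw n (modelEvent n Set.univ θ) * angleKernel n θ B = layerLaw n (modelEvent n B θ) := by
  rw [angleKernel_apply, map_cond_modelEvent_apply n θ hB, ← mul_assoc]
  rcases eq_or_ne (layerLaw n (modelEvent n Set.univ θ)) 0 with h | h
  · rw [h, zero_mul, zero_mul]
    have hs : modelEvent n B θ ⊆ modelEvent n Set.univ θ := fun ω hω => ⟨hω.1, trivial⟩
    exact (measure_mono_null hs h).symm
  · rw [ENNReal.mul_inv_cancel h (measure_ne_top _ _), one_mul]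

theorem exists_angleKernel {θ : ℝ} (hθ : θ ∈ Set.Ioc 0 Real.pi) :
    ∃ (C : ℝ) (n₀ : ℕ), 0 ≤ C ∧ ∀ n, n₀ ≤ n →
      MemLp logSinSq 2 (angleKernel n θ) ∧
      |(∫ t, logSinSq t ∂(angleKernel n θ)) - (Real.log (limitSinSq θ) + meanCoeff θ / n)|
        ≤ C / n ^ 2 ∧
      |variance logSinSq (angleKernel n θ) - varCoeff θ / n| ≤ C / n ^ 2 := by
  obtain ⟨C, n₀, hC, hn₀, h⟩ := exists_cond_layerLog hθ
  refine ⟨C, n₀, hC, fun n hn => ?_⟩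
  obtain ⟨h1, h2, h3⟩ := h n hn (modelEvent n Set.univ θ) (measurableSet_modelEvent n .univ θ)
    fun ω hω => ⟨modelOutput_mem_nonparallel hθ (hn₀.trans hn) hω, trivial⟩
  have hm : Measurable fun ω : Fin n → ℝ × ℝ => pairAngle (modelOutput θ ω) :=
    measurable_pairAngle.comp (measurable_modelOutput_right θ n)
  have hl : Measurable logSinSq := Real.measurable_log.comp (Real.measurable_sin.pow_const 2)
  have e : logSinSq ∘ (fun ω : Fin n → ℝ × ℝ => pairAngle (modelOutput θ ω)) =
      fun ω => layerLog θ ω := funext fun ω => logSinSq_pairAngle_modelOutput θ ω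
  rw [angleKernel_apply]
  refine ⟨?_, ?_, ?_⟩
  · rw [memLp_map_measure_iff hl.aestronglyMeasurable hm.aemeasurable, e]
    exact h1
  · rw [integral_map hm.aemeasurable hl.aestronglyMeasurable]
    simp_rw [logSinSq_pairAngle_modelOutput]
    exact h2
  · rw [variance_map hl.aemeasurable hm.aemeasurable, e]
    exact h3

/-! ### From one layer of the network to the next -/

/-- The scalar in front of the weight matrix that leads from layer `k` to layer `k + 1`. -/
noncomputable def layerScale (N : ℕ → ℕ) : ℕ → ℝ
  | 0 => 1
  | k + 1 => √(2 / (N (k + 1) : ℝ))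

theorem layerScale_nonneg (N : ℕ → ℕ) (k : ℕ) : 0 ≤ layerScale N k := by
  cases k with
  | zero => exact zero_le_one
  | succ k => exact Real.sqrt_nonneg _

/-- The vector `i ↦ r ⟨u, V i⟩`, rectified. -/
noncomputable def layerStep {m n : ℕ} (r : ℝ) (u : EuclideanSpace ℝ (Fin m))
    (V : Fin n → EuclideanSpace ℝ (Fin m)) : EuclideanSpace ℝ (Fin n) :=
  reluVec fun i => r * inner ℝ u (V i)

/-- The rows of a matrix as vectors of Euclidean space. -/
noncomputable def rowVec {m n : ℕ} (A : Matrix (Fin n) (Fin m) ℝ) (i : Fin n) :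
    EuclideanSpace ℝ (Fin m) :=
  WithLp.toLp 2 (A i)

theorem output_succ {N : ℕ → ℕ} (W : Weights N) (x : Fin (N 0) → ℝ) (k : ℕ) :
    output W x (k + 1) = layerStep (layerScale N k) (output W x k) (rowVec (W k)) := by
  have h : ∀ (z : Fin (N k) → ℝ) (i : Fin (N (k + 1))),
      (W k *ᵥ z) i = inner ℝ (WithLp.toLp 2 z : EuclideanSpace ℝ (Fin (N k))) (rowVec (W k) i) := by
    intro z i
    rw [PiLp.inner_apply]
    change ∑ j, W k i j * z j = _
    exact Finset.sum_congr rfl fun j _ => by simp [rowVec]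
  cases k with
  | zero =>
    refine congrArg reluVec (funext fun i => (h x i).trans ?_)
    rw [layerScale, one_mul]
    rfl
  | succ k =>
    exact congrArg reluVec (funext fun i => congrArg (layerScale N (k + 1) * ·) (h _ i))

theorem output_congr {N : ℕ → ℕ} {W W' : Weights N} (x : Fin (N 0) → ℝ) {k : ℕ}
    (h : ∀ j < k, W j = W' j) : output W x k = output W' x k := by
  induction k with
  | zero => rfl
  | succ k ih =>
    rw [output_succ, output_succ, ih fun j hj => h j (hj.trans k.lt_succ_self), h k k.lt_succ_self]

theorem measurable_rowVec {Ω : Type*} [MeasurableSpace Ω] {m n : ℕ}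
    {A : Ω → Matrix (Fin n) (Fin m) ℝ} (hA : ∀ i j, Measurable fun ω => A ω i j) :
    Measurable fun ω => rowVec (A ω) := by
  refine measurable_pi_lambda _ fun i => ?_
  have h : Measurable fun ω => A ω i := measurable_pi_lambda _ fun j => hA i j
  exact (WithLp.measurable_toLp 2 (Fin m → ℝ)).comp h

theorem measurable_layerStep {m n : ℕ} (r : ℝ) :
    Measurable fun q : EuclideanSpace ℝ (Fin m) × (Fin n → EuclideanSpace ℝ (Fin m)) =>
      layerStep r q.1 q.2 := by
  have h : ∀ i, Measurable fun q : EuclideanSpace ℝ (Fin m) × (Fin n → EuclideanSpace ℝ (Fin m)) =>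
      r * inner ℝ q.1 (q.2 i) := fun i => by
    have h2 : Measurable fun q : EuclideanSpace ℝ (Fin m) × (Fin n → EuclideanSpace ℝ (Fin m)) =>
        q.2 i := (measurable_pi_apply i).comp measurable_snd
    exact (measurable_fst.inner h2).const_mul r
  exact (measurable_reluVec n).comp (measurable_pi_lambda _ h)

theorem measurable_layerStep_apply {Ω : Type*} [MeasurableSpace Ω] {m n : ℕ} (r : ℝ)
    {u : Ω → EuclideanSpace ℝ (Fin m)} {V : Ω → Fin n → EuclideanSpace ℝ (Fin m)}
    (hu : Measurable u) (hV : Measurable V) :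
    Measurable fun ω => layerStep r (u ω) (V ω) :=
  (measurable_layerStep r).comp (hu.prodMk hV)

theorem measurable_output {Ω : Type*} [MeasurableSpace Ω] {N : ℕ → ℕ} {W : Ω → Weights N}
    (x : Fin (N 0) → ℝ) {k : ℕ} (h : ∀ j < k, ∀ a b, Measurable fun ω => W ω j a b) :
    Measurable fun ω => output (W ω) x k := by
  induction k with
  | zero => exact measurable_const
  | succ k ih =>
    have h1 := ih fun j hj => h j (hj.trans k.lt_succ_self)
    have h2 := measurable_rowVec (h k k.lt_succ_self)
    have h3 := measurable_layerStep_apply (layerScale N k) h1 h2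
    simp_rw [output_succ]
    exact h3

/-! ### The law of one layer -/

theorem pi_gaussian_map_curry (n m : ℕ) :
    (Measure.pi fun _ : Fin n × Fin m => gaussianReal 0 1).map (fun f i j => f (i, j))
      = Measure.pi fun _ : Fin n => Measure.pi fun _ : Fin m => gaussianReal 0 1 := by
  have hm1 : Measurable fun (f : Fin n → Fin m → ℝ) (p : Fin n × Fin m) => f p.1 p.2 :=
    measurable_pi_lambda _ fun p => (measurable_pi_apply p.2).comp (measurable_pi_apply p.1)
  have hm2 : Measurable fun (f : Fin n × Fin m → ℝ) (i : Fin n) (j : Fin m) => f (i, j) :=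
    measurable_pi_lambda _ fun i => measurable_pi_lambda _ fun j => measurable_pi_apply (i, j)
  have h : (Measure.pi fun _ : Fin n × Fin m => gaussianReal 0 1) =
      (Measure.pi fun _ : Fin n => Measure.pi fun _ : Fin m => gaussianReal 0 1).map
        (fun f p => f p.1 p.2) := by
    refine Measure.pi_eq fun s hs => ?_
    rw [Measure.map_apply hm1 (MeasurableSet.univ_pi hs)]
    have e : (fun (f : Fin n → Fin m → ℝ) (p : Fin n × Fin m) => f p.1 p.2) ⁻¹' Set.univ.pi s
        = Set.univ.pi fun i => Set.univ.pi fun j => s (i, j) := by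
      ext f
      simp [Set.mem_pi]
    rw [e, Measure.pi_pi]
    simp_rw [Measure.pi_pi]
    rw [Fintype.prod_prod_type]
  rw [h, Measure.map_map hm2 hm1]
  exact Measure.map_id

/-- The law of the rows of a matrix with independent standard Gaussian entries. -/
noncomputable def rowLaw (m n : ℕ) : Measure (Fin n → EuclideanSpace ℝ (Fin m)) :=
  Measure.pi fun _ => stdGaussian (EuclideanSpace ℝ (Fin m))

instance (m n : ℕ) : IsProbabilityMeasure (rowLaw m n) := by unfold rowLaw; infer_instance

theorem pi_gaussian_map_rowVec (n m : ℕ) :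
    (Measure.pi fun _ : Fin n × Fin m => gaussianReal 0 1).map
      (fun f => rowVec (fun i j => f (i, j))) = rowLaw m n := by
  have hm2 : Measurable fun (f : Fin n × Fin m → ℝ) (i : Fin n) (j : Fin m) => f (i, j) :=
    measurable_pi_lambda _ fun i => measurable_pi_lambda _ fun j => measurable_pi_apply (i, j)
  have hm3 : Measurable fun (f : Fin n → Fin m → ℝ) (i : Fin n) =>
      (WithLp.toLp 2 (f i) : EuclideanSpace ℝ (Fin m)) :=
    measurable_pi_lambda _ fun i => (WithLp.measurable_toLp 2 _).comp (measurable_pi_apply i)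
  have e : (fun f : Fin n × Fin m → ℝ => rowVec (fun i j => f (i, j)))
      = (fun (f : Fin n → Fin m → ℝ) (i : Fin n) =>
        (WithLp.toLp 2 (f i) : EuclideanSpace ℝ (Fin m))) ∘ fun f i j => f (i, j) := rfl
  rw [e, ← Measure.map_map hm3 hm2, pi_gaussian_map_curry, rowLaw, ← map_pi_eq_stdGaussian]
  have : ∀ _ : Fin n, IsProbabilityMeasure ((Measure.pi fun _ : Fin m => gaussianReal 0 1).map
      (WithLp.toLp 2)) := fun _ =>
    Measure.isProbabilityMeasure_map (WithLp.measurable_toLp 2 _).aemeasurable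
  exact Measure.pi_map_pi fun _ => (WithLp.measurable_toLp 2 _).aemeasurable

theorem rowLaw_map_inner_pair {m : ℕ} (n : ℕ) (u v : EuclideanSpace ℝ (Fin m)) :
    (rowLaw m n).map (fun V i => (inner ℝ u (V i), inner ℝ v (V i))) =
      (layerLaw n).map fun ω i => (‖u‖ * proj 0 (ω i), ‖v‖ * proj (pairAngle (u, v)) (ω i)) := by
  have hm1 : Measurable fun w : EuclideanSpace ℝ (Fin m) => (inner ℝ u w, inner ℝ v w) := by
    fun_prop
  have hm2 : Measurable fun p : ℝ × ℝ => (‖u‖ * proj 0 p, ‖v‖ * proj (pairAngle (u, v)) p) := by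
    fun_prop
  have i1 := Measure.isProbabilityMeasure_map (μ := stdGaussian (EuclideanSpace ℝ (Fin m)))
    hm1.aemeasurable
  have i2 := Measure.isProbabilityMeasure_map (μ := pairLaw) hm2.aemeasurable
  have h1 := Measure.pi_map_pi (ι := Fin n) (hμ := fun _ => inferInstance)
    (μ := fun _ => stdGaussian (EuclideanSpace ℝ (Fin m)))
    (f := fun _ w => (inner ℝ u w, inner ℝ v w)) fun _ => hm1.aemeasurable
  have h2 := Measure.pi_map_pi (ι := Fin n) (hμ := fun _ => inferInstance) (μ := fun _ => pairLaw)
    (f := fun _ p => (‖u‖ * proj 0 p, ‖v‖ * proj (pairAngle (u, v)) p)) fun _ => hm2.aemeasurable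
  rw [rowLaw, layerLaw, h1, h2]
  exact congrArg Measure.pi (funext fun _ => stdGaussian_map_inner_pair u v)

/-- Given the outputs `u`, `v` of a layer, the probability that the next layer is nondegenerate with
angle in `B` depends only on the angle between `u` and `v`. -/
theorem rowLaw_layerStep_event {m n : ℕ} {r : ℝ} (hr : 0 < r) {u v : EuclideanSpace ℝ (Fin m)}
    (hu : u ≠ 0) (hv : v ≠ 0) {B : Set ℝ} (hB : MeasurableSet B) :
    rowLaw m n {V | (layerStep r u V, layerStep r v V) ∈ nonparallel (EuclideanSpace ℝ (Fin n)) ∧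
      pairAngle (layerStep r u V, layerStep r v V) ∈ B} =
    layerLaw n (modelEvent n B (pairAngle (u, v))) := by
  let S : Set (EuclideanSpace ℝ (Fin n) × EuclideanSpace ℝ (Fin n)) :=
    {p | p ∈ nonparallel _ ∧ pairAngle p ∈ B}
  let F : (Fin n → ℝ × ℝ) → EuclideanSpace ℝ (Fin n) × EuclideanSpace ℝ (Fin n) :=
    fun ζ => (reluVec fun i => r * (ζ i).1, reluVec fun i => r * (ζ i).2)
  have hF : Measurable F := by
    refine Measurable.prodMk ((measurable_reluVec n).comp (measurable_pi_lambda _ fun i => ?_))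
      ((measurable_reluVec n).comp (measurable_pi_lambda _ fun i => ?_))
    · exact ((measurable_pi_apply i).fst).const_mul r
    · exact ((measurable_pi_apply i).snd).const_mul r
  have hS : MeasurableSet (F ⁻¹' S) := hF (measurableSet_angle_event hB)
  have hm1 : Measurable fun (V : Fin n → EuclideanSpace ℝ (Fin m)) (i : Fin n) =>
      ((inner ℝ u (V i) : ℝ), (inner ℝ v (V i) : ℝ)) :=
    measurable_pi_lambda _ fun i => by fun_prop
  have hm2 : Measurable fun (ω : Fin n → ℝ × ℝ) (i : Fin n) =>
      (‖u‖ * proj 0 (ω i), ‖v‖ * proj (pairAngle (u, v)) (ω i)) :=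
    measurable_pi_lambda _ fun i => by fun_prop
  have h := congrArg (fun μ => μ (F ⁻¹' S)) (rowLaw_map_inner_pair n u v)
  simp only [Measure.map_apply hm1 hS, Measure.map_apply hm2 hS] at h
  refine h.trans (congrArg _ ?_)
  ext ω
  have e1 : ∀ (w : EuclideanSpace ℝ (Fin m)) (t : ℝ),
      (reluVec fun i => r * (‖w‖ * proj t (ω i))) = (r * ‖w‖) • reluVec fun i => proj t (ω i) := by
    intro w t
    rw [← reluVec_smul (mul_nonneg hr.le (norm_nonneg w))]
    simp_rw [mul_assoc]
  have hu' : 0 < r * ‖u‖ := mul_pos hr (norm_pos_iff.2 hu)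
  have hv' : 0 < r * ‖v‖ := mul_pos hr (norm_pos_iff.2 hv)
  have e2 := pairAngle_smul_smul hu' hv' (modelOutput (pairAngle (u, v)) ω)
  have e3 := smul_smul_mem_nonparallel hu' hv' (modelOutput (pairAngle (u, v)) ω)
  simp only [Set.mem_preimage, S, F, Set.mem_ofPred_eq, modelEvent, e1]
  rw [← e2, ← e3]
  rfl

theorem layerStep_zero_left {m n : ℕ} (r : ℝ) (V : Fin n → EuclideanSpace ℝ (Fin m)) :
    layerStep r 0 V = 0 := by
  ext i; simp [layerStep, reluVec, relu]

theorem layerStep_zero_scale {m n : ℕ} (u : EuclideanSpace ℝ (Fin m))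
    (V : Fin n → EuclideanSpace ℝ (Fin m)) : layerStep 0 u V = 0 := by
  ext i; simp [layerStep, reluVec, relu]

/-! ### Disintegration with respect to the angle in the previous layer -/

section Network

variable {Ω : Type*} [MeasurableSpace Ω] {P : Measure Ω} {L : ℕ}
  {N : ℕ → ℕ} {W : Ω → Weights N}

theorem IsGaussianInit.map_rowVec [IsProbabilityMeasure P] (hW : IsGaussianInit P L W) {k : ℕ}
    (hk : k < L) :
    P.map (fun ω => rowVec (W ω k)) = rowLaw (N k) (N (k + 1)) := by
  have hinj : Function.Injective fun p : Fin (N (k + 1)) × Fin (N k) =>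
      (⟨⟨k, hk⟩, p⟩ : Σ k : Fin L, Fin (N (k + 1)) × Fin (N k)) := by
    intro p q h
    simpa using h
  have hind := hW.indep_entries.precomp hinj
  have hmeas : ∀ p : Fin (N (k + 1)) × Fin (N k), Measurable fun ω => W ω k p.1 p.2 := fun p =>
    hW.measurable_entry k hk p.1 p.2
  have h := (iIndepFun_iff_map_fun_eq_pi_map fun p => (hmeas p).aemeasurable).1 hind
  simp only [hW.gaussian_entry k hk] at h
  rw [← pi_gaussian_map_rowVec, ← h, Measure.map_map ?_ (measurable_pi_lambda _ hmeas)]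
  · rfl
  · exact measurable_rowVec fun i j => measurable_pi_apply (i, j)

/-- The outputs in layer `k` depend on the first `k` weight matrices only. -/
theorem IsGaussianInit.indepFun_output_rowVec (hW : IsGaussianInit P L W) {k : ℕ} (hk : k < L)
    (x y : Fin (N 0) → ℝ) :
    IndepFun (fun ω => (output (W ω) x k, output (W ω) y k)) (fun ω => rowVec (W ω k)) P := by
  classical
  let S : Finset (Σ k : Fin L, Fin (N (k + 1)) × Fin (N k)) :=
    Finset.univ.filter fun e => (e.1 : ℕ) < k
  let T : Finset (Σ k : Fin L, Fin (N (k + 1)) × Fin (N k)) :=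
    Finset.univ.filter fun e => (e.1 : ℕ) = k
  have hST : Disjoint S T := by
    rw [Finset.disjoint_left]
    intro e he he'
    simp only [S, T, Finset.mem_filter, Finset.mem_univ, true_and] at he he'
    omega
  have hind := hW.indep_entries.indepFun_finset S T hST fun e =>
    hW.measurable_entry e.1 e.1.2 e.2.1 e.2.2
  -- the weights rebuilt from the entries of the first `k` matrices, with `0` for all others
  let R : (S → ℝ) → Weights N := fun s j a b =>
    if h : j < k then s ⟨⟨⟨j, h.trans hk⟩, (a, b)⟩, by simp [S, h]⟩ else 0
  have hR : ∀ j < k, ∀ a b, Measurable fun s => R s j a b := by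
    intro j hj a b
    simp only [R, dif_pos hj]
    exact measurable_pi_apply _
  let Q : (T → ℝ) → Matrix (Fin (N (k + 1))) (Fin (N k)) ℝ := fun t a b =>
    t ⟨⟨⟨k, hk⟩, (a, b)⟩, by simp [T]⟩
  have hQ : ∀ a b, Measurable fun t => Q t a b := fun a b => measurable_pi_apply _
  have h := hind.comp ((measurable_output x hR).prodMk (measurable_output y hR))
    (measurable_rowVec hQ)
  have e : ∀ ω, ∀ j < k, R (fun i : S => W ω i.1.1 i.1.2.1 i.1.2.2) j = W ω j := by
    intro ω j hj
    ext a b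
    simp only [R, dif_pos hj]
  convert h using 1
  · ext1 ω
    simp only [Function.comp_apply]
    rw [output_congr x (e ω), output_congr y (e ω)]
  · rfl

theorem IsGaussianInit.measurable_outputs (hW : IsGaussianInit P L W) {k : ℕ} (hk : k ≤ L)
    (x y : Fin (N 0) → ℝ) : Measurable fun ω => (output (W ω) x k, output (W ω) y k) :=
  (measurable_output x fun j hj => hW.measurable_entry j (hj.trans_le hk)).prodMk
    (measurable_output y fun j hj => hW.measurable_entry j (hj.trans_le hk))

theorem IsGaussianInit.measurable_layerAngle (hW : IsGaussianInit P L W) {k : ℕ} (hk : k ≤ L)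
    (x y : Fin (N 0) → ℝ) : Measurable fun ω => layerAngle (W ω) x y k := by
  have h := hW.measurable_outputs hk x y
  have h' := measurable_pairAngle.comp h
  exact h'

theorem IsGaussianInit.measurableSet_nondegenerateAt (hW : IsGaussianInit P L W) {k : ℕ}
    (hk : k ≤ L) (x y : Fin (N 0) → ℝ) : MeasurableSet {ω | NondegenerateAt (W ω) x y k} := by
  have h := hW.measurable_outputs hk x y
  have h' := h measurableSet_nonparallel
  exact h'

/-- The joint law of the angles in two consecutive layers, on the event of nondegeneracy, as a
mixture of the laws in the model layer. The mixing measure is the law of the angle on the event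
that both inputs of the layer are nonzero; it vanishes if the scale of the layer is `0`, which
happens for a layer of width `0`. -/
theorem IsGaussianInit.exists_mixing_measure [IsProbabilityMeasure P]
    (hW : IsGaussianInit P L W) {k : ℕ} (hk : k < L) (x y : Fin (N 0) → ℝ) :
    ∃ τ : Measure ℝ, IsFiniteMeasure τ ∧ τ (Set.Icc 0 Real.pi)ᶜ = 0 ∧
      ∀ A B : Set ℝ, MeasurableSet A → MeasurableSet B →
        P {ω | layerAngle (W ω) x y k ∈ A ∧ NondegenerateAt (W ω) x y (k + 1) ∧
          layerAngle (W ω) x y (k + 1) ∈ B} =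
        ∫⁻ θ in A, layerLaw (N (k + 1)) (modelEvent (N (k + 1)) B θ) ∂τ := by
  set m := N k with hm
  set n := N (k + 1) with hn
  set r := layerScale N k with hr
  have hU : Measurable fun ω => (output (W ω) x k, output (W ω) y k) :=
    hW.measurable_outputs hk.le x y
  have hV : Measurable fun ω => rowVec (W ω k) := measurable_rowVec (hW.measurable_entry k hk)
  set η := P.map fun ω => (output (W ω) x k, output (W ω) y k) with hη
  have : IsProbabilityMeasure η := Measure.isProbabilityMeasure_map hU.aemeasurable
  have hjoint := (indepFun_iff_map_prod_eq_prod_map_map hU.aemeasurable hV.aemeasurable).1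
    (hW.indepFun_output_rowVec hk x y)
  rw [hW.map_rowVec hk, ← hη] at hjoint
  let D : Set (EuclideanSpace ℝ (Fin m) × EuclideanSpace ℝ (Fin m)) :=
    {p | (r ≠ 0 ∧ p.1 ≠ 0) ∧ p.2 ≠ 0}
  have hD : MeasurableSet D :=
    ((MeasurableSet.const _).inter (measurable_fst (measurableSet_singleton 0).compl)).inter
      (measurable_snd (measurableSet_singleton 0).compl)
  refine ⟨(η.restrict D).map pairAngle, inferInstance, ?_, fun A B hA hB => ?_⟩
  · rw [Measure.map_apply measurable_pairAngle measurableSet_Icc.compl]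
    convert measure_empty (μ := η.restrict D)
    ext p
    simp only [Set.mem_preimage, Set.mem_compl_iff, Set.mem_empty_iff_false, iff_false, not_not]
    exact ⟨InnerProductGeometry.angle_nonneg _ _, InnerProductGeometry.angle_le_pi _ _⟩
  · rw [setLIntegral_map hA (measurable_measure_modelEvent n hB) measurable_pairAngle,
      Measure.restrict_restrict (measurable_pairAngle hA),
      ← lintegral_indicator ((measurable_pairAngle hA).inter hD)]
    let F : (EuclideanSpace ℝ (Fin m) × EuclideanSpace ℝ (Fin m)) ×
        (Fin n → EuclideanSpace ℝ (Fin m)) →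
        EuclideanSpace ℝ (Fin n) × EuclideanSpace ℝ (Fin n) :=
      fun q => (layerStep r q.1.1 q.2, layerStep r q.1.2 q.2)
    have hF : Measurable F :=
      (measurable_layerStep_apply r measurable_fst.fst measurable_snd).prodMk
        (measurable_layerStep_apply r measurable_fst.snd measurable_snd)
    have hS : MeasurableSet {q : (EuclideanSpace ℝ (Fin m) × EuclideanSpace ℝ (Fin m)) ×
        (Fin n → EuclideanSpace ℝ (Fin m)) | pairAngle q.1 ∈ A ∧
          (F q ∈ nonparallel _ ∧ pairAngle (F q) ∈ B)} :=
      ((measurable_pairAngle.comp measurable_fst) hA).inter (hF (measurableSet_angle_event hB))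
    have h := congrArg (fun μ => μ {q : (EuclideanSpace ℝ (Fin m) × EuclideanSpace ℝ (Fin m)) ×
        (Fin n → EuclideanSpace ℝ (Fin m)) | pairAngle q.1 ∈ A ∧
          (F q ∈ nonparallel _ ∧ pairAngle (F q) ∈ B)}) hjoint
    simp only [Measure.map_apply (hU.prodMk hV) hS] at h
    rw [Measure.prod_apply hS] at h
    refine Eq.trans ?_ (h.trans (lintegral_congr fun p => ?_))
    · congr 1
      ext ω
      simp only [Set.mem_preimage, Set.mem_ofPred_eq, F, NondegenerateAt, layerAngle, output_succ]
      rfl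
    · by_cases hp : p ∈ D
      · by_cases hpA : pairAngle p ∈ A
        · rw [Set.indicator_of_mem (show p ∈ pairAngle ⁻¹' A ∩ D from ⟨hpA, hp⟩)]
          rw [← rowLaw_layerStep_event (lt_of_le_of_ne (layerScale_nonneg N k) hp.1.1.symm)
            hp.1.2 hp.2 hB]
          congr 1
          ext V
          simp [hpA, F, hr]
        · rw [Set.indicator_of_notMem fun h' => hpA h'.1]
          convert measure_empty (μ := rowLaw m n)
          ext V
          simp [hpA]
      · rw [Set.indicator_of_notMem fun h' => hp h'.2]
        convert measure_empty (μ := rowLaw m n)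
        ext V
        simp only [Set.mem_preimage, Set.mem_ofPred_eq, Set.mem_empty_iff_false, iff_false]
        rintro ⟨-, ⟨h1, h2, -⟩, -⟩
        refine hp ⟨⟨fun h0 => h1 ?_, fun h0 => h1 ?_⟩, fun h0 => h2 ?_⟩
        · simp only [F, h0, layerStep_zero_scale]
        · simp only [F, h0, layerStep_zero_left]
        · simp only [F, h0, layerStep_zero_left]

/-- The conditional law of the angle is the one of the model layer. If nondegeneracy has probability
`0` then `angleLaw` is the zero measure. -/
theorem IsGaussianInit.condAngleLaw_ae_eq [IsProbabilityMeasure P] (hW : IsGaussianInit P L W)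
    {k : ℕ} (hk : k < L) (x y : Fin (N 0) → ℝ) :
    condAngleLaw P W x y k =ᵐ[angleLaw P W x y k] angleKernel (N (k + 1)) := by
  obtain ⟨τ, hτ, -, h⟩ := hW.exists_mixing_measure hk x y
  have hΘ := hW.measurable_layerAngle hk.le x y
  have hT := hW.measurable_layerAngle (Nat.succ_le_of_lt hk) x y
  have hE := hW.measurableSet_nondegenerateAt (Nat.succ_le_of_lt hk) x y
  set n := N (k + 1) with hn
  -- the density of the angle with respect to the mixing measure is the probability of
  -- nondegeneracy, which cancels the normalization of the kernel
  have hden : angleLaw P W x y k = (P {ω | NondegenerateAt (W ω) x y (k + 1)})⁻¹ •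
      τ.withDensity fun θ => layerLaw n (modelEvent n Set.univ θ) := by
    ext s hs
    rw [angleLaw, Measure.map_apply hΘ hs, cond_apply hE, Measure.smul_apply,
      withDensity_apply _ hs, ← h s Set.univ hs .univ, smul_eq_mul]
    congr 2
    ext ω
    simp [and_comm]
  refine condDistrib_ae_eq_of_measure_eq_compProd _ hT.aemeasurable ?_
  refine Measure.ext_prod fun {s t} hs ht => ?_
  rw [Measure.compProd_apply_prod hs ht]
  change _ = ∫⁻ θ in s, angleKernel n θ t ∂(angleLaw P W x y k)
  rw [hden, Measure.restrict_smul, lintegral_smul_measure,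
    setLIntegral_withDensity_eq_setLIntegral_mul _ (measurable_measure_modelEvent n .univ)
      (Kernel.measurable_coe _ ht) hs]
  simp only [Pi.mul_apply, mul_angleKernel_apply n _ ht]
  rw [← h s t hs ht, Measure.map_apply (hΘ.prodMk hT) (hs.prod ht), cond_apply hE, smul_eq_mul]
  congr 2
  ext ω
  simp only [Set.mem_inter_iff, Set.mem_ofPred_eq, Set.mem_preimage, Set.mem_prod]
  tauto

/-- Nondegeneracy in the next layer forces a positive angle. -/
theorem IsGaussianInit.angle_mem_Ioc [IsProbabilityMeasure P] (hW : IsGaussianInit P L W)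
    {k : ℕ} (hk : k < L) (x y : Fin (N 0) → ℝ) :
    ∀ᵐ θ ∂(angleLaw P W x y k), θ ∈ Set.Ioc 0 Real.pi := by
  obtain ⟨τ, hτ, h0, h⟩ := hW.exists_mixing_measure hk x y
  have hΘ := hW.measurable_layerAngle hk.le x y
  have hE := hW.measurableSet_nondegenerateAt (Nat.succ_le_of_lt hk) x y
  have hs : MeasurableSet (Set.Ioc 0 Real.pi)ᶜ := measurableSet_Ioc.compl
  have hzero : P {ω | layerAngle (W ω) x y k ∈ (Set.Ioc 0 Real.pi)ᶜ ∧
      NondegenerateAt (W ω) x y (k + 1) ∧ layerAngle (W ω) x y (k + 1) ∈ Set.univ} = 0 := by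
    -- `θ = 0` is the only angle outside the interval, and there the next layer is degenerate
    rw [h _ _ hs .univ, setLIntegral_congr_fun_ae (g := fun _ => 0) hs, lintegral_zero]
    filter_upwards [show ∀ᵐ θ ∂τ, θ ∈ Set.Icc 0 Real.pi from h0] with θ hθ hθ'
    have : θ = 0 := by
      by_contra hne
      exact hθ' ⟨lt_of_le_of_ne hθ.1 (Ne.symm hne), hθ.2⟩
    rw [this]
    convert measure_empty (μ := layerLaw (N (k + 1)))
    ext ω
    simp [modelEvent, modelOutput_zero_notMem_nonparallel]
  change angleLaw P W x y k (Set.Ioc 0 Real.pi)ᶜ = 0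
  rw [angleLaw, Measure.map_apply hΘ hs, cond_apply hE]
  convert mul_zero _
  rw [← hzero]
  congr 1
  ext ω
  simp [and_comm]

end Network

/-! ### The approximate mean and variance -/

theorem abs_rho_sub_le {n : ℕ} (hn : 2 ≤ n) : |rho n - 2 / n| ≤ 200 / (n : ℝ) ^ 2 := by
  have h2 : (2 : ℝ) ≤ n := by exact_mod_cast hn
  rw [rho]
  generalize (n : ℝ) = t at h2
  have ht : 0 < t := by linarith
  have ht1 : 0 < t - 1 := by linarith
  have ht5 : 0 < t + 5 := by linarith
  have hx : 0 < (t + 5) / (t - 1) := by positivity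
  have hlog1 : Real.log ((t + 5) / (t - 1)) - 6 / t ≤ 12 / t ^ 2 := by
    have := Real.log_le_sub_one_of_pos hx
    have e : (t + 5) / (t - 1) - 1 - 6 / t = 6 / (t * (t - 1)) := by field_simp; ring
    have : 6 / (t * (t - 1)) ≤ 12 / t ^ 2 := by
      rw [div_le_div_iff₀ (by positivity) (by positivity)]; nlinarith
    linarith
  have hlog2 : -(30 / t ^ 2) ≤ Real.log ((t + 5) / (t - 1)) - 6 / t := by
    have := Real.one_sub_inv_le_log_of_pos hx
    have e : 1 - ((t + 5) / (t - 1))⁻¹ - 6 / t = -(30 / (t * (t + 5))) := by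
      field_simp; ring
    have : 30 / (t * (t + 5)) ≤ 30 / t ^ 2 := by
      rw [div_le_div_iff₀ (by positivity) (by positivity)]; nlinarith
    linarith
  have h10 : 0 ≤ 10 / t - 10 * t / (t + 5) ^ 2 ∧ 10 / t - 10 * t / (t + 5) ^ 2 ≤ 100 / t ^ 2 := by
    have e : 10 / t - 10 * t / (t + 5) ^ 2 = (100 * t + 250) / (t * (t + 5) ^ 2) := by
      field_simp; ring
    rw [e]
    refine ⟨by positivity, ?_⟩
    rw [div_le_div_iff₀ (by positivity) (by positivity)]
    nlinarith [mul_pos ht ht, mul_pos (mul_pos ht ht) ht]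
  have h6 : 0 ≤ 6 * t / (t - 1) ^ 2 - 6 / t ∧ 6 * t / (t - 1) ^ 2 - 6 / t ≤ 36 / t ^ 2 := by
    have e : 6 * t / (t - 1) ^ 2 - 6 / t = (12 * t - 6) / (t * (t - 1) ^ 2) := by
      field_simp; ring
    rw [e]
    have : 0 ≤ 12 * t - 6 := by linarith
    refine ⟨by positivity, ?_⟩
    rw [div_le_div_iff₀ (by positivity) (by positivity)]
    have : 0 ≤ t * ((t - 2) * (24 * t - 18)) :=
      mul_nonneg ht.le (mul_nonneg (by linarith) (by linarith))
    nlinarith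
  -- the leading terms of the three summands of `rho`
  have e1 : 2 / t = 6 / t - 10 / t + 6 / t := by ring
  have e2 : 12 / t ^ 2 + 100 / t ^ 2 + 36 / t ^ 2 ≤ 200 / t ^ 2 := by
    rw [← add_div, ← add_div]; gcongr; norm_num
  have e3 : 30 / t ^ 2 ≤ 200 / t ^ 2 := by gcongr; norm_num
  rw [abs_le, e1]
  constructor <;> linarith [h10.1, h10.2, h6.1, h6.2]

/-- The mean in a layer of width `n`, up to `O(n⁻²)`. Since `rho n = 2 / n + O(n⁻²)`, the
coefficient of `1 / n` is shifted by `2`. -/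
noncomputable def layerMean (θ : ℝ) (n : ℕ) : ℝ :=
  Real.log (limitSinSq θ) - rho n + (meanCoeff θ + 2) / n

/-- The variance in a layer of width `n`, up to `O(n⁻²)`. -/
noncomputable def layerVar (θ : ℝ) (n : ℕ) : ℝ := varCoeff θ / n

theorem exists_angleKernel_moments {θ : ℝ} (hθ : θ ∈ Set.Ioc 0 Real.pi) :
    ∃ (C : ℝ) (n₀ : ℕ), ∀ n, n₀ ≤ n →
      MemLp logSinSq 2 (angleKernel n θ) ∧
      |(∫ t, logSinSq t ∂(angleKernel n θ)) - layerMean θ n| ≤ C / (n : ℝ) ^ 2 ∧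
      |variance logSinSq (angleKernel n θ) - layerVar θ n| ≤ C / (n : ℝ) ^ 2 := by
  obtain ⟨C, n₀, hC, h⟩ := exists_angleKernel hθ
  refine ⟨C + 200, max n₀ 2, fun n hn => ?_⟩
  obtain ⟨h1, h2, h3⟩ := h n ((le_max_left _ _).trans hn)
  have hr := abs_rho_sub_le ((le_max_right _ _).trans hn)
  rw [add_div]
  refine ⟨h1, ?_, h3.trans (le_add_of_nonneg_right (by positivity))⟩
  have e : (∫ t, logSinSq t ∂(angleKernel n θ)) - layerMean θ n =
      ((∫ t, logSinSq t ∂(angleKernel n θ)) - (Real.log (limitSinSq θ) + meanCoeff θ / n))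
        + (rho n - 2 / n) := by
    rw [layerMean]; ring
  rw [e]
  exact (abs_add_le _ _).trans (add_le_add h2 hr)

/-- The error terms have the form `r₀(θ) + r₁(θ) / n` and `r₂(θ) / n`, so the bounds are uniform in
the width. -/
theorem exists_abs_expansion_le : ∃ K δ : ℝ, 0 < δ ∧ ∀ θ ∈ Set.Ioo 0 δ, ∀ n : ℕ, 2 ≤ n →
    |layerMean θ n - meanExpansion θ n| ≤ K * θ ^ 3 ∧
    |layerVar θ n - varExpansion θ n| ≤ K * θ ^ 3 := by
  obtain ⟨c₀, hc₀, h₀⟩ := log_limitSinSq_isBigO.exists_nonneg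
  obtain ⟨c₁, hc₁, h₁⟩ := meanNumerator_div_isBigO.exists_nonneg
  obtain ⟨c₂, hc₂, h₂⟩ := varNumerator_div_isBigO.exists_nonneg
  obtain ⟨δ, hδ, h⟩ := mem_nhdsGT_iff_exists_Ioo_subset.1
    (inter_mem h₀.bound (inter_mem h₁.bound h₂.bound))
  refine ⟨c₀ + c₁ + c₂, δ, hδ, fun θ hθ n hn => ?_⟩
  obtain ⟨b₀, b₁, b₂⟩ := h hθ
  have hn1 : (1 : ℝ) ≤ n := by exact_mod_cast one_le_two.trans hn
  have h3 : 0 < θ ^ 3 := pow_pos hθ.1 3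
  simp only [Set.mem_ofPred_eq, Real.norm_eq_abs, abs_of_pos h3] at b₀ b₁ b₂
  have hdiv : ∀ z c : ℝ, |z| ≤ c * θ ^ 3 → |z / n| ≤ c * θ ^ 3 := by
    intro z c hz
    rw [abs_div, Nat.abs_cast]
    exact (div_le_self (abs_nonneg z) hn1).trans hz
  have p₀ : 0 ≤ c₀ * θ ^ 3 := by positivity
  have p₁ : 0 ≤ c₁ * θ ^ 3 := by positivity
  have p₂ : 0 ≤ c₂ * θ ^ 3 := by positivity
  constructor
  · have e : layerMean θ n - meanExpansion θ n =
        (Real.log (limitSinSq θ) -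
          (logSinSq θ - 2 / (3 * Real.pi) * θ - 2 / (9 * Real.pi ^ 2) * θ ^ 2)) +
        (meanNumerator θ / limitSinSq θ ^ 2 + 2 -
          (-(8 / (15 * Real.pi)) * θ + 68 / (45 * Real.pi ^ 2) * θ ^ 2)) / n := by
      rw [layerMean, meanExpansion, meanCoeff]
      field_simp
      ring
    rw [e]
    have := (abs_add_le _ _).trans (add_le_add b₀ (hdiv _ _ b₁))
    linarith
  · have e : layerVar θ n - varExpansion θ n =
        (varNumerator θ / limitSinSq θ ^ 2 - (8 - 64 / (15 * Real.pi) * θ -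
          (8 + 296 / (45 * Real.pi ^ 2)) * θ ^ 2)) / n := by
      rw [layerVar, varExpansion, varCoeff]
      ring
    rw [e]
    have := hdiv _ _ b₂
    linarith

end ReluNetwork

theorem theorem1 :
    ∃ (μ σsq : ℝ → ℕ → ℝ) (C : ℝ → ℝ) (n₀ : ℝ → ℕ),
      -- for a fixed angle, the dependence of `μ` and `σsq` on the width is explicit
      (∀ θ ∈ Set.Ioc 0 Real.pi, ∃ m₀ m₁ s : ℝ, ∀ n : ℕ, 2 ≤ n →
        μ θ n = m₀ - ReluNetwork.rho n + m₁ / n ∧ σsq θ n = s / n) ∧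
      -- small-angle expansions, uniformly in the width
      (∃ K δ : ℝ, 0 < δ ∧ ∀ θ ∈ Set.Ioo 0 δ, ∀ n : ℕ, 2 ≤ n →
        |μ θ n - ReluNetwork.meanExpansion θ n| ≤ K * θ ^ 3 ∧
        |σsq θ n - ReluNetwork.varExpansion θ n| ≤ K * θ ^ 3) ∧
      -- conditional mean and variance in the next layer
      (∀ (Ω : Type*) [MeasurableSpace Ω] (P : Measure Ω) [IsProbabilityMeasure P]
        (L : ℕ) (N : ℕ → ℕ) (W : Ω → ReluNetwork.Weights N) (x y : Fin (N 0) → ℝ) (k : ℕ),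
        ReluNetwork.IsGaussianInit P L W → k < L →
        ∀ᵐ θ ∂(ReluNetwork.angleLaw P W x y k),
          θ ∈ Set.Ioc 0 Real.pi ∧
          (n₀ θ ≤ N (k + 1) →
            MemLp ReluNetwork.logSinSq 2 (ReluNetwork.condAngleLaw P W x y k θ) ∧
            |(∫ t, ReluNetwork.logSinSq t ∂(ReluNetwork.condAngleLaw P W x y k θ))
                - μ θ (N (k + 1))| ≤ C θ / (N (k + 1) : ℝ) ^ 2 ∧
            |variance ReluNetwork.logSinSq (ReluNetwork.condAngleLaw P W x y k θ)
                - σsq θ (N (k + 1))| ≤ C θ / (N (k + 1) : ℝ) ^ 2)) := by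
  classical
  choose! C n₀ h using fun θ (hθ : θ ∈ Set.Ioc 0 Real.pi) =>
    ReluNetwork.exists_angleKernel_moments hθ
  refine ⟨ReluNetwork.layerMean, ReluNetwork.layerVar, C, n₀, fun θ _ =>
    ⟨_, _, _, fun n _ => ⟨rfl, rfl⟩⟩, ReluNetwork.exists_abs_expansion_le, ?_⟩
  intro Ω _ P _ L N W x y k hW hk
  filter_upwards [hW.angle_mem_Ioc hk x y, hW.condAngleLaw_ae_eq hk x y] with θ hθ heq
  rw [heq]
  exact ⟨hθ, h θ hθ _⟩
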